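/- Let $p,q,t\in\mathbb C$ with $|p|<1$, $q,t\neq 0$ and $|q|,|t|\neq 1$, and assume that $q^a\neq p^b$ and $t^a\neq p^b$ for all integers $a>0$ and $b$ (that is, $q,t\notin p^{\mathbb Q}$; for $p=0$ this is automatic). Let $$\theta(z;p)=\prod_{j\ge 0}(1-p^jz)\Bigl(1-\frac{p^{j+1}}z\Bigr),\qquad (a;q,p)_k=\prod_{l=0}^{k-1}\theta(aq^l;p),\qquad \Gamma(x;p,s)=\prod_{j,k\ge 0}\frac{1-p^{j+1}s^{k+1}/x}{1-p^js^kx}\quad(|s|<1),$$ and for $|s|>1$ interpret the symbol $\Gamma(x;p,s)$ as $1/\Gamma(s^{-1}x;p,s^{-1})$. For $m,r,k\in\mathbb Z_{\ge 0}$ define the difference operator $$\mathbf H^{(k)}_{m,r}(z;w)=\sum_{\substack{\mu\in\mathbb Z_{\ge 0}^m,\ I\subseteq\{1,\dots,r\}\\ |\mu|+|I|=k}}C_{\mu,I}(z;w)\,T^{\mu}_{q,z}T^{I}_{t^{-1},w},$$ where $|\mu|=\mu_1+\dots+\mu_m$, $T^\mu_{q,z}$ replaces each $z_i$ by $q^{\mu_i}z_i$,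 $T^I_{t^{-1},w}$ replaces $w_j$ by $t^{-1}w_j$ for $j\in I$, and, with $I^c=\{1,\dots,r\}\setminus I$, $$\begin{aligned}C_{\mu,I}(z;w)={}&(-1)^{|I|}(t^{-m}q^r)^{|\mu|}q^{\binom{|I|}2}\prod_{i\in I,\,j\in I^c}\frac{\theta(qw_j/w_i;p)}{\theta(w_j/w_i;p)}\prod_{i,j=1}^m\frac{(tz_i/z_j;q,p)_{\mu_i}}{(qz_i/z_j;q,p)_{\mu_i}}\prod_{1\le i<j\le m}\frac{q^{\mu_j}\theta(q^{\mu_i-\mu_j}z_i/z_j;p)}{\theta(z_i/z_j;p)}\\&\times\prod_{i=1}^m\Bigl(\prod_{j\in I}\frac{\theta(z_i/tw_j;p)}{\theta(q^{\mu_i}z_i/w_j;p)}\prod_{j\in I^c}\frac{\theta(z_i/qw_j;p)}{\theta(q^{\mu_i-1}z_i/w_j;p)}\Bigr).\end{aligned}$$ For $m,r,n,s\in\mathbb Z_{\ge 0}$, let $$\begin{aligned}\mathbf\Phi(z;w;Z;W)={}&\prod_{i=1}^m\prod_{j=1}^n\frac{\Gamma(t^{-1}z_iZ_j;p,q)}{\Gamma(z_iZ_j;p,q)}\prod_{i=1}^r\prod_{j=1}^s\frac{\Gamma(qw_iW_j;p,t^{-1})}{\Gamma(w_iW_j;p,t^{-1})}\\&\times\prod_{i=1}^m\prod_{j=1}^s\theta(z_iW_j;p)\prod_{i=1}^r\prod_{j=1}^n\theta(w_iZ_j;p).\end{aligned}$$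 If $t^{m-n}=q^{r-s}$, then for every $k\in\mathbb Z_{\ge 0}$ $$\mathbf H^{(k)}_{m,r}(z;w)\,\mathbf\Phi(z;w;Z;W)=\mathbf H^{(k)}_{n,s}(Z;W)\,\mathbf\Phi(z;w;Z;W)$$ as meromorphic functions of $(z;w;Z;W)\in(\mathbb C\setminus\{0\})^{m+r+n+s}$. More precisely, the equality holds at every point where the denominators of the coefficients do not vanish and no gamma function occurring in a value of $\mathbf\Phi$ on either side has a pole or a zero. -/

import Mathlib

open Finset

noncomputable section

namespace DeformedRuijsenaars

/-- The multiplicative theta function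
`θ(z;p) = ∏_{j ≥ 0} (1 - p^j z)(1 - p^{j+1}/z)`, for `|p| < 1` and `z ≠ 0`. -/
def theta (p z : ℂ) : ℂ :=
  ∏' j : ℕ, (1 - p ^ j * z) * (1 - p ^ (j + 1) / z)

/-- The elliptic shifted factorial
`(a;q,p)_k = θ(a;p) θ(aq;p) ⋯ θ(aq^{k-1};p)`. -/
def thetaFactorial (p q a : ℂ) (k : ℕ) : ℂ :=
  ∏ l ∈ range k, theta p (a * q ^ l)

/-- The elliptic gamma function
`Γ(x;p,q) = ∏_{j,k ≥ 0} (1 - p^{j+1} q^{k+1}/x) / (1 - p^j q^k x)`, for `|p|, |q| < 1`. -/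
def ellipticGamma (p q x : ℂ) : ℂ :=
  ∏' a : ℕ × ℕ,
    (1 - p ^ (a.1 + 1) * q ^ (a.2 + 1) / x) / (1 - p ^ a.1 * q ^ a.2 * x)

/-- The point `x` is neither a pole nor a zero of `Γ(·;p,q)`. -/
def EllipticGammaRegular (p q x : ℂ) : Prop :=
  ∀ j k : ℕ, p ^ j * q ^ k * x ≠ 1 ∧ p ^ (j + 1) * q ^ (k + 1) ≠ x

/-- The solution of `g(s x) = θ(x;p) g(x)` that enters the kernel function: it is `Γ(x;p,s)` for
`|s| < 1`, and `1 / Γ(s⁻¹ x;p,s⁻¹)` for `|s| > 1`. -/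
def gammaSol (p s x : ℂ) : ℂ :=
  if ‖s‖ < 1 then ellipticGamma p s x else (ellipticGamma p s⁻¹ (s⁻¹ * x))⁻¹

/-- The point `x` is neither a pole nor a zero of `gammaSol p s`. -/
def GammaSolRegular (p s x : ℂ) : Prop :=
  if ‖s‖ < 1 then EllipticGammaRegular p s x else EllipticGammaRegular p s⁻¹ (s⁻¹ * x)

/-- The coefficient `C_{μ,I}(z;w)` of the multiplicative deformed Ruijsenaars operator. -/
def coeff (p q t : ℂ) {m r : ℕ} (μ : Fin m → ℕ) (I : Finset (Fin r))
    (z : Fin m → ℂ) (w : Fin r → ℂ) : ℂ :=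
  (-1) ^ #I * ((t ^ m)⁻¹ * q ^ r) ^ (∑ i, μ i) * q ^ (Nat.choose #I 2)
    * (∏ i ∈ I, ∏ j ∈ Iᶜ, theta p (q * w j / w i) / theta p (w j / w i))
    * (∏ i, ∏ j, thetaFactorial p q (t * z i / z j) (μ i)
        / thetaFactorial p q (q * z i / z j) (μ i))
    * (∏ i, ∏ j ∈ Ioi i,
        q ^ (μ j) * theta p (q ^ ((μ i : ℤ) - (μ j : ℤ)) * z i / z j) / theta p (z i / z j))
    * (∏ i,
        (∏ j ∈ I, theta p (z i / (t * w j)) / theta p (q ^ (μ i) * z i / w j))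
        * (∏ j ∈ Iᶜ, theta p (z i / (q * w j)) / theta p (q ^ ((μ i : ℤ) - 1) * z i / w j)))

/-- The shift `z ↦ (q^{μ_1} z_1, …, q^{μ_m} z_m)`. -/
def shiftZ (q : ℂ) {m : ℕ} (μ : Fin m → ℕ) (z : Fin m → ℂ) : Fin m → ℂ :=
  fun i => q ^ (μ i) * z i

/-- The shift multiplying the variables `w_j`, `j ∈ I`, by `t⁻¹` and fixing the others. -/
def shiftW (t : ℂ) {r : ℕ} (I : Finset (Fin r)) (w : Fin r → ℂ) : Fin r → ℂ :=
  fun j => if j ∈ I then t⁻¹ * w j else w j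

/-- The operator `𝐇_{m,r}^{(k)}(z;w;q,t) = ∑_{|μ|+|I|=k} C_{μ,I}(z;w) T_{q,z}^μ T_{t⁻¹,w}^I`
applied to a function of `m + r` variables. Here `μ` runs over `(ℤ_{≥0})^m` and `I` over the
subsets of the `r` indices. -/
def opH (p q t : ℂ) {m r : ℕ} (k : ℕ) (f : (Fin m → ℂ) → (Fin r → ℂ) → ℂ)
    (z : Fin m → ℂ) (w : Fin r → ℂ) : ℂ :=
  ∑ l ∈ antidiagonal k, ∑ μ ∈ piAntidiag (univ : Finset (Fin m)) l.1,
    ∑ I ∈ powersetCard l.2 (univ : Finset (Fin r)),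
      coeff p q t μ I z w * f (shiftZ q μ z) (shiftW t I w)

/-- The multiplicative kernel function `𝚽^{(m,r,n,s)}(z;w;Z;W)`. -/
def kernelPhi (p q t : ℂ) {m r n s : ℕ} (z : Fin m → ℂ) (w : Fin r → ℂ)
    (Z : Fin n → ℂ) (W : Fin s → ℂ) : ℂ :=
  (∏ i, ∏ j, gammaSol p q (t⁻¹ * z i * Z j) / gammaSol p q (z i * Z j))
    * (∏ i, ∏ j, gammaSol p t⁻¹ (q * w i * W j) / gammaSol p t⁻¹ (w i * W j))
    * (∏ i, ∏ j, theta p (z i * W j))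
    * (∏ i, ∏ j, theta p (w i * Z j))

/-- None of the gamma factors of `kernelPhi` has a pole or a zero at `(z;w;Z;W)`. -/
def KernelRegular (p q t : ℂ) {m r n s : ℕ} (z : Fin m → ℂ) (w : Fin r → ℂ)
    (Z : Fin n → ℂ) (W : Fin s → ℂ) : Prop :=
  (∀ i j, GammaSolRegular p q (t⁻¹ * z i * Z j) ∧ GammaSolRegular p q (z i * Z j)) ∧
  (∀ i j, GammaSolRegular p t⁻¹ (q * w i * W j) ∧ GammaSolRegular p t⁻¹ (w i * W j))

/-- The variables are non-zero, and none of the variable-dependent denominators of the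
coefficients `C_{μ,I}(z;w)`, `|μ| + |I| = k`, vanishes. -/
def CoeffRegular (p q : ℂ) {m r : ℕ} (k : ℕ) (z : Fin m → ℂ) (w : Fin r → ℂ) : Prop :=
  (∀ i, z i ≠ 0) ∧ (∀ j, w j ≠ 0) ∧
  (∀ i j, i ≠ j → ∀ a : ℕ, a ≤ k → theta p (q ^ a * z i / z j) ≠ 0) ∧
  (∀ i j, i ≠ j → theta p (w j / w i) ≠ 0) ∧
  (∀ i j, ∀ a : ℤ, -1 ≤ a → a < k → theta p (q ^ a * z i / w j) ≠ 0)

end DeformedRuijsenaars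

end

/-!
# The kernel function identity for the deformed Ruijsenaars operators

**Reduction to theta functions.** The gamma factors satisfy `g(s x) = θ(x;p) g(x)`, also for
`|s| > 1`. So all values of the kernel function that occur in the operator of order `k` are
multiples, by products of theta functions, of one and the same product of gamma functions
(`kernelPhi_shift`), and this product is symmetric under the exchange of `(z;w)` and `(Z;W)`. What
remains is an identity between two finite sums of products of theta functions, `reducedSum`.

**The duality transformation.** That identity is the special case of the Kajihara–Noumi duality
transformation `kajiharaSum_comm` in which every `z_i` and `Z_j` carries the parameter `t` and every
`w_i` and `W_j` the parameter `q⁻¹` (`coeff_eq`, `reducedKernel_eq`, `reducedSum_eq_kajiharaSum`).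
With the parameter `q⁻¹` a variable can be shifted at most once, as `θ(1;p) = 0`, and this is why
subsets `I` occur in the operator. The balancing condition of the transformation is
`t^{m-n} = q^{r-s}`.

**Proof of the duality transformation.** The three-term identity of the theta function
(`weierstrass`) gives Frobenius' evaluation of `det (θ(l x_i y_j) / (θ(x_i y_j) θ(l)))`. Expanding
the determinant with entries `f(x_i y_j) + u f(c x_i y_j)` along its rows or along its columns
yields `source_identity`, a sum over subsets `K` that is symmetric in `x` and `y`. At `c = q⁻¹` and
with the `x_i` replaced by strings `x_i, q x_i, …, q^{M_i-1} x_i`, and the `y_l` likewise, it becomes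
the duality transformation with parameters in `q^{-ℕ}` (`kajiharaSum_comm_of_pow`). In a common factor
`u` of one parameter on each side, both sides are holomorphic on `ℂ \ {0}` with the same multiplier
under `u ↦ p u`; two such functions that agree on infinitely many orbits are equal
(`eq_zero_of_infinite_zeros`), and the parameters are freed one at a time
(`kajiharaSum_comm_of_forall_update`). Additional variables with parameter `1`, which do not
contribute, make this work when some of the sets of variables are empty.

**Special points.** The argument needs `p ≠ 0` and variables that avoid countably many zero sets.
The reduced sums are continuous in `p` and in the variables wherever their denominators do not
vanish (`tendsto_reducedSum`), and generic points are dense (`exists_generic_seq`).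
-/

namespace DeformedRuijsenaars

open Filter Topology

/-! ### The theta function -/

/-- The shifted factorial `(x;p)_∞ = ∏_{j ≥ 0} (1 - p^j x)`. -/
noncomputable def qPochInf (p x : ℂ) : ℂ := ∏' j : ℕ, (1 + -(p ^ j * x))

theorem summable_norm_pow_mul {p : ℂ} (hp : ‖p‖ < 1) (x : ℂ) :
    Summable fun j : ℕ => ‖-(p ^ j * x)‖ := by
  simp only [norm_neg, norm_mul, norm_pow]
  exact (summable_geometric_of_lt_one (norm_nonneg _) hp).mul_right _

theorem multipliable_qPochInf {p : ℂ} (hp : ‖p‖ < 1) (x : ℂ) :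
    Multipliable fun j : ℕ => (1 + -(p ^ j * x)) :=
  multipliable_one_add_of_summable (summable_norm_pow_mul hp x)

theorem qPochInf_eq_mul {p : ℂ} (hp : ‖p‖ < 1) (x : ℂ) :
    qPochInf p x = (1 - x) * qPochInf p (p * x) := by
  have h : Multipliable fun j : ℕ => (1 + -(p ^ (j + 1) * x)) := by
    simpa [pow_succ, mul_assoc] using multipliable_qPochInf hp (p * x)
  have h2 := tprod_eq_zero_mul' (f := fun j : ℕ => 1 + -(p ^ j * x)) h
  refine h2.trans ?_
  rw [pow_zero, one_mul, sub_eq_add_neg, qPochInf]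
  simp only [pow_succ, mul_assoc]

theorem qPochInf_ne_zero {p : ℂ} (hp : ‖p‖ < 1) {x : ℂ} (h : ∀ j : ℕ, p ^ j * x ≠ 1) :
    qPochInf p x ≠ 0 := by
  refine tprod_one_add_ne_zero_of_summable (fun j => ?_) (summable_norm_pow_mul hp x)
  rw [← sub_eq_add_neg, sub_ne_zero]
  exact (h j).symm

theorem hasProdLocallyUniformlyOn_qPochInf (ρ R : ℝ) (hρ : 0 ≤ ρ) (hρ1 : ρ < 1) :
    HasProdLocallyUniformlyOn (fun (j : ℕ) (a : ℂ × ℂ) => 1 + -(a.1 ^ j * a.2))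
      (fun a => qPochInf a.1 a.2) (Metric.ball 0 ρ ×ˢ Metric.ball 0 R) := by
  refine Summable.hasProdLocallyUniformlyOn_nat_one_add
    (Metric.isOpen_ball.prod Metric.isOpen_ball)
    (u := fun j => ρ ^ j * R) ((summable_geometric_of_lt_one hρ hρ1).mul_right _)
    (Eventually.of_forall ?_) (fun j => by fun_prop)
  rintro j ⟨a, b⟩ ⟨ha, hb⟩
  simp only [Metric.mem_ball, dist_zero_right] at ha hb
  simp only [norm_neg, norm_mul, norm_pow]
  gcongr

theorem continuousAt_qPochInf {p : ℂ} (hp : ‖p‖ < 1) (x : ℂ) :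
    ContinuousAt (fun a : ℂ × ℂ => qPochInf a.1 a.2) (p, x) := by
  obtain ⟨ρ, h1, h2⟩ := exists_between hp
  have h := hasProdLocallyUniformlyOn_qPochInf ρ (‖x‖ + 1) ((norm_nonneg _).trans h1.le) h2
  refine (ContinuousOn.continuousAt (s := Metric.ball 0 ρ ×ˢ Metric.ball 0 (‖x‖ + 1)) ?_ ?_)
  · refine (hasProdLocallyUniformlyOn_iff_tendstoLocallyUniformlyOn.mp h).continuousOn
      (Frequently.of_forall fun s => ?_)
    fun_prop
  · refine (Metric.isOpen_ball.prod Metric.isOpen_ball).mem_nhds ⟨?_, ?_⟩ <;> simp [h1]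

theorem differentiable_qPochInf {p : ℂ} (hp : ‖p‖ < 1) : Differentiable ℂ (qPochInf p) := by
  intro x
  have h : HasProdLocallyUniformlyOn (fun (j : ℕ) (a : ℂ) => 1 + -(p ^ j * a))
      (qPochInf p) (Metric.ball 0 (‖x‖ + 1)) := by
    refine Summable.hasProdLocallyUniformlyOn_nat_one_add Metric.isOpen_ball
      (u := fun j => ‖p‖ ^ j * (‖x‖ + 1))
      ((summable_geometric_of_lt_one (norm_nonneg _) hp).mul_right _)
      (Eventually.of_forall ?_) (fun j => by fun_prop)
    intro j a ha
    simp only [Metric.mem_ball, dist_zero_right] at ha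
    simp only [norm_neg, norm_mul, norm_pow]
    gcongr
  refine ((hasProdLocallyUniformlyOn_iff_tendstoLocallyUniformlyOn.mp h).differentiableOn
    (Eventually.of_forall fun s => ?_) Metric.isOpen_ball).differentiableAt
    (Metric.isOpen_ball.mem_nhds (by simp))
  fun_prop

theorem theta_eq_qPochInf {p : ℂ} (hp : ‖p‖ < 1) (z : ℂ) :
    theta p z = qPochInf p z * qPochInf p (p / z) := by
  rw [qPochInf, qPochInf, ← (multipliable_qPochInf hp _).tprod_mul (multipliable_qPochInf hp _)]
  refine tprod_congr fun j => ?_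
  ring

theorem theta_ne_zero {p : ℂ} (hp : ‖p‖ < 1) {z : ℂ} (hz : z ≠ 0)
    (h1 : ∀ j : ℕ, p ^ j * z ≠ 1) (h2 : ∀ j : ℕ, p ^ (j + 1) ≠ z) : theta p z ≠ 0 := by
  rw [theta_eq_qPochInf hp]
  refine mul_ne_zero (qPochInf_ne_zero hp h1) (qPochInf_ne_zero hp fun j h => h2 j ?_)
  field_simp at h
  rw [pow_succ, h]

theorem theta_ne_zero_of_forall_zpow {p : ℂ} (hp : ‖p‖ < 1) {z : ℂ} (hz : z ≠ 0)
    (h : ∀ b : ℤ, z ≠ p ^ b) : theta p z ≠ 0 := by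
  refine theta_ne_zero hp hz (fun j hj => h (-j) ?_) (fun j hj => h (j + 1) ?_)
  · rw [zpow_neg, zpow_natCast]
    exact eq_inv_of_mul_eq_one_right hj
  · rw [← hj]; norm_cast

theorem exists_of_theta_eq_zero {p : ℂ} (hp : ‖p‖ < 1) {z : ℂ} (hz : z ≠ 0)
    (h : theta p z = 0) : ∃ b : ℤ, z = p ^ b := by
  by_contra! h'
  exact theta_ne_zero_of_forall_zpow hp hz h' h

theorem continuousAt_theta {p : ℂ} (hp : ‖p‖ < 1) {z : ℂ} (hz : z ≠ 0) :
    ContinuousAt (fun a : ℂ × ℂ => theta a.1 a.2) (p, z) := by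
  have h : (fun a : ℂ × ℂ => theta a.1 a.2) =ᶠ[𝓝 (p, z)]
      fun a => qPochInf a.1 a.2 * qPochInf a.1 (a.1 / a.2) := by
    have : ∀ᶠ a : ℂ × ℂ in 𝓝 (p, z), ‖a.1‖ < 1 :=
      (continuous_fst.norm.continuousAt).eventually_lt continuousAt_const hp
    filter_upwards [this] with a ha using theta_eq_qPochInf ha _
  refine ContinuousAt.congr ?_ h.symm
  refine (continuousAt_qPochInf hp z).mul ?_
  have := (continuousAt_qPochInf hp (p / z))
  have h2 : ContinuousAt (fun a : ℂ × ℂ => (a.1, a.1 / a.2)) (p, z) := by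
    fun_prop (disch := exact hz)
  exact ContinuousAt.comp (g := fun a : ℂ × ℂ => qPochInf a.1 a.2)
    (f := fun a : ℂ × ℂ => (a.1, a.1 / a.2)) this h2

theorem differentiableAt_theta {p : ℂ} (hp : ‖p‖ < 1) {z : ℂ} (hz : z ≠ 0) :
    DifferentiableAt ℂ (theta p) z := by
  have : theta p = fun z => qPochInf p z * qPochInf p (p / z) :=
    funext (theta_eq_qPochInf hp)
  rw [this]
  refine (differentiable_qPochInf hp z).mul ?_
  exact (differentiable_qPochInf hp _).comp z (by fun_prop (disch := exact hz))

theorem theta_inv {p : ℂ} (hp : ‖p‖ < 1) {z : ℂ} (hz : z ≠ 0) :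
    theta p z⁻¹ = -z⁻¹ * theta p z := by
  rw [theta_eq_qPochInf hp, theta_eq_qPochInf hp, qPochInf_eq_mul hp z, qPochInf_eq_mul hp z⁻¹,
    div_inv_eq_mul, ← div_eq_mul_inv]
  field_simp
  ring

theorem theta_mul_left {p : ℂ} (hp : ‖p‖ < 1) (hp0 : p ≠ 0) {z : ℂ} (hz : z ≠ 0) :
    theta p (p * z) = -z⁻¹ * theta p z := by
  rw [← theta_inv hp hz, theta_eq_qPochInf hp, theta_eq_qPochInf hp, div_inv_eq_mul,
    div_mul_cancel_left₀ hp0, mul_comm]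

theorem theta_one {p : ℂ} : theta p 1 = 0 :=
  tprod_of_exists_eq_zero ⟨0, by simp⟩

theorem theta_zpow {p : ℂ} (hp : ‖p‖ < 1) (hp0 : p ≠ 0) (b : ℤ) : theta p (p ^ b) = 0 := by
  induction b using Int.induction_on with
  | zero => simpa using theta_one
  | succ i ih =>
    rw [add_comm, zpow_add₀ hp0, zpow_one, theta_mul_left hp hp0 (zpow_ne_zero _ hp0), ih, mul_zero]
  | pred i ih =>
    have := theta_mul_left hp hp0 (zpow_ne_zero (-(i : ℤ) - 1) hp0)
    rw [← zpow_one_add₀ hp0, add_sub_cancel, ih] at this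
    simpa [hp0, zpow_ne_zero] using this.symm

theorem deriv_theta_one_ne_zero {p : ℂ} (hp : ‖p‖ < 1) : deriv (theta p) 1 ≠ 0 := by
  have h : theta p =
      fun z => (1 - z) * (qPochInf p (p * z) * qPochInf p (p / z)) := by
    funext z
    rw [theta_eq_qPochInf hp, qPochInf_eq_mul hp z, mul_assoc]
  have hd : DifferentiableAt ℂ (fun z => qPochInf p (p * z) * qPochInf p (p / z)) 1 := by
    refine ((differentiable_qPochInf hp _).comp (1 : ℂ) (by fun_prop)).mul ?_
    exact (differentiable_qPochInf hp _).comp (1 : ℂ) (by fun_prop (disch := exact one_ne_zero))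
  have h1 : HasDerivAt (fun z : ℂ => 1 - z) (-1) 1 := by
    simpa using (hasDerivAt_id (1 : ℂ)).const_sub 1
  have h2 := (h1.mul hd.hasDerivAt).deriv
  rw [h]
  refine (ne_of_eq_of_ne h2 ?_)
  have h3 : qPochInf p p ≠ 0 := qPochInf_ne_zero hp fun j hj => by
    have := congrArg norm hj
    rw [← pow_succ, norm_pow, norm_one] at this
    exact (pow_lt_one₀ (norm_nonneg _) hp (Nat.succ_ne_zero j)).ne this
  simp [h3]

theorem deriv_theta_mul_left {p : ℂ} (hp : ‖p‖ < 1) (hp0 : p ≠ 0) {z : ℂ} (hz : z ≠ 0)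
    (h : theta p z = 0) : p * deriv (theta p) (p * z) = -z⁻¹ * deriv (theta p) z := by
  have h1 : HasDerivAt (fun x => theta p (p * x)) (deriv (theta p) (p * z) * p) z := by
    have := (differentiableAt_theta hp (mul_ne_zero hp0 hz)).hasDerivAt
    exact HasDerivAt.comp z this (by simpa using (hasDerivAt_id z).const_mul p)
  have h2 : HasDerivAt (fun x => -x⁻¹ * theta p x)
      (-(-(z ^ 2)⁻¹) * theta p z + -z⁻¹ * deriv (theta p) z) z :=
    (hasDerivAt_inv hz).neg.mul (differentiableAt_theta hp hz).hasDerivAt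
  have h3 : (fun x => theta p (p * x)) =ᶠ[𝓝 z] fun x => -x⁻¹ * theta p x := by
    filter_upwards [isOpen_ne.mem_nhds hz] with x hx using theta_mul_left hp hp0 hx
  have h4 := (h2.congr_of_eventuallyEq h3).unique h1
  rw [h, mul_zero, zero_add] at h4
  rw [h4, mul_comm]

/-- All zeros `p^b` of the theta function are simple. -/
theorem deriv_theta_ne_zero {p : ℂ} (hp : ‖p‖ < 1) (hp0 : p ≠ 0) {z : ℂ} (hz : z ≠ 0)
    (h : theta p z = 0) : deriv (theta p) z ≠ 0 := by
  obtain ⟨b, rfl⟩ := exists_of_theta_eq_zero hp hz h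
  clear h hz
  induction b using Int.induction_on with
  | zero => simpa using deriv_theta_one_ne_zero hp
  | succ i ih =>
    intro h0
    have := deriv_theta_mul_left hp hp0 (zpow_ne_zero (i : ℤ) hp0) (theta_zpow hp hp0 _)
    rw [← zpow_one_add₀ hp0, add_comm (1 : ℤ), h0, mul_zero] at this
    exact mul_ne_zero (neg_ne_zero.mpr (inv_ne_zero (zpow_ne_zero _ hp0))) ih this.symm
  | pred i ih =>
    intro h0
    have := deriv_theta_mul_left hp hp0 (zpow_ne_zero (-(i : ℤ) - 1) hp0) (theta_zpow hp hp0 _)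
    rw [← zpow_one_add₀ hp0, add_sub_cancel, h0, mul_zero] at this
    exact mul_ne_zero hp0 ih this

/-! ### Functions on the punctured plane that are quasi-periodic under `x ↦ p x` -/

/-- Division of holomorphic functions when the divisor has only simple zeros. -/
theorem exists_eq_mul_of_simple_zeros {U : Set ℂ} (hU : IsOpen U) {f g : ℂ → ℂ}
    (hf : DifferentiableOn ℂ f U) (hg : DifferentiableOn ℂ g U)
    (h : ∀ x ∈ U, g x = 0 → f x = 0 ∧ deriv g x ≠ 0) :
    ∃ k : ℂ → ℂ, DifferentiableOn ℂ k U ∧ ∀ x ∈ U, f x = g x * k x := by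
  classical
  refine ⟨fun x => if g x = 0 then deriv f x / deriv g x else f x / g x, ?_, ?_⟩
  · intro x hx
    refine DifferentiableAt.differentiableWithinAt ?_
    have hfa := hf.analyticAt (hU.mem_nhds hx)
    have hga := hg.analyticAt (hU.mem_nhds hx)
    by_cases h0 : g x = 0
    · obtain ⟨hf0, hg'⟩ := h x hx h0
      have hF : AnalyticAt ℂ (dslope f x) x := by
        obtain ⟨P, hP⟩ := hfa
        exact ⟨_, hP.has_fpower_series_dslope_fslope⟩
      have hG : AnalyticAt ℂ (dslope g x) x := by
        obtain ⟨P, hP⟩ := hga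
        exact ⟨_, hP.has_fpower_series_dslope_fslope⟩
      have hG0 : dslope g x x ≠ 0 := by rwa [dslope_same]
      refine (hF.differentiableAt.div hG.differentiableAt hG0).congr_of_eventuallyEq ?_
      filter_upwards [hG.continuousAt.eventually_ne hG0] with y hy
      by_cases hyx : y = x
      · subst hyx
        simp [h0, dslope_same]
      · have e1 : f y = (y - x) * dslope f x y := by
          have := sub_smul_dslope f x y
          rw [hf0, sub_zero] at this
          exact this.symm
        have e2 : g y = (y - x) * dslope g x y := by
          have := sub_smul_dslope g x y
          rw [h0, sub_zero] at this
          exact this.symm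
        have hyx' : y - x ≠ 0 := sub_ne_zero.mpr hyx
        have e3 : g y ≠ 0 := by rw [e2]; exact mul_ne_zero hyx' hy
        rw [if_neg e3, Pi.div_apply, e1, e2, mul_div_mul_left _ _ hyx']
    · refine (hfa.differentiableAt.div hga.differentiableAt h0).congr_of_eventuallyEq ?_
      filter_upwards [hga.continuousAt.eventually_ne h0] with y hy
      rw [if_neg hy, Pi.div_apply]
  · intro x hx
    by_cases h0 : g x = 0
    · simp [h0, (h x hx h0).1]
    · simp only [h0, if_false]
      field_simp

theorem exists_zpow_mul_mem_annulus {p : ℂ} (hp : ‖p‖ < 1) (hp0 : p ≠ 0) {x : ℂ} (hx : x ≠ 0) :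
    ∃ n : ℤ, ‖p‖ ≤ ‖p ^ n * x‖ ∧ ‖p ^ n * x‖ ≤ 1 := by
  have h1 : 1 < ‖p‖⁻¹ := (one_lt_inv₀ (norm_pos_iff.mpr hp0)).mpr hp
  obtain ⟨n, h2, h3⟩ := exists_mem_Ico_zpow (norm_pos_iff.mpr hx) h1
  have hpos : 0 < ‖p‖ := norm_pos_iff.mpr hp0
  refine ⟨n + 1, ?_, ?_⟩ <;> rw [norm_mul, norm_zpow]
  · rw [zpow_add₀ hpos.ne', zpow_one]
    rw [inv_zpow] at h2
    have := mul_le_mul_of_nonneg_left h2 (zpow_pos hpos n).le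
    rw [mul_inv_cancel₀ (zpow_pos hpos n).ne'] at this
    nlinarith
  · rw [inv_zpow] at h3
    have := mul_lt_mul_of_pos_left h3 (zpow_pos hpos (n + 1))
    rw [mul_inv_cancel₀ (zpow_pos hpos _).ne'] at this
    exact this.le

/-- The closed annulus `‖p‖ ≤ ‖x‖ ≤ 1`, which meets every orbit of `x ↦ p x`. -/
def annulus (p : ℂ) : Set ℂ := {x | ‖p‖ ≤ ‖x‖ ∧ ‖x‖ ≤ 1}

theorem isCompact_annulus (p : ℂ) : IsCompact (annulus p) := by
  have : annulus p = Metric.closedBall 0 1 ∩ {x | ‖p‖ ≤ ‖x‖} := by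
    ext x; simp [annulus, and_comm]
  rw [this]
  exact (isCompact_closedBall _ _).inter_right (isClosed_le continuous_const continuous_norm)

theorem ne_zero_of_mem_annulus {p x : ℂ} (hp0 : p ≠ 0) (hx : x ∈ annulus p) : x ≠ 0 :=
  norm_pos_iff.mp ((norm_pos_iff.mpr hp0).trans_le hx.1)

/-- A holomorphic function on the punctured plane with `g(px) = c g(x)` is a constant multiple
of a power `e^{α log x}`, by Liouville's theorem; so it vanishes identically as soon as it
vanishes somewhere. -/
theorem eq_zero_of_multiplier {p c : ℂ} (hp : ‖p‖ < 1) (hp0 : p ≠ 0) (hc : c ≠ 0) {g : ℂ → ℂ}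
    (hg : DifferentiableOn ℂ g {0}ᶜ) (hmul : ∀ x, x ≠ 0 → g (p * x) = c * g x)
    {a : ℂ} (ha : a ≠ 0) (hga : g a = 0) {x : ℂ} (hx : x ≠ 0) : g x = 0 := by
  set α : ℝ := Real.log ‖c‖ / Real.log ‖p‖ with hα
  have hpos : 0 < ‖p‖ := norm_pos_iff.mpr hp0
  have hlog : Real.log ‖p‖ ≠ 0 := (Real.log_neg hpos hp).ne
  have hpα : ‖p‖ ^ α = ‖c‖ := by
    rw [Real.rpow_def_of_pos hpos, hα, mul_div_cancel₀ _ hlog, Real.exp_log (norm_pos_iff.mpr hc)]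
  -- `φ x = ‖g x‖ ‖x‖^{-α}` is invariant under `x ↦ p x`, hence bounded
  have hφ : ∀ x, x ≠ 0 → ‖g (p * x)‖ * ‖p * x‖ ^ (-α) = ‖g x‖ * ‖x‖ ^ (-α) := by
    intro x hx
    rw [hmul x hx, norm_mul, norm_mul, Real.mul_rpow hpos.le (norm_nonneg _), Real.rpow_neg hpos.le,
      hpα]
    have : ‖c‖ ≠ 0 := norm_ne_zero_iff.mpr hc
    field_simp
  have hφz : ∀ n : ℤ, ∀ x, x ≠ 0 →
      ‖g (p ^ n * x)‖ * ‖p ^ n * x‖ ^ (-α) = ‖g x‖ * ‖x‖ ^ (-α) := by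
    intro n
    induction n using Int.induction_on with
    | zero => simp
    | succ i ih =>
      intro x hx
      rw [add_comm, zpow_one_add₀ hp0, mul_assoc, hφ _ (mul_ne_zero (zpow_ne_zero _ hp0) hx),
        ih x hx]
    | pred i ih =>
      intro x hx
      have := hφ (p ^ (-(i : ℤ) - 1) * x) (mul_ne_zero (zpow_ne_zero _ hp0) hx)
      rw [← mul_assoc, ← zpow_one_add₀ hp0, add_sub_cancel, ih x hx] at this
      exact this.symm
  obtain ⟨C, hC⟩ : ∃ C, ∀ x ∈ annulus p, ‖‖g x‖ * ‖x‖ ^ (-α)‖ ≤ C := by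
    refine (isCompact_annulus p).exists_bound_of_continuousOn ?_
    intro x hx
    have hx0 := ne_zero_of_mem_annulus hp0 hx
    refine ContinuousAt.continuousWithinAt ?_
    refine ((hg.continuousOn.continuousAt (isOpen_compl_singleton.mem_nhds hx0)).norm).mul ?_
    exact continuousAt_id.norm.rpow_const (Or.inl (norm_ne_zero_iff.mpr hx0))
  have hbound : ∀ x, x ≠ 0 → ‖g x‖ * ‖x‖ ^ (-α) ≤ C := by
    intro x hx
    obtain ⟨n, hn⟩ := exists_zpow_mul_mem_annulus hp hp0 hx
    rw [← hφz n x hx]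
    exact (le_abs_self _).trans (hC _ hn)
  set G : ℂ → ℂ := fun u => g (Complex.exp u) * Complex.exp (-α * u)
  have hG : Differentiable ℂ G := by
    intro u
    have := (hg.differentiableAt (isOpen_compl_singleton.mem_nhds (Complex.exp_ne_zero u)))
    exact (this.comp u Complex.differentiableAt_exp).mul (by fun_prop)
  have hGb : Bornology.IsBounded (Set.range G) := by
    refine isBounded_iff_forall_norm_le.mpr ⟨C, ?_⟩
    rintro _ ⟨u, rfl⟩
    have h1 := hbound _ (Complex.exp_ne_zero u)
    have h2 : ‖Complex.exp (-α * u)‖ = ‖Complex.exp u‖ ^ (-α) := by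
      rw [Complex.norm_exp, Complex.norm_exp, ← Real.exp_mul]
      congr 1
      simp [mul_comm]
    simpa only [G, norm_mul, h2] using h1
  have h3 := hG.apply_eq_apply_of_bounded hGb (Complex.log x) (Complex.log a)
  simpa [G, Complex.exp_log hx, Complex.exp_log ha, hga] using h3

/-- A holomorphic function on the punctured plane with `f(px) = C x^e f(x)` that vanishes on
infinitely many orbits of `x ↦ p x` vanishes identically. -/
theorem eq_zero_of_infinite_zeros {p C : ℂ} {e : ℤ} (hp : ‖p‖ < 1) (hp0 : p ≠ 0)
    (hC : C ≠ 0) {f : ℂ → ℂ}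
    (hf : DifferentiableOn ℂ f {0}ᶜ) (hmul : ∀ x, x ≠ 0 → f (p * x) = C * x ^ e * f x)
    {u : ℕ → ℂ} (hu0 : ∀ j, u j ≠ 0) (hu : ∀ i j, ∀ b : ℤ, u i = p ^ b * u j → i = j)
    (hfu : ∀ j, f (u j) = 0) {x : ℂ} (hx : x ≠ 0) : f x = 0 := by
  have hz : ∀ n : ℤ, ∀ x, x ≠ 0 → f x = 0 → f (p ^ n * x) = 0 := by
    intro n
    induction n using Int.induction_on with
    | zero => simp
    | succ i ih =>
      intro x hx h
      rw [add_comm, zpow_one_add₀ hp0, mul_assoc, hmul _ (mul_ne_zero (zpow_ne_zero _ hp0) hx),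
        ih x hx h, mul_zero]
    | pred i ih =>
      intro x hx h
      have h0 := mul_ne_zero (zpow_ne_zero (-(i : ℤ) - 1) hp0) hx
      have := hmul _ h0
      rw [← mul_assoc, ← zpow_one_add₀ hp0, add_sub_cancel, ih x hx h] at this
      have h1 := mul_ne_zero hC (zpow_ne_zero e h0)
      exact (mul_eq_zero.mp this.symm).resolve_left h1
  choose n hn using fun j => exists_zpow_mul_mem_annulus hp hp0 (hu0 j)
  have hinj : Function.Injective fun j => p ^ n j * u j := by
    intro i j hij
    refine hu i j (n j - n i) ?_
    simp only at hij
    rw [zpow_sub₀ hp0, div_mul_eq_mul_div, ← hij, mul_div_cancel_left₀ _ (zpow_ne_zero _ hp0)]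
  obtain ⟨y, hy, hacc⟩ := (Set.infinite_range_of_injective hinj).exists_accPt_of_subset_isCompact
    (isCompact_annulus p) (by rintro _ ⟨j, rfl⟩; exact hn j)
  have hy0 := ne_zero_of_mem_annulus hp0 hy
  have han : AnalyticOnNhd ℂ f {0}ᶜ := hf.analyticOnNhd isOpen_compl_singleton
  have hfr : ∃ᶠ z in 𝓝[≠] y, f z = 0 := by
    refine (accPt_iff_frequently_nhdsNE.mp hacc).mono ?_
    rintro _ ⟨j, rfl⟩
    exact hz _ _ (hu0 j) (hfu j)
  exact han.eqOn_zero_of_preconnected_of_frequently_eq_zero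
    (isConnected_compl_singleton_of_one_lt_rank (by simp) 0).isPreconnected hy0 hfr hx

/-- If a holomorphic quasi-periodic function vanishes at `a`, then it is divisible by
`θ(x/a)`. -/
theorem exists_eq_theta_mul {p C a : ℂ} {e : ℤ} (hp : ‖p‖ < 1) (hp0 : p ≠ 0) (ha : a ≠ 0)
    (hC : C ≠ 0) {f : ℂ → ℂ} (hf : DifferentiableOn ℂ f {0}ᶜ)
    (hmul : ∀ x, x ≠ 0 → f (p * x) = C * x ^ e * f x) (hfa : f a = 0) :
    ∃ k : ℂ → ℂ, DifferentiableOn ℂ k {0}ᶜ ∧ (∀ x, x ≠ 0 → f x = theta p (x / a) * k x) ∧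
      ∀ x, x ≠ 0 → k (p * x) = -(C / a) * x ^ (e + 1) * k x := by
  have hz : ∀ n : ℤ, f (p ^ n * a) = 0 := by
    intro n
    induction n using Int.induction_on with
    | zero => simpa using hfa
    | succ i ih =>
      rw [add_comm, zpow_one_add₀ hp0, mul_assoc, hmul _ (mul_ne_zero (zpow_ne_zero _ hp0) ha),
        ih, mul_zero]
    | pred i ih =>
      have h0 := mul_ne_zero (zpow_ne_zero (-(i : ℤ) - 1) hp0) ha
      have := hmul _ h0
      rw [← mul_assoc, ← zpow_one_add₀ hp0, add_sub_cancel, ih] at this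
      exact (mul_eq_zero.mp this.symm).resolve_left (mul_ne_zero hC (zpow_ne_zero e h0))
  have hder : ∀ x, x ≠ 0 →
      HasDerivAt (fun x => theta p (x / a)) (deriv (theta p) (x / a) / a) x := by
    intro x hx
    have := (differentiableAt_theta hp (div_ne_zero hx ha)).hasDerivAt
    have h2 := HasDerivAt.comp x this ((hasDerivAt_id x).div_const a)
    simpa [div_eq_mul_inv, Function.comp_def] using h2
  have hsimple : ∀ x, x ≠ 0 → theta p (x / a) = 0 → deriv (fun x => theta p (x / a)) x ≠ 0 := by
    intro x hx h
    rw [(hder x hx).deriv]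
    exact div_ne_zero (deriv_theta_ne_zero hp hp0 (div_ne_zero hx ha) h) ha
  obtain ⟨k, hk, hfk⟩ := exists_eq_mul_of_simple_zeros isOpen_compl_singleton hf
    (g := fun x => theta p (x / a))
    (fun x hx => (hder x hx).differentiableAt.differentiableWithinAt) (by
      intro x hx h
      refine ⟨?_, hsimple x hx h⟩
      obtain ⟨b, hb⟩ := exists_of_theta_eq_zero hp (div_ne_zero hx ha) h
      rw [← hz b, ← hb, div_mul_cancel₀ _ ha])
  refine ⟨k, hk, hfk, fun x hx => ?_⟩
  have hkc : ∀ y, y ≠ 0 → ContinuousAt k y := fun y hy =>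
    hk.continuousOn.continuousAt (isOpen_compl_singleton.mem_nhds hy)
  -- the relation holds off the zeros of `θ(x/a)`, hence everywhere by continuity
  have hev : ∀ᶠ y in 𝓝[≠] x, theta p (y / a) ≠ 0 := by
    by_cases h : theta p (x / a) = 0
    · have h1 := (hder x hx).eventually_ne (c := 0) (by
        have := hsimple x hx h
        rwa [(hder x hx).deriv] at this)
      exact h1
    · exact ((hder x hx).continuousAt.eventually_ne h).filter_mono nhdsWithin_le_nhds
  have hev2 : ∀ᶠ y in 𝓝[≠] x, k (p * y) = -(C / a) * y ^ (e + 1) * k y := by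
    filter_upwards [hev, (isOpen_ne.eventually_mem hx).filter_mono nhdsWithin_le_nhds] with y h1 h2
    have e1 := hmul y h2
    rw [hfk _ (mul_ne_zero hp0 h2), hfk _ h2, mul_div_assoc,
      theta_mul_left hp hp0 (div_ne_zero h2 ha)] at e1
    have h3 : y / a ≠ 0 := div_ne_zero h2 ha
    rw [zpow_add_one₀ h2]
    field_simp at e1 ⊢
    linear_combination (-1) * e1
  have t1 : Tendsto (fun y => k (p * y)) (𝓝[≠] x) (𝓝 (k (p * x))) :=
    ((hkc _ (mul_ne_zero hp0 hx)).comp (f := fun y => p * y)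
      (continuousAt_const.mul continuousAt_id)).tendsto.mono_left
      nhdsWithin_le_nhds
  have t2 : Tendsto (fun y => -(C / a) * y ^ (e + 1) * k y) (𝓝[≠] x)
      (𝓝 (-(C / a) * x ^ (e + 1) * k x)) :=
    ((continuousAt_const.mul (continuousAt_zpow₀ x _ (Or.inl hx))).mul
      (hkc x hx)).tendsto.mono_left nhdsWithin_le_nhds
  exact tendsto_nhds_unique (t1.congr' hev2) t2

theorem countable_setOf_theta_mul_eq_zero {p : ℂ} (hp : ‖p‖ < 1) {d : ℂ} (hd : d ≠ 0) :
    {z : ℂ | z ≠ 0 ∧ theta p (d * z) = 0}.Countable := by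
  refine (Set.countable_range fun b : ℤ => p ^ b / d).mono ?_
  rintro z ⟨hz, h⟩
  obtain ⟨b, hb⟩ := exists_of_theta_eq_zero hp (mul_ne_zero hd hz) h
  exact ⟨b, by simp only [← hb]; field_simp⟩

/-- The three-term identity for generic `l`. As functions of `x`, both sides have the same
multiplier under `x ↦ p x`, and their difference vanishes at `x0`, `(l x0 y0 y)⁻¹` and `y⁻¹`. The
multiplier leaves room for two zeros only, so that the difference vanishes identically. -/
theorem weierstrass_of_generic {p : ℂ} (hp : ‖p‖ < 1) (hp0 : p ≠ 0) {l x y x0 y0 : ℂ}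
    (hl : l ≠ 0) (hx : x ≠ 0) (hy : y ≠ 0) (hx0 : x0 ≠ 0) (hy0 : y0 ≠ 0)
    (h1 : theta p (x0 * y) ≠ 0) (h2 : theta p (l * x0 * y0) ≠ 0)
    (h3 : theta p (l * x0 ^ 2 * y0 * y) ≠ 0) :
    theta p (l * x * y) * theta p (x0 * y) * theta p (x * y0) * theta p (l * x0 * y0)
      - theta p (l * x * y0) * theta p (l * x0 * y) * theta p (x0 * y0) * theta p (x * y)
      = x0 * y0 * theta p l * theta p (y / y0) * theta p (x / x0)
        * theta p (l * x0 * y0 * x * y) := by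
  set D : ℂ → ℂ := fun x =>
    theta p (l * x * y) * theta p (x0 * y) * theta p (x * y0) * theta p (l * x0 * y0)
      - theta p (l * x * y0) * theta p (l * x0 * y) * theta p (x0 * y0) * theta p (x * y)
      - x0 * y0 * theta p l * theta p (y / y0) * theta p (x / x0)
        * theta p (l * x0 * y0 * x * y) with hD
  suffices h : D x = 0 by
    rw [hD] at h
    exact sub_eq_zero.mp h
  have hdiff : ∀ c : ℂ, c ≠ 0 → DifferentiableOn ℂ (fun x => theta p (c * x)) {0}ᶜ := by
    intro c hc z hz
    exact ((differentiableAt_theta hp (mul_ne_zero hc hz)).comp z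
      (by fun_prop)).differentiableWithinAt
  have hDdiff : DifferentiableOn ℂ D {0}ᶜ := by
    have e1 := hdiff (l * y) (mul_ne_zero hl hy)
    have e2 := hdiff y0 hy0
    have e3 := hdiff (l * y0) (mul_ne_zero hl hy0)
    have e4 := hdiff y hy
    have e5 := hdiff x0⁻¹ (inv_ne_zero hx0)
    have e6 := hdiff (l * x0 * y0 * y) (by simp [*])
    have : D = fun x =>
      theta p (l * y * x) * theta p (x0 * y) * theta p (y0 * x) * theta p (l * x0 * y0)
      - theta p (l * y0 * x) * theta p (l * x0 * y) * theta p (x0 * y0) * theta p (y * x)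
      - x0 * y0 * theta p l * theta p (y / y0) * theta p (x0⁻¹ * x)
        * theta p (l * x0 * y0 * y * x) := by
      rw [hD]; funext x; ring_nf
    rw [this]
    fun_prop
  have hDmul : ∀ x, x ≠ 0 → D (p * x) = (l * y * y0)⁻¹ * x ^ (-2 : ℤ) * D x := by
    intro x hx
    have e : ∀ c, c ≠ 0 → theta p (p * (c * x)) = -(c * x)⁻¹ * theta p (c * x) := fun c hc =>
      theta_mul_left hp hp0 (mul_ne_zero hc hx)
    have e1 := e (l * y) (mul_ne_zero hl hy)
    have e2 := e y0 hy0
    have e3 := e (l * y0) (mul_ne_zero hl hy0)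
    have e4 := e y hy
    have e5 := e x0⁻¹ (inv_ne_zero hx0)
    have e6 := e (l * x0 * y0 * y) (by simp [*])
    simp only [hD]
    rw [show l * (p * x) * y = p * (l * y * x) by ring, show p * x * y0 = p * (y0 * x) by ring,
      show l * (p * x) * y0 = p * (l * y0 * x) by ring, show p * x * y = p * (y * x) by ring,
      show p * x / x0 = p * (x0⁻¹ * x) by ring,
      show l * x0 * y0 * (p * x) * y = p * (l * x0 * y0 * y * x) by ring, e1, e2, e3, e4, e5, e6,
      show l * y * x = l * x * y by ring, show y0 * x = x * y0 by ring,
      show l * y0 * x = l * x * y0 by ring, show y * x = x * y by ring,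
      show x0⁻¹ * x = x / x0 by ring, show l * x0 * y0 * y * x = l * x0 * y0 * x * y by ring,
      zpow_neg, zpow_two]
    field_simp
  have hDx0 : D x0 = 0 := by
    simp only [hD]
    rw [div_self hx0, theta_one]
    ring
  obtain ⟨k, hk, hDk, hkmul⟩ := exists_eq_theta_mul hp hp0 hx0 (by simp [*]) hDdiff hDmul hDx0
  set x1 := (l * x0 * y0 * y)⁻¹ with hx1
  have hx10 : x1 ≠ 0 := by simp [x1, *]
  have hk1 : k x1 = 0 := by
    have h4 : D x1 = 0 := by
      simp only [hD]
      have i1 : l * x1 * y = (x0 * y0)⁻¹ := by rw [hx1]; field_simp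
      have i2 : x1 * y0 = (l * x0 * y)⁻¹ := by rw [hx1]; field_simp
      have i3 : l * x1 * y0 = (x0 * y)⁻¹ := by rw [hx1]; field_simp
      have i4 : x1 * y = (l * x0 * y0)⁻¹ := by rw [hx1]; field_simp
      have i5 : l * x0 * y0 * x1 * y = 1 := by rw [hx1]; field_simp
      rw [i1, i2, i3, i4, i5, theta_one, theta_inv hp (by simp [*]), theta_inv hp (by simp [*]),
        theta_inv hp (by simp [*]), theta_inv hp (by simp [*])]
      field_simp
      ring
    rw [hDk _ hx10] at h4
    refine (mul_eq_zero.mp h4).resolve_left ?_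
    have i6 : x1 / x0 = (l * x0 ^ 2 * y0 * y)⁻¹ := by rw [hx1]; field_simp
    rw [i6, theta_inv hp (by simp [*])]
    exact mul_ne_zero (by simp [*]) h3
  obtain ⟨k2, hk2, hkk2, hk2mul⟩ := exists_eq_theta_mul hp hp0 hx10
    (neg_ne_zero.mpr (div_ne_zero (by simp [*]) hx0)) hk hkmul hk1
  have hyi : y⁻¹ ≠ 0 := inv_ne_zero hy
  have hk3 : k2 y⁻¹ = 0 := by
    have h4 : D y⁻¹ = 0 := by
      simp only [hD]
      have i1 : l * y⁻¹ * y = l := by field_simp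
      have i2 : y⁻¹ * y0 = (y / y0)⁻¹ := by field_simp
      have i3 : y⁻¹ / x0 = (x0 * y)⁻¹ := by field_simp
      have i4 : l * x0 * y0 * y⁻¹ * y = l * x0 * y0 := by field_simp
      rw [i1, i2, i3, i4, inv_mul_cancel₀ hy, theta_one, theta_inv hp (by simp [*]),
        theta_inv hp (by simp [*])]
      field_simp
      ring
    rw [hDk _ hyi, hkk2 _ hyi] at h4
    have i3 : y⁻¹ / x0 = (x0 * y)⁻¹ := by field_simp
    have i5 : y⁻¹ / x1 = l * x0 * y0 := by rw [hx1]; field_simp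
    rw [i3, i5, theta_inv hp (by simp [*])] at h4
    have h5 : -(x0 * y)⁻¹ * theta p (x0 * y) ≠ 0 := mul_ne_zero (by simp [*]) h1
    exact ((mul_eq_zero.mp ((mul_eq_zero.mp h4).resolve_left h5))).resolve_left h2
  have h6 := eq_zero_of_multiplier hp hp0 (c := -(-((l * y * y0)⁻¹ / x0) / x1))
    (by simp [*]) hk2 (by
      intro x hx
      have := hk2mul x hx
      rwa [show (-2 : ℤ) + 1 + 1 = 0 by norm_num, zpow_zero, mul_one] at this) hyi hk3 hx
  rw [hDk x hx, hkk2 x hx, h6, mul_zero, mul_zero]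

/-- The three-term (Weierstrass) identity for the theta function. -/
theorem weierstrass {p : ℂ} (hp : ‖p‖ < 1) (hp0 : p ≠ 0) {l x y x0 y0 : ℂ}
    (hl : l ≠ 0) (hx : x ≠ 0) (hy : y ≠ 0) (hx0 : x0 ≠ 0) (hy0 : y0 ≠ 0)
    (h1 : theta p (x0 * y) ≠ 0) :
    theta p (l * x * y) * theta p (x0 * y) * theta p (x * y0) * theta p (l * x0 * y0)
      - theta p (l * x * y0) * theta p (l * x0 * y) * theta p (x0 * y0) * theta p (x * y)
      = x0 * y0 * theta p l * theta p (y / y0) * theta p (x / x0)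
        * theta p (l * x0 * y0 * x * y) := by
  -- both sides are continuous in `l`, and only countably many `l` are not generic
  set S : Set ℂ := {0}ᶜ
  have hth : ∀ c : ℂ, c ≠ 0 → ContinuousOn (fun l => theta p (c * l)) S := by
    intro c hc z hz
    exact ((differentiableAt_theta hp (mul_ne_zero hc hz)).continuousAt.comp
      (f := fun l => c * l) (by fun_prop)).continuousWithinAt
  set B : Set ℂ := {0} ∪ {z | z ≠ 0 ∧ theta p (x0 * y0 * z) = 0}
    ∪ {z | z ≠ 0 ∧ theta p (x0 ^ 2 * y0 * y * z) = 0}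
  have hB : B.Countable := ((Set.countable_singleton 0).union
    (countable_setOf_theta_mul_eq_zero hp (by simp [*]))).union
    (countable_setOf_theta_mul_eq_zero hp (by simp [*]))
  have hdense := hB.dense_compl ℝ
  have hcl : l ∈ closure (S ∩ Bᶜ) := by
    have : S ∩ Bᶜ = Bᶜ := by
      refine Set.inter_eq_right.mpr fun z hz h0 => hz ?_
      exact Or.inl (Or.inl h0)
    rw [this]
    exact hdense l
  have e1 := hth (x * y) (by simp [*])
  have e2 := hth (x0 * y0) (by simp [*])
  have e3 := hth (x * y0) (by simp [*])
  have e4 := hth (x0 * y) (by simp [*])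
  have e5 := hth 1 (by simp)
  have e6 := hth (x0 * y0 * x * y) (by simp [*])
  set F : ℂ → ℂ := fun l =>
    theta p (x * y * l) * theta p (x0 * y) * theta p (x * y0) * theta p (x0 * y0 * l)
      - theta p (x * y0 * l) * theta p (x0 * y * l) * theta p (x0 * y0) * theta p (x * y)
      - x0 * y0 * theta p (1 * l) * theta p (y / y0) * theta p (x / x0)
        * theta p (x0 * y0 * x * y * l) with hF
  have hFc : ContinuousOn F S := by rw [hF]; fun_prop
  have hF0 : ∀ z ∈ S ∩ Bᶜ, F z = 0 := by
    rintro z ⟨hz, hzB⟩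
    simp only [B, Set.mem_compl_iff, Set.mem_union, Set.mem_ofPred_eq, not_or, not_and] at hzB
    have := weierstrass_of_generic hp hp0 (l := z) hz hx hy hx0 hy0 h1
      (by have := hzB.1.2 hz; rwa [show z * x0 * y0 = x0 * y0 * z by ring])
      (by have := hzB.2 hz; rwa [show z * x0 ^ 2 * y0 * y = x0 ^ 2 * y0 * y * z by ring])
    rw [← sub_eq_zero] at this
    rw [← this, hF]
    ring_nf
  have hFl : F l = 0 := by
    have h2 : ContinuousWithinAt F (S ∩ Bᶜ) l := (hFc l hl).mono Set.inter_subset_left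
    have h3 : (𝓝[S ∩ Bᶜ] l).NeBot := mem_closure_iff_nhdsWithin_neBot.mp hcl
    have h4 : F =ᶠ[𝓝[S ∩ Bᶜ] l] fun _ => 0 := by
      filter_upwards [self_mem_nhdsWithin] with z hz using hF0 z hz
    exact tendsto_nhds_unique (h2.tendsto.congr' h4) tendsto_const_nhds
  rw [← sub_eq_zero, ← hFl, hF]
  ring_nf

/-! ### The Frobenius determinant -/

/-- The entry `θ(lv) / (θ(v) θ(l))` of the Frobenius (elliptic Cauchy) determinant. -/
noncomputable def frobEntry (p l v : ℂ) : ℂ := theta p (l * v) / (theta p v * theta p l)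

/-- The antisymmetric function `b θ(a/b)`. -/
noncomputable def thetaDiff (p a b : ℂ) : ℂ := b * theta p (a / b)

/-- The elliptic Vandermonde product `∏_{i<j} x_i θ(x_j/x_i)`. -/
noncomputable def thetaVandermonde (p : ℂ) {N : ℕ} (x : Fin N → ℂ) : ℂ :=
  ∏ i, ∏ j ∈ Ioi i, thetaDiff p (x j) (x i)

theorem thetaDiff_swap {p : ℂ} (hp : ‖p‖ < 1) {a b : ℂ} (ha : a ≠ 0) (hb : b ≠ 0) :
    thetaDiff p a b = -thetaDiff p b a := by
  have := theta_inv hp (div_ne_zero hb ha)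
  rw [inv_div] at this
  rw [thetaDiff, thetaDiff, this]
  field_simp

/-- Subtracting the multiple of row `0` that clears column `0` turns the entry of the Frobenius
matrix with parameter `l` into a multiple of the entry with parameter `l x_0 y_0`. -/
theorem frobEntry_sub {p : ℂ} (hp : ‖p‖ < 1) (hp0 : p ≠ 0) {l x y x0 y0 : ℂ}
    (hl : l ≠ 0) (hx : x ≠ 0) (hy : y ≠ 0) (hx0 : x0 ≠ 0) (hy0 : y0 ≠ 0)
    (h01 : theta p (x0 * y) ≠ 0) (h10 : theta p (x * y0) ≠ 0)
    (h11 : theta p (x * y) ≠ 0) (hl1 : theta p l ≠ 0) (hl2 : theta p (l * x0 * y0) ≠ 0) :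
    frobEntry p l (x * y)
      - frobEntry p l (x * y0) / frobEntry p l (x0 * y0) * frobEntry p l (x0 * y)
      = (thetaDiff p x x0 / theta p (x * y0)) * ((thetaDiff p y y0 / theta p (x0 * y))
        * frobEntry p (l * x0 * y0) (x * y)) := by
  have h := weierstrass hp hp0 hl hx hy hx0 hy0 h01
  have hl2' : theta p (l * (x0 * y0)) ≠ 0 := by rwa [← mul_assoc]
  simp only [frobEntry, thetaDiff, ← mul_assoc] at *
  generalize theta p (l * x * y) = a1, theta p (x0 * y) = a2, theta p (x * y0) = a3,
    theta p (l * x0 * y0) = a4, theta p (l * x * y0) = a5, theta p (l * x0 * y) = a6,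
    theta p (x0 * y0) = a7, theta p (x * y) = a8, theta p (y / y0) = a9, theta p (x / x0) = a10,
    theta p (l * x0 * y0 * x * y) = a11, theta p l = a12 at *
  field_simp
  linear_combination h

theorem thetaVandermonde_succ (p : ℂ) {N : ℕ} (x : Fin (N + 1) → ℂ) :
    thetaVandermonde p x
      = (∏ j : Fin N, thetaDiff p (x j.succ) (x 0)) * thetaVandermonde p (fun j => x j.succ) := by
  rw [thetaVandermonde, Fin.prod_univ_succ, Fin.prod_Ioi_zero, thetaVandermonde]
  simp only [Fin.prod_Ioi_succ]

/-- Frobenius' evaluation of the elliptic Cauchy determinant. The inductive step is Gaussian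
elimination; the three-term identity shows that the reduced entries are of the same form. -/
theorem det_frobEntry {p : ℂ} (hp : ‖p‖ < 1) (hp0 : p ≠ 0) {N : ℕ} {l : ℂ} (x y : Fin N → ℂ)
    (hl : l ≠ 0) (hx : ∀ i, x i ≠ 0) (hy : ∀ j, y j ≠ 0)
    (hxy : ∀ i j, theta p (x i * y j) ≠ 0)
    (hgen : ∀ A B : Finset (Fin N), theta p (l * (∏ i ∈ A, x i) * ∏ j ∈ B, y j) ≠ 0) :
    (Matrix.of fun i j => frobEntry p l (x i * y j)).det
      = theta p (l * (∏ i, x i) * ∏ j, y j) / theta p l * thetaVandermonde p x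
        * thetaVandermonde p y / ∏ i, ∏ j, theta p (x i * y j) := by
  induction N generalizing l with
  | zero =>
    have := hgen ∅ ∅
    simp only [prod_empty, mul_one] at this
    simp [thetaVandermonde, this]
  | succ N ih =>
    have hl1 : theta p l ≠ 0 := by simpa using hgen ∅ ∅
    have hl2 : theta p (l * x 0 * y 0) ≠ 0 := by simpa using hgen {0} {0}
    set M : Matrix (Fin (N + 1)) (Fin (N + 1)) ℂ := Matrix.of fun i j => frobEntry p l (x i * y j)
      with hM
    have hM00 : M 0 0 ≠ 0 := by
      simp only [hM, Matrix.of_apply, frobEntry]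
      rw [← mul_assoc]
      exact div_ne_zero hl2 (mul_ne_zero (hxy 0 0) hl1)
    set c : Fin (N + 1) → ℂ := fun i => if i = 0 then 0 else M i 0 / M 0 0 with hc
    have hdet : M.det = (Matrix.of fun i j => M i j - c i * M 0 j).det :=
      Matrix.det_eq_of_forall_row_eq_smul_add_const c 0 (by simp [hc]) (by
        intro i j
        simp [hc])
    rw [hdet, Matrix.det_succ_column_zero, Finset.sum_eq_single 0]
    · have hsub : (Matrix.of fun i j => M i j - c i * M 0 j).submatrix (Fin.succAbove 0) Fin.succ
          = Matrix.of fun i j => (thetaDiff p (x i.succ) (x 0) / theta p (x i.succ * y 0)) *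
            (Matrix.of (fun i j => (thetaDiff p (y j.succ) (y 0) / theta p (x 0 * y j.succ)) *
              (Matrix.of fun (i j : Fin N) =>
                frobEntry p (l * x 0 * y 0) (x i.succ * y j.succ)) i j)) i j := by
        ext i j
        simp only [hM, hc, Matrix.submatrix_apply, Matrix.of_apply, Fin.succAbove_zero,
          Fin.succ_ne_zero, if_false]
        exact frobEntry_sub hp hp0 hl (hx _) (hy _) (hx _) (hy _) (hxy _ _) (hxy _ _)
          (hxy _ _) hl1 hl2
      rw [hsub, Matrix.det_mul_column, Matrix.det_mul_row,
        ih (fun i => x i.succ) (fun j => y j.succ) (by simp [hl, hx, hy]) (fun _ => hx _)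
          (fun _ => hy _) (fun _ _ => hxy _ _) (fun A B => by
          have := hgen (cons 0 (A.map (Fin.succEmb N)) (by simp))
            (cons 0 (B.map (Fin.succEmb N)) (by simp))
          rw [prod_cons, prod_cons, prod_map, prod_map] at this
          convert this using 2
          simp only [Fin.coe_succEmb]
          ring)]
      rw [thetaVandermonde_succ p x, thetaVandermonde_succ p y]
      simp only [Fin.prod_univ_succ, Matrix.of_apply, hM, hc, if_true, zero_mul, sub_zero,
        prod_div_distrib, prod_mul_distrib, frobEntry, Fin.val_zero, pow_zero, one_mul]
      have e1 : ∏ i : Fin N, theta p (x i.succ * y 0) ≠ 0 := prod_ne_zero_iff.mpr fun _ _ => hxy _ _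
      have e2 : ∏ i : Fin N, theta p (x 0 * y i.succ) ≠ 0 := prod_ne_zero_iff.mpr fun _ _ => hxy _ _
      have e3 : ∏ i : Fin N, ∏ j : Fin N, theta p (x i.succ * y j.succ) ≠ 0 :=
        prod_ne_zero_iff.mpr fun _ _ => prod_ne_zero_iff.mpr fun _ _ => hxy _ _
      have e4 := hxy 0 0
      rw [show l * (x 0 * ∏ i : Fin N, x i.succ) * (y 0 * ∏ i : Fin N, y i.succ)
        = l * x 0 * y 0 * (∏ i : Fin N, x i.succ) * ∏ i : Fin N, y i.succ by ring,
        ← mul_assoc l]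
      field_simp
    · intro i _ hi
      have : (Matrix.of fun i j => M i j - c i * M 0 j) i 0 = 0 := by
        simp [hc, hi, hM00]
      rw [this]
      ring
    · simp

/-! ### The source identity -/

/-- The power of `c` that arises in `thetaVandermonde_scaleOn` depends on the cardinality of `K`
only. -/
theorem prod_Ioi_ite_mem {N : ℕ} (K : Finset (Fin N)) (c : ℂ) :
    ∃ e : ℕ, 2 * e + #K = #K * #K ∧
      ∏ i, ∏ j ∈ Ioi i, (if i ∈ K ∧ j ∈ K then c else 1) = c ^ e := by
  refine ⟨∑ i, ∑ j ∈ Ioi i, if i ∈ K ∧ j ∈ K then 1 else 0, ?_, ?_⟩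
  · have h := sum_sum_Ioi_add_eq_sum_sum_off_diag
      (fun i j : Fin N => if i ∈ K ∧ j ∈ K then 1 else 0)
    have h2 : ∀ i j : Fin N, ((if j ∈ K ∧ i ∈ K then 1 else 0) + if i ∈ K ∧ j ∈ K then 1 else 0)
        = 2 * if i ∈ K ∧ j ∈ K then 1 else 0 := by
      intro i j
      simp only [and_comm (a := j ∈ K)]
      ring
    simp only [h2, ← mul_sum] at h
    rw [h]
    have h3 : ∀ i, (∑ j ∈ ({i}ᶜ : Finset (Fin N)), if j ∈ K ∧ i ∈ K then 1 else 0)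
        + (if i ∈ K then 1 else 0) = ∑ j, if j ∈ K ∧ i ∈ K then 1 else 0 := by
      intro i
      rw [← sum_compl_add_sum {i}]
      simp only [sum_singleton, and_self]
    have h4 : #K = ∑ i, if i ∈ K then 1 else 0 := by simp
    conv_lhs => rw [h4]
    rw [← sum_add_distrib]
    simp only [h3]
    simp [ite_and, sum_ite_mem]
  · simp only [← prod_pow_eq_pow_sum]
    refine prod_congr rfl fun i _ => prod_congr rfl fun j _ => ?_
    split_ifs <;> simp

/-- The tuple `x` with the entries in `K` multiplied by `c`. -/
def scaleOn {ι : Type*} [DecidableEq ι] (c : ℂ) (K : Finset ι) (x : ι → ℂ) : ι → ℂ :=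
  fun i => if i ∈ K then c * x i else x i

theorem thetaVandermonde_scaleOn {p : ℂ} (hp : ‖p‖ < 1) {N : ℕ} {c : ℂ} (hc : c ≠ 0)
    (x : Fin N → ℂ) (hx : ∀ i, x i ≠ 0) (hxx : ∀ i j, i ≠ j → theta p (x i / x j) ≠ 0)
    (K : Finset (Fin N)) :
    thetaVandermonde p (scaleOn c K x)
      = thetaVandermonde p x * ((∏ i, ∏ j ∈ Ioi i, (if i ∈ K ∧ j ∈ K then c else 1)) *
        ∏ i ∈ K, ∏ j ∈ Kᶜ, theta p (c * x i / x j) / theta p (x i / x j)) := by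
  set R : Fin N → Fin N → ℂ := fun i j =>
    if i ∈ K ∧ j ∉ K then theta p (c * x i / x j) / theta p (x i / x j) else 1 with hR
  have h1 : ∏ i ∈ K, ∏ j ∈ Kᶜ, theta p (c * x i / x j) / theta p (x i / x j)
      = ∏ i, ∏ j ∈ Ioi i, R j i * R i j := by
    rw [prod_prod_Ioi_mul_eq_prod_prod_off_diag]
    have : ∀ i, ∏ j ∈ ({i}ᶜ : Finset (Fin N)), R j i = ∏ j, R j i := by
      intro i
      rw [← prod_compl_mul_prod {i}]
      simp [hR]
    simp only [this]
    rw [Finset.prod_comm (s := univ) (t := univ) (f := fun i j => R j i),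
      ← prod_subset (subset_univ K)]
    · refine prod_congr rfl fun i hi => ?_
      rw [← prod_subset (subset_univ Kᶜ)]
      · refine prod_congr rfl fun j hj => ?_
        rw [mem_compl] at hj
        simp [hR, hi, hj]
      · intro j _ hj
        rw [mem_compl] at hj
        simp [hR, hj]
    · intro i _ hi
      simp [hR, hi]
  rw [h1]
  simp only [thetaVandermonde, ← prod_mul_distrib]
  refine prod_congr rfl fun i _ => prod_congr rfl fun j hj => ?_
  have hij : j ≠ i := (mem_Ioi.mp hj).ne'
  have e1 := hxx _ _ hij
  have e2 := hxx _ _ hij.symm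
  have e3 := hx i
  have e4 := hx j
  by_cases hi : i ∈ K <;> by_cases hjK : j ∈ K
  · simp only [scaleOn, hR, hi, hjK, if_true, thetaDiff, mul_div_mul_left _ _ hc]
    simp
    ring
  · simp only [scaleOn, hR, hi, hjK, if_true, if_false]
    rw [thetaDiff_swap hp e4 (mul_ne_zero hc e3), thetaDiff_swap hp e4 e3]
    simp only [thetaDiff]
    simp
    field_simp
  · simp only [scaleOn, hR, hi, hjK, if_true, if_false, thetaDiff]
    simp
    field_simp
  · simp [scaleOn, hR, hi, hjK]

theorem sum_powersetCard_eq_of_forall_pow {α : Type*} [Fintype α] (a b : Finset α → ℂ)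
    (h : ∀ u : ℂ, ∑ s, u ^ #s * a s = ∑ s, u ^ #s * b s) (k : ℕ) :
    ∑ s ∈ powersetCard k univ, a s = ∑ s ∈ powersetCard k univ, b s := by
  have h1 : (∑ s, Polynomial.X ^ #s * Polynomial.C (a s) : Polynomial ℂ)
      = ∑ s, Polynomial.X ^ #s * Polynomial.C (b s) := by
    refine Polynomial.funext fun u => ?_
    simpa only [Polynomial.eval_finsetSum, Polynomial.eval_mul, Polynomial.eval_pow,
      Polynomial.eval_X, Polynomial.eval_C] using h u
  have h2 := congrArg (fun P => Polynomial.coeff P k) h1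
  simp only [Polynomial.finsetSum_coeff, Polynomial.coeff_mul_C, Polynomial.coeff_X_pow,
    ite_mul, one_mul, zero_mul] at h2
  have key : ∀ f : Finset α → ℂ,
      ∑ s ∈ powersetCard k univ, f s = ∑ s, if k = #s then f s else 0 := by
    intro f
    rw [powersetCard_eq_filter, sum_filter, powerset_univ]
    exact sum_congr rfl fun s _ => if_congr eq_comm rfl rfl
  rw [key, key, h2]

/-- Multilinearity of the determinant in the rows. -/
theorem sum_det_frobEntry_scaleOn (p l c u : ℂ) {N : ℕ} (x y : Fin N → ℂ) :
    ∑ K, u ^ #K * (Matrix.of fun i j => frobEntry p l (scaleOn c K x i * y j)).det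
      = (Matrix.of fun i j =>
          u * frobEntry p l (c * x i * y j) + frobEntry p l (x i * y j)).det := by
  have h := Matrix.detRowAlternating.map_add_univ
    (fun i j => u * frobEntry p l (c * x i * y j)) (fun i j : Fin N => frobEntry p l (x i * y j))
  refine Eq.trans ?_ h.symm
  refine sum_congr rfl fun K _ => ?_
  have h2 := Matrix.det_mul_column (fun i => if i ∈ K then u else 1)
    (Matrix.of fun i j => frobEntry p l (scaleOn c K x i * y j))
  rw [prod_ite_mem, univ_inter, prod_const] at h2
  rw [← h2]
  refine congrArg Matrix.det ?_
  ext i j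
  by_cases hi : i ∈ K <;> simp [scaleOn, hi]

/-- The term of the source identity that belongs to the subset `K`. -/
noncomputable def sourceTerm {ι κ : Type*} [Fintype ι] [DecidableEq ι] [Fintype κ] (p c : ℂ)
    (x : ι → ℂ) (y : κ → ℂ) (K : Finset ι) : ℂ :=
  (∏ i ∈ K, ∏ j ∈ Kᶜ, theta p (c * x i / x j) / theta p (x i / x j))
    * ∏ i ∈ K, ∏ l, theta p (x i * y l) / theta p (c * x i * y l)

theorem exists_generic_scalar {p : ℂ} (hp : ‖p‖ < 1) {S : Set ℂ} (hS : S.Finite)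
    (hS0 : ∀ d ∈ S, d ≠ 0) : ∃ l : ℂ, l ≠ 0 ∧ ∀ d ∈ S, theta p (d * l) ≠ 0 := by
  have hB : ({0} ∪ ⋃ d ∈ S, {z : ℂ | z ≠ 0 ∧ theta p (d * z) = 0}).Countable :=
    (Set.countable_singleton 0).union
      (hS.countable.biUnion fun d hd => countable_setOf_theta_mul_eq_zero hp (hS0 d hd))
  obtain ⟨l, hl⟩ := (hB.dense_compl ℝ).nonempty
  simp only [Set.mem_compl_iff, Set.mem_union, Set.mem_singleton_iff, Set.mem_iUnion, not_or,
    not_exists] at hl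
  exact ⟨l, hl.1, fun d hd h => hl.2 d hd ⟨hl.1, h⟩⟩

theorem det_frobEntry_scaleOn {p : ℂ} (hp : ‖p‖ < 1) (hp0 : p ≠ 0) {N : ℕ} {l c : ℂ}
    (x y : Fin N → ℂ) (hl : l ≠ 0) (hc : c ≠ 0)
    (hx : ∀ i, x i ≠ 0) (hy : ∀ j, y j ≠ 0)
    (hxx : ∀ i j, i ≠ j → theta p (x i / x j) ≠ 0)
    (hxy : ∀ i j, theta p (x i * y j) ≠ 0) (hcxy : ∀ i j, theta p (c * x i * y j) ≠ 0)
    (K : Finset (Fin N))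
    (hgen : ∀ A B : Finset (Fin N), theta p (l * (∏ i ∈ A, scaleOn c K x i) * ∏ j ∈ B, y j) ≠ 0) :
    (Matrix.of fun i j => frobEntry p l (scaleOn c K x i * y j)).det
      = (theta p (l * (c ^ #K * ((∏ i, x i) * ∏ j, y j))) / theta p l
          * (∏ i, ∏ j ∈ Ioi i, (if i ∈ K ∧ j ∈ K then c else 1))
          * (thetaVandermonde p x * thetaVandermonde p y) / ∏ i, ∏ j, theta p (x i * y j))
        * sourceTerm p c x y K := by
  rw [det_frobEntry hp hp0 _ _ hl (fun i => ?_) hy (fun i j => ?_) hgen,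
    thetaVandermonde_scaleOn hp hc x hx hxx]
  · have h1 : ∏ i, scaleOn c K x i = c ^ #K * ∏ i, x i := by
      have : ∀ i, scaleOn c K x i = (if i ∈ K then c else 1) * x i := by
        intro i; by_cases hi : i ∈ K <;> simp [scaleOn, hi]
      simp only [this, prod_mul_distrib, prod_ite_mem, univ_inter, prod_const]
    have h2 : ∏ i, ∏ j, theta p (scaleOn c K x i * y j)
        = (∏ i, ∏ j, theta p (x i * y j)) *
          (∏ i ∈ K, ∏ l, theta p (x i * y l) / theta p (c * x i * y l))⁻¹ := by
      have h3 : ∏ i ∈ K, ∏ l, theta p (x i * y l) / theta p (c * x i * y l)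
          = ∏ i, if i ∈ K then ∏ l, theta p (x i * y l) / theta p (c * x i * y l) else 1 := by
        rw [prod_ite_mem, univ_inter]
      rw [h3, ← prod_inv_distrib, ← prod_mul_distrib]
      refine prod_congr rfl fun i _ => ?_
      by_cases hi : i ∈ K
      · simp only [scaleOn, hi, if_true, ← prod_inv_distrib, ← prod_mul_distrib, inv_div]
        refine prod_congr rfl fun j _ => ?_
        have := hxy i j
        field_simp
      · simp [scaleOn, hi]
    rw [h1, h2, sourceTerm, show l * (c ^ #K * ∏ i, x i) * ∏ j, y j
      = l * (c ^ #K * ((∏ i, x i) * ∏ j, y j)) by ring]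
    rw [div_mul_eq_div_div, div_inv_eq_mul]
    ring
  · by_cases hi : i ∈ K <;> simp [scaleOn, hi, hx, hc]
  · by_cases hi : i ∈ K <;> simp [scaleOn, hi, hxy, hcxy]

theorem source_identity_fin {p : ℂ} (hp : ‖p‖ < 1) (hp0 : p ≠ 0) {N : ℕ} {c : ℂ}
    (x y : Fin N → ℂ) (hc : c ≠ 0) (hx : ∀ i, x i ≠ 0) (hy : ∀ j, y j ≠ 0)
    (hxx : ∀ i j, i ≠ j → theta p (x i / x j) ≠ 0)
    (hyy : ∀ i j, i ≠ j → theta p (y i / y j) ≠ 0)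
    (hxy : ∀ i j, theta p (x i * y j) ≠ 0) (hcxy : ∀ i j, theta p (c * x i * y j) ≠ 0) (k : ℕ) :
    ∑ K ∈ powersetCard k univ, sourceTerm p c x y K
      = ∑ K ∈ powersetCard k univ, sourceTerm p c y x K := by
  -- the auxiliary parameter of the determinant is chosen off all zeros that matter
  set S : Set ℂ := insert (c ^ k * ((∏ i, x i) * ∏ j, y j)) (Set.range
      (fun a : Finset (Fin N) × Finset (Fin N) × Finset (Fin N) =>
        (∏ i ∈ a.2.1, scaleOn c a.1 x i) * ∏ j ∈ a.2.2, y j) ∪ Set.range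
      (fun a : Finset (Fin N) × Finset (Fin N) × Finset (Fin N) =>
        (∏ i ∈ a.2.1, scaleOn c a.1 y i) * ∏ j ∈ a.2.2, x j)) with hSdef
  have hsc : ∀ (z : Fin N → ℂ), (∀ i, z i ≠ 0) → ∀ K i, scaleOn c K z i ≠ 0 := by
    intro z hz K i
    by_cases hi : i ∈ K <;> simp [scaleOn, hi, hz, hc]
  obtain ⟨l, hl, hlS⟩ := exists_generic_scalar hp (S := S)
    (((Set.finite_range _).union (Set.finite_range _)).insert _) (by
      rintro d (rfl | ⟨a, rfl⟩ | ⟨a, rfl⟩)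
      · exact mul_ne_zero (pow_ne_zero _ hc) (mul_ne_zero (prod_ne_zero_iff.mpr fun i _ => hx i)
          (prod_ne_zero_iff.mpr fun i _ => hy i))
      · exact mul_ne_zero (prod_ne_zero_iff.mpr fun i _ => hsc x hx _ i)
          (prod_ne_zero_iff.mpr fun i _ => hy i)
      · exact mul_ne_zero (prod_ne_zero_iff.mpr fun i _ => hsc y hy _ i)
          (prod_ne_zero_iff.mpr fun i _ => hx i))
  have hl1 : theta p l ≠ 0 := by
    have := hlS _ (Or.inr (Or.inl ⟨(∅, ∅, ∅), rfl⟩))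
    simpa using this
  have hlk : theta p (l * (c ^ k * ((∏ i, x i) * ∏ j, y j))) ≠ 0 := by
    have := hlS _ (Or.inl rfl)
    rwa [mul_comm] at this
  have hV : ∀ z : Fin N → ℂ, (∀ i, z i ≠ 0) → (∀ i j, i ≠ j → theta p (z i / z j) ≠ 0) →
      thetaVandermonde p z ≠ 0 := fun z hz hzz =>
    prod_ne_zero_iff.mpr fun i _ => prod_ne_zero_iff.mpr fun j hj =>
      mul_ne_zero (hz i) (hzz _ _ (mem_Ioi.mp hj).ne')
  have hswap : ∏ i, ∏ j, theta p (y i * x j) = ∏ i, ∏ j, theta p (x i * y j) := by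
    rw [Finset.prod_comm]
    simp only [mul_comm (y _)]
  have hP : ∏ i, ∏ j, theta p (x i * y j) ≠ 0 :=
    prod_ne_zero_iff.mpr fun i _ => prod_ne_zero_iff.mpr fun j _ => hxy i j
  have hdet : ∀ u : ℂ,
      ∑ K, u ^ #K * (Matrix.of fun i j => frobEntry p l (scaleOn c K x i * y j)).det
      = ∑ K, u ^ #K * (Matrix.of fun i j => frobEntry p l (scaleOn c K y i * x j)).det := by
    intro u
    rw [sum_det_frobEntry_scaleOn, sum_det_frobEntry_scaleOn, ← Matrix.det_transpose]
    congr 1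
    ext i j
    simp only [Matrix.transpose_apply, Matrix.of_apply]
    rw [show c * x j * y i = c * y i * x j by ring, mul_comm (x j)]
  have hk := sum_powersetCard_eq_of_forall_pow _ _ hdet k
  obtain ⟨e, he⟩ : ∃ e : ℕ, 2 * e + k = k * k ∨ ∀ e' : ℕ, 2 * e' + k ≠ k * k := by
    by_cases h : ∃ e : ℕ, 2 * e + k = k * k
    · exact ⟨h.choose, Or.inl h.choose_spec⟩
    · exact ⟨0, Or.inr (not_exists.mp h)⟩
  have hone : ∀ K ∈ powersetCard k (univ : Finset (Fin N)),
      ∏ i, ∏ j ∈ Ioi i, (if i ∈ K ∧ j ∈ K then c else 1) = c ^ e := by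
    intro K hK
    obtain ⟨e', h1, h2⟩ := prod_Ioi_ite_mem K c
    rw [(mem_powersetCard.mp hK).2] at h1
    rcases he with he | he
    · rw [h2]
      congr 1
      omega
    · exact absurd h1 (he e')
  set G := theta p (l * (c ^ k * ((∏ i, x i) * ∏ j, y j))) / theta p l * c ^ e
      * (thetaVandermonde p x * thetaVandermonde p y) / ∏ i, ∏ j, theta p (x i * y j) with hG
  have hG0 : G ≠ 0 := by
    refine div_ne_zero (mul_ne_zero (mul_ne_zero (div_ne_zero hlk hl1) (pow_ne_zero _ hc)) ?_) hP
    exact mul_ne_zero (hV x hx hxx) (hV y hy hyy)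
  have hL : ∀ K ∈ powersetCard k (univ : Finset (Fin N)),
      (Matrix.of fun i j => frobEntry p l (scaleOn c K x i * y j)).det
        = G * sourceTerm p c x y K := by
    intro K hK
    rw [det_frobEntry_scaleOn hp hp0 x y hl hc hx hy hxx hxy hcxy K, hone K hK,
      (mem_powersetCard.mp hK).2]
    intro A B
    have := hlS _ (Or.inr (Or.inl ⟨(K, A, B), rfl⟩))
    rwa [mul_comm, ← mul_assoc] at this
  have hR : ∀ K ∈ powersetCard k (univ : Finset (Fin N)),
      (Matrix.of fun i j => frobEntry p l (scaleOn c K y i * x j)).det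
        = G * sourceTerm p c y x K := by
    intro K hK
    rw [det_frobEntry_scaleOn hp hp0 y x hl hc hy hx hyy
      (fun i j => by rw [mul_comm]; exact hxy j i)
      (fun i j => by rw [mul_right_comm]; exact hcxy j i) K, hone K hK,
      (mem_powersetCard.mp hK).2, hswap, mul_comm (∏ i, y i), mul_comm (thetaVandermonde p y)]
    intro A B
    have := hlS _ (Or.inr (Or.inr ⟨(K, A, B), rfl⟩))
    rwa [mul_comm, ← mul_assoc] at this
  rw [sum_congr rfl hL, sum_congr rfl hR, ← mul_sum, ← mul_sum] at hk
  exact mul_left_cancel₀ hG0 hk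

theorem sum_sourceTerm_equiv {ι κ : Type*} [Fintype ι] [DecidableEq ι] [Fintype κ] {N N' : ℕ}
    (e : Fin N ≃ ι) (e' : Fin N' ≃ κ) (p c : ℂ) (x : ι → ℂ) (y : κ → ℂ) (k : ℕ) :
    ∑ K ∈ powersetCard k univ, sourceTerm p c (x ∘ e) (y ∘ e') K
      = ∑ K ∈ powersetCard k univ, sourceTerm p c x y K := by
  refine sum_equiv e.finsetCongr (fun K => by simp [mem_powersetCard]) fun K _ => ?_
  have hc : (K.map e.toEmbedding)ᶜ = Kᶜ.map e.toEmbedding := by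
    ext i; simp
  rw [sourceTerm, sourceTerm, Equiv.finsetCongr_apply, hc]
  simp only [prod_map, Equiv.coe_toEmbedding, Function.comp]
  congr 1
  refine prod_congr rfl fun i _ => ?_
  exact e'.prod_comp fun l => theta p (x (e i) * y l) / theta p (c * x (e i) * y l)

/-- The source identity: the Frobenius determinant with rows `f(x_i y_j) + u f(c x_i y_j)` may be
expanded along its rows, which scales subsets of the `x_i`, or along its columns, which scales
subsets of the `y_j`. -/
theorem source_identity {ι κ : Type*} [Fintype ι] [DecidableEq ι] [Fintype κ] [DecidableEq κ]
    (hcard : Fintype.card ι = Fintype.card κ)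
    {p : ℂ} (hp : ‖p‖ < 1) (hp0 : p ≠ 0) {c : ℂ}
    (x : ι → ℂ) (y : κ → ℂ) (hc : c ≠ 0) (hx : ∀ i, x i ≠ 0) (hy : ∀ j, y j ≠ 0)
    (hxx : ∀ i j, i ≠ j → theta p (x i / x j) ≠ 0)
    (hyy : ∀ i j, i ≠ j → theta p (y i / y j) ≠ 0)
    (hxy : ∀ i j, theta p (x i * y j) ≠ 0) (hcxy : ∀ i j, theta p (c * x i * y j) ≠ 0) (k : ℕ) :
    ∑ K ∈ powersetCard k univ, sourceTerm p c x y K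
      = ∑ K ∈ powersetCard k univ, sourceTerm p c y x K := by
  have e := (Fintype.equivFin ι).symm
  have e' := (Fintype.equivFinOfCardEq hcard.symm).symm
  rw [← sum_sourceTerm_equiv e e', ← sum_sourceTerm_equiv e' e]
  exact source_identity_fin hp hp0 _ _ hc (fun _ => hx _) (fun _ => hy _)
    (fun i j h => hxx _ _ (e.injective.ne h)) (fun i j h => hyy _ _ (e'.injective.ne h))
    (fun _ _ => hxy _ _) (fun _ _ => hcxy _ _) k

/-! ### Multiple principal specialization -/

section
variable {ι κ : Type*} [Fintype ι] [Fintype κ]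

/-- The term of the Kajihara–Noumi duality transformation that belongs to `μ`. Every variable
`x_i` carries a parameter `α_i`, and every `y_l` a parameter `β_l`. -/
noncomputable def kajiharaTerm (p q : ℂ) (α x : ι → ℂ) (β y : κ → ℂ) (μ : ι → ℕ) : ℂ :=
  ∏ i, ∏ a ∈ range (μ i),
    ((∏ j, theta p (α j * q ^ a * x i / x j) / theta p (q ^ ((a : ℤ) - μ j) * x i / x j))
      * ∏ l, theta p (q ^ a * (x i * y l) / β l) / theta p (q ^ a * (x i * y l)))

/-- One side of the Kajihara–Noumi duality transformation. -/
noncomputable def kajiharaSum [DecidableEq ι] (p q : ℂ) (α x : ι → ℂ) (β y : κ → ℂ) (k : ℕ) : ℂ :=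
  ∑ μ ∈ piAntidiag univ k, kajiharaTerm p q α x β y μ

theorem prod_Ico_telescope (r : ℕ → ℂ) {m n : ℕ} (hmn : m ≤ n) (h : ∀ b, m ≤ b → r b ≠ 0) :
    ∏ b ∈ Ico m n, r (b + 1) / r b = r n / r m := by
  induction n, hmn using Nat.le_induction with
  | base => simp [h m le_rfl]
  | succ n hn ih =>
    rw [prod_Ico_succ_top hn, ih]
    have := h n hn
    field_simp

theorem prod_filter_lt_fin {M m : ℕ} (hm : m ≤ M) (f : ℕ → ℂ) :
    ∏ a ∈ (univ : Finset (Fin M)).filter (fun a => a.1 < m), f a = ∏ a ∈ range m, f a := by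
  refine prod_bij (fun a _ => a.1) (fun a ha => by simpa using ha) (fun a _ b _ h => Fin.ext h)
    (fun b hb => ⟨⟨b, (mem_range.mp hb).trans_le hm⟩, by simpa using hb, rfl⟩) (fun _ _ => rfl)

theorem prod_filter_not_lt_fin {M m : ℕ} (f : ℕ → ℂ) :
    ∏ a ∈ (univ : Finset (Fin M)).filter (fun a => ¬ a.1 < m), f a = ∏ a ∈ Ico m M, f a := by
  refine prod_bij (fun a _ => a.1) (fun a ha => ?_) (fun a _ b _ h => Fin.ext h)
    (fun b hb => ⟨⟨b, (mem_Ico.mp hb).2⟩, by simpa using (mem_Ico.mp hb).1, rfl⟩) (fun _ _ => rfl)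
  rw [mem_filter] at ha
  exact mem_Ico.mpr ⟨not_lt.mp ha.2, a.2⟩

/-- The union of initial segments of the blocks `{(i,a) : a < M_i}`, of lengths `μ_i`. -/
def initialSegments (M : ι → ℕ) (μ : ι → ℕ) : Finset (Σ i, Fin (M i)) :=
  univ.filter fun s => s.2.1 < μ s.1

theorem initialSegments_eq_sigma (M μ : ι → ℕ) :
    initialSegments M μ = univ.sigma fun i => univ.filter fun a : Fin (M i) => a.1 < μ i := by
  ext ⟨i, a⟩; simp [initialSegments]

theorem compl_initialSegments [DecidableEq ι] (M μ : ι → ℕ) :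
    (initialSegments M μ)ᶜ = univ.sigma fun i => univ.filter fun a : Fin (M i) => ¬ a.1 < μ i := by
  ext ⟨i, a⟩; simp [initialSegments]

theorem card_initialSegments {M μ : ι → ℕ} (h : ∀ i, μ i ≤ M i) :
    #(initialSegments M μ) = ∑ i, μ i := by
  rw [initialSegments_eq_sigma, card_sigma]
  refine sum_congr rfl fun i _ => ?_
  rw [← card_range (μ i)]
  refine card_bij (fun a _ => a.1) (fun a ha => by simpa using ha) (fun a _ b _ h => Fin.ext h)
    (fun b hb => ⟨⟨b, (mem_range.mp hb).trans_le (h i)⟩, by simpa using hb, rfl⟩)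

variable {p q : ℂ} {x : ι → ℂ} {y : κ → ℂ} {M : ι → ℕ} {N : κ → ℕ}

/-- At the points `q^{a+e} x_i` with `a < M_i`, the products over the blocks in the term of a union
of initial segments telescope to a term of the duality transformation. -/
theorem sourceTerm_initialSegments [DecidableEq ι] (hq0 : q ≠ 0)
    (hq : ∀ c : ℤ, c ≠ 0 → theta p (q ^ c) ≠ 0) (hx : ∀ i, x i ≠ 0)
    (hxx : ∀ i j, i ≠ j → ∀ c : ℤ, theta p (q ^ c * x i / x j) ≠ 0)
    (hxy : ∀ i l, ∀ c : ℤ, theta p (q ^ c * (x i * y l)) ≠ 0)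
    {μ : ι → ℕ} (hμ : ∀ i, μ i ≤ M i) {e f : ℕ} (hef : e + f = 1) :
    sourceTerm p q⁻¹ (fun s : Σ i, Fin (M i) => q ^ (s.2.1 + e) * x s.1)
        (fun s : Σ l, Fin (N l) => q ^ (s.2.1 + f) * y s.1) (initialSegments M μ)
      = kajiharaTerm p q (fun i => (q ^ M i)⁻¹) x (fun l => (q ^ N l)⁻¹) y μ := by
  have h1 : ∀ (i j : ι) (a b : ℕ),
      q ^ (a + e) * x i / (q ^ (b + e) * x j) = q ^ ((a : ℤ) - b) * x i / x j := by
    intro i j a b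
    rw [zpow_sub₀ hq0, zpow_natCast, zpow_natCast, pow_add, pow_add]
    have := hx j
    field_simp
  have h2 : ∀ (i j : ι) (a b : ℕ),
      q⁻¹ * (q ^ (a + e) * x i) / (q ^ (b + e) * x j)
        = q ^ ((a : ℤ) - (b + 1 : ℕ)) * x i / x j := by
    intro i j a b
    rw [mul_div_assoc, h1, Nat.cast_add, Nat.cast_one, ← sub_sub, zpow_sub_one₀ hq0]
    ring
  have h3 : ∀ (i : ι) (l : κ) (a b : ℕ),
      q ^ (a + e) * x i * (q ^ (b + f) * y l) = q ^ ((a : ℤ) + (b + 1 : ℕ)) * (x i * y l) := by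
    intro i l a b
    have : q ^ ((a : ℤ) + (b + 1 : ℕ)) = q ^ (a + e) * q ^ (b + f) := by
      rw [← pow_add, ← Nat.cast_add, zpow_natCast]
      congr 1
      omega
    rw [this]
    ring
  have h4 : ∀ (i : ι) (l : κ) (a b : ℕ),
      q⁻¹ * (q ^ (a + e) * x i) * (q ^ (b + f) * y l) = q ^ ((a : ℤ) + (b : ℕ)) * (x i * y l) := by
    intro i l a b
    rw [mul_assoc, h3, ← mul_assoc, ← zpow_neg_one, ← zpow_add₀ hq0]
    congr 2
    push_cast
    ring
  simp only [sourceTerm, h1, h2, h3, h4, ← prod_mul_distrib]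
  rw [initialSegments_eq_sigma, prod_sigma]
  rw [← initialSegments_eq_sigma, compl_initialSegments, kajiharaTerm]
  refine prod_congr rfl fun i _ => ?_
  simp only [prod_sigma, ← univ_sigma_univ]
  rw [prod_filter_lt_fin (hμ i) (fun a => (∏ j, ∏ b ∈ univ.filter
      (fun b : Fin (M j) => ¬ b.1 < μ j), theta p (q ^ ((a : ℤ) - (b.1 + 1 : ℕ)) * x i / x j)
        / theta p (q ^ ((a : ℤ) - b.1) * x i / x j))
    * ∏ l, ∏ b : Fin (N l), theta p (q ^ ((a : ℤ) + (b.1 + 1 : ℕ)) * (x i * y l))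
        / theta p (q ^ ((a : ℤ) + (b.1 : ℕ)) * (x i * y l)))]
  refine prod_congr rfl fun a ha => ?_
  have ha' := mem_range.mp ha
  congr 1
  · refine prod_congr rfl fun j _ => ?_
    rw [prod_filter_not_lt_fin (fun b => theta p (q ^ ((a : ℤ) - (b + 1 : ℕ)) * x i / x j)
        / theta p (q ^ ((a : ℤ) - b) * x i / x j)),
      prod_Ico_telescope (fun b => theta p (q ^ ((a : ℤ) - b) * x i / x j)) (hμ j)]
    · congr 3
      rw [zpow_sub₀ hq0, zpow_natCast, zpow_natCast]
      field_simp
    · intro b hb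
      by_cases hij : i = j
      · subst hij
        rw [mul_div_assoc, div_self (hx i), mul_one]
        exact hq _ (by omega)
      · exact hxx i j hij _
  · refine prod_congr rfl fun l _ => ?_
    rw [Fin.prod_univ_eq_prod_range (fun b => theta p (q ^ ((a : ℤ) + (b + 1 : ℕ)) * (x i * y l))
        / theta p (q ^ ((a : ℤ) + (b : ℕ)) * (x i * y l))) (N l), range_eq_Ico,
      prod_Ico_telescope (fun b => theta p (q ^ ((a : ℤ) + (b : ℕ)) * (x i * y l)))
        (Nat.zero_le _) (fun b _ => hxy i l _)]
    congr 2
    · rw [zpow_add₀ hq0, zpow_natCast, zpow_natCast, div_inv_eq_mul]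
      ring

theorem kajiharaTerm_eq_zero (hq0 : q ≠ 0) (hx : ∀ i, x i ≠ 0) (β : κ → ℂ)
    {μ : ι → ℕ} {i : ι} (hi : M i < μ i) :
    kajiharaTerm p q (fun i => (q ^ M i)⁻¹) x β y μ = 0 := by
  refine prod_eq_zero (mem_univ i) (prod_eq_zero (mem_range.mpr hi) ?_)
  rw [prod_eq_zero (mem_univ i), zero_mul]
  have := hx i
  rw [inv_mul_cancel₀ (pow_ne_zero _ hq0), one_mul, div_self this, theta_one, zero_div]

theorem exists_eq_initialSegments {K : Finset (Σ i, Fin (M i))}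
    (hK : ∀ i (a b : Fin (M i)), b < a → (⟨i, a⟩ : Σ i, Fin (M i)) ∈ K → ⟨i, b⟩ ∈ K) :
    ∃ μ : ι → ℕ, (∀ i, μ i ≤ M i) ∧ initialSegments M μ = K := by
  classical
  have hex : ∀ i, ∃ n, ¬ ∃ h : n < M i, (⟨i, ⟨n, h⟩⟩ : Σ i, Fin (M i)) ∈ K :=
    fun i => ⟨M i, fun ⟨h, _⟩ => lt_irrefl _ h⟩
  refine ⟨fun i => Nat.find (hex i), fun i => Nat.find_min' _ fun ⟨h, _⟩ => lt_irrefl _ h, ?_⟩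
  ext ⟨i, a⟩
  simp only [initialSegments, mem_filter, mem_univ, true_and]
  constructor
  · intro h
    obtain ⟨_, h2⟩ := not_not.mp (Nat.find_min (hex i) h)
    exact h2
  · intro h
    by_contra hlt
    rw [not_lt] at hlt
    refine Nat.find_spec (hex i) ⟨hlt.trans_lt a.2, ?_⟩
    rcases hlt.lt_or_eq with h1 | h1
    · exact hK i a _ h1 h
    · convert h

/-- If some block meets `K` in a set that is not an initial segment, then `K` contains a point
`q^{a+1} u` but not `q^a u`, and the factor `θ(q⁻¹ q^{a+1} u / (q^a u)) = θ(1)` vanishes. -/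
theorem sourceTerm_eq_zero [DecidableEq ι] (hq0 : q ≠ 0) (hx : ∀ i, x i ≠ 0) {e : ℕ}
    {Y : (Σ l, Fin (N l)) → ℂ} {K : Finset (Σ i, Fin (M i))}
    (hK : ¬ ∀ i (a b : Fin (M i)), b < a → (⟨i, a⟩ : Σ i, Fin (M i)) ∈ K → ⟨i, b⟩ ∈ K) :
    sourceTerm p q⁻¹ (fun s : Σ i, Fin (M i) => q ^ (s.2.1 + e) * x s.1) Y K = 0 := by
  push Not at hK
  obtain ⟨i, a, b, hba, ha, hb⟩ := hK
  -- some block has consecutive positions `n ∉ K`, `n + 1 ∈ K`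
  obtain ⟨n, h1, h2, h3⟩ : ∃ n, ∃ h : n + 1 < M i,
      (⟨i, ⟨n + 1, h⟩⟩ : Σ i, Fin (M i)) ∈ K ∧
      (⟨i, ⟨n, (Nat.lt_succ_self n).trans h⟩⟩ : Σ i, Fin (M i)) ∉ K := by
    by_contra! hcon
    have : ∀ d : ℕ, ∀ hd : b.1 + d < M i, (⟨i, ⟨b.1 + d, hd⟩⟩ : Σ i, Fin (M i)) ∉ K := by
      intro d
      induction d with
      | zero => intro hd; exact hb
      | succ d ih => intro hd h; exact ih _ (hcon (b.1 + d) hd h)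
    refine this (a.1 - b.1) (by have := a.2; have : b.1 < a.1 := hba; omega) ?_
    convert ha
    have : b.1 < a.1 := hba
    omega
  refine mul_eq_zero_of_left (prod_eq_zero h2 (prod_eq_zero (mem_compl.mpr h3) ?_)) _
  have := hx i
  have h4 : q⁻¹ * (q ^ (n + 1 + e) * x i) / (q ^ (n + e) * x i) = 1 := by
    rw [show n + 1 + e = n + e + 1 by ring, pow_succ]
    field_simp
  simp only [h4, theta_one, zero_div]

theorem sum_sourceTerm_eq_kajiharaSum [DecidableEq ι] (hq0 : q ≠ 0)
    (hq : ∀ c : ℤ, c ≠ 0 → theta p (q ^ c) ≠ 0) (hx : ∀ i, x i ≠ 0)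
    (hxx : ∀ i j, i ≠ j → ∀ c : ℤ, theta p (q ^ c * x i / x j) ≠ 0)
    (hxy : ∀ i l, ∀ c : ℤ, theta p (q ^ c * (x i * y l)) ≠ 0) {e f : ℕ} (hef : e + f = 1) (k : ℕ) :
    ∑ K ∈ powersetCard k univ, sourceTerm p q⁻¹ (fun s : Σ i, Fin (M i) => q ^ (s.2.1 + e) * x s.1)
        (fun s : Σ l, Fin (N l) => q ^ (s.2.1 + f) * y s.1) K
      = kajiharaSum p q (fun i => (q ^ M i)⁻¹) x (fun l => (q ^ N l)⁻¹) y k := by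
  classical
  have h0 : kajiharaSum p q (fun i => (q ^ M i)⁻¹) x (fun l => (q ^ N l)⁻¹) y k
      = ∑ μ ∈ (piAntidiag univ k).filter (fun μ : ι → ℕ => ∀ i, μ i ≤ M i),
        kajiharaTerm p q (fun i => (q ^ M i)⁻¹) x (fun l => (q ^ N l)⁻¹) y μ := by
    rw [kajiharaSum, sum_filter_of_ne]
    intro μ _ h
    by_contra! hcon
    obtain ⟨i, hi⟩ := hcon
    exact h (kajiharaTerm_eq_zero hq0 hx _ hi)
  rw [h0]
  symm
  refine sum_of_injOn (initialSegments M) ?_ ?_ ?_ ?_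
  · intro μ hμ ν hν h
    simp only [coe_filter, Set.mem_ofPred_eq, mem_piAntidiag] at hμ hν
    -- the length of a segment can be read off from the segment
    have key : ∀ μ ν : ι → ℕ, (∀ i, μ i ≤ M i) → initialSegments M μ = initialSegments M ν →
        ∀ i, μ i ≤ ν i := by
      intro μ ν hμ h i
      by_contra! hlt
      have h1 : (⟨i, ⟨ν i, hlt.trans_le (hμ i)⟩⟩ : Σ i, Fin (M i)) ∈ initialSegments M μ := by
        simpa [initialSegments] using hlt
      rw [h] at h1
      simp [initialSegments] at h1
    exact funext fun i => le_antisymm (key μ ν hμ.2 h i) (key ν μ hν.2 h.symm i)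
  · intro μ hμ
    simp only [coe_filter, Set.mem_ofPred_eq, mem_piAntidiag] at hμ
    simp [mem_powersetCard, card_initialSegments hμ.2, hμ.1.1]
  · intro K hK hK2
    refine sourceTerm_eq_zero hq0 hx fun h => hK2 ?_
    obtain ⟨μ, h1, h2⟩ := exists_eq_initialSegments h
    refine ⟨μ, ?_, h2⟩
    rw [← h2, mem_powersetCard, card_initialSegments h1] at hK
    simpa [mem_piAntidiag, hK.2] using h1
  · intro μ hμ
    rw [mem_filter] at hμ
    exact (sourceTerm_initialSegments hq0 hq hx hxx hxy hμ.2 hef).symm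

theorem theta_block_ne_zero {γ : Type*} {x : γ → ℂ} {M : γ → ℕ} (hq0 : q ≠ 0)
    (hq : ∀ c : ℤ, c ≠ 0 → theta p (q ^ c) ≠ 0)
    (hx : ∀ i, x i ≠ 0) (hxx : ∀ i j, i ≠ j → ∀ c : ℤ, theta p (q ^ c * x i / x j) ≠ 0)
    (e : ℕ)
    (s s' : Σ i, Fin (M i)) (hne : s ≠ s') :
    theta p (q ^ (s.2.1 + e) * x s.1 / (q ^ (s'.2.1 + e) * x s'.1)) ≠ 0 := by
  obtain ⟨i, a⟩ := s
  obtain ⟨j, b⟩ := s'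
  have h1 : q ^ (a.1 + e) * x i / (q ^ (b.1 + e) * x j) = q ^ ((a.1 : ℤ) - b.1) * x i / x j := by
    rw [zpow_sub₀ hq0, zpow_natCast, zpow_natCast, pow_add, pow_add]
    have := hx j
    field_simp
  simp only [h1]
  by_cases hij : i = j
  · subst hij
    rw [mul_div_assoc, div_self (hx i), mul_one]
    refine hq _ fun h => hne ?_
    have : a = b := Fin.ext (by omega)
    rw [this]
  · exact hxx i j hij _

/-- The duality transformation for parameters in `q^{-ℕ}`: the source identity at
`x_i, q x_i, …, q^{M_i - 1} x_i`, where only unions of initial segments contribute. -/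
theorem kajiharaSum_comm_of_pow [DecidableEq ι] [DecidableEq κ] (hp : ‖p‖ < 1) (hp0 : p ≠ 0)
    (hq0 : q ≠ 0)
    (hq : ∀ c : ℤ, c ≠ 0 → theta p (q ^ c) ≠ 0) (hx : ∀ i, x i ≠ 0) (hy : ∀ l, y l ≠ 0)
    (hxx : ∀ i j, i ≠ j → ∀ c : ℤ, theta p (q ^ c * x i / x j) ≠ 0)
    (hyy : ∀ i j, i ≠ j → ∀ c : ℤ, theta p (q ^ c * y i / y j) ≠ 0)
    (hxy : ∀ i l, ∀ c : ℤ, theta p (q ^ c * (x i * y l)) ≠ 0)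
    (hMN : ∑ i, M i = ∑ l, N l) (k : ℕ) :
    kajiharaSum p q (fun i => (q ^ M i)⁻¹) x (fun l => (q ^ N l)⁻¹) y k
      = kajiharaSum p q (fun l => (q ^ N l)⁻¹) y (fun i => (q ^ M i)⁻¹) x k := by
  have hyx : ∀ l i, ∀ c : ℤ, theta p (q ^ c * (y l * x i)) ≠ 0 := fun l i c => by
    rw [mul_comm (y l)]; exact hxy i l c
  rw [← sum_sourceTerm_eq_kajiharaSum hq0 hq hx hxx hxy (zero_add 1),
    ← sum_sourceTerm_eq_kajiharaSum hq0 hq hy hyy hyx (add_zero 1)]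
  refine source_identity (by simpa using hMN) hp hp0 _ _ (inv_ne_zero hq0)
    (fun s => mul_ne_zero (pow_ne_zero _ hq0) (hx _))
    (fun s => mul_ne_zero (pow_ne_zero _ hq0) (hy _)) (theta_block_ne_zero hq0 hq hx hxx 0)
    (theta_block_ne_zero hq0 hq hy hyy 1)
    (fun s s' => ?_) (fun s s' => ?_) k
  · have := hxy s.1 s'.1 ((s.2.1 + s'.2.1 + 1 : ℕ) : ℤ)
    rw [zpow_natCast] at this
    convert this using 2
    ring
  · have := hxy s.1 s'.1 ((s.2.1 + s'.2.1 : ℕ) : ℤ)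
    rw [zpow_natCast] at this
    convert this using 2
    field_simp
    ring

end

/-! ### Continuation in the parameters -/

section
variable {ι κ : Type*} [Fintype ι] [Fintype κ]
variable {p q : ℂ} {x : ι → ℂ} {y : κ → ℂ}

theorem theta_mul_theta_div_mul_left (hp : ‖p‖ < 1) (hp0 : p ≠ 0) {c e u : ℂ} (hc : c ≠ 0)
    (he : e ≠ 0) (hu : u ≠ 0) :
    theta p (p * u * c) * theta p (e / (p * u)) = e / (c * p) * (u ^ 2)⁻¹
      * (theta p (u * c) * theta p (e / u)) := by
  have h1 := theta_mul_left hp hp0 (mul_ne_zero hu hc)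
  have h2 := theta_mul_left hp hp0 (z := e / (p * u)) (by simp [*])
  rw [show p * (e / (p * u)) = e / u by field_simp] at h2
  rw [mul_assoc, h1, h2]
  field_simp

theorem kajiharaTerm_update_mul_left [DecidableEq ι] [DecidableEq κ] (hp : ‖p‖ < 1)
    (hp0 : p ≠ 0) (hq0 : q ≠ 0)
    (hx : ∀ i, x i ≠ 0) (hy : ∀ l, y l ≠ 0) (α : ι → ℂ) (β : κ → ℂ) (i₀ : ι) (l₀ : κ)
    {d₁ d₂ u : ℂ} (hd₁ : d₁ ≠ 0) (hd₂ : d₂ ≠ 0) (hu : u ≠ 0) (μ : ι → ℕ) :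
    kajiharaTerm p q (Function.update α i₀ (p * u * d₁)) x
        (Function.update β l₀ (p * u * d₂)) y μ
      = (x i₀ * y l₀ / (d₁ * d₂ * p) * (u ^ 2)⁻¹) ^ (∑ i, μ i)
        * kajiharaTerm p q (Function.update α i₀ (u * d₁)) x
            (Function.update β l₀ (u * d₂)) y μ := by
  rw [kajiharaTerm, kajiharaTerm, ← prod_pow_eq_pow_sum, ← prod_mul_distrib]
  refine prod_congr rfl fun i _ => ?_
  rw [show ∀ K : ℂ, K ^ μ i = ∏ _a ∈ range (μ i), K by simp, ← prod_mul_distrib]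
  refine prod_congr rfl fun a _ => ?_
  have hα : ∀ v : ℂ, ∏ j ∈ univ.erase i₀, theta p (Function.update α i₀ v j * q ^ a * x i / x j)
        / theta p (q ^ ((a : ℤ) - μ j) * x i / x j)
      = ∏ j ∈ univ.erase i₀, theta p (α j * q ^ a * x i / x j)
        / theta p (q ^ ((a : ℤ) - μ j) * x i / x j) := fun v =>
    prod_congr rfl fun j hj => by rw [Function.update_of_ne (ne_of_mem_erase hj)]
  have hβ : ∀ v : ℂ, ∏ l ∈ univ.erase l₀, theta p (q ^ a * (x i * y l) / Function.update β l₀ v l)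
        / theta p (q ^ a * (x i * y l))
      = ∏ l ∈ univ.erase l₀, theta p (q ^ a * (x i * y l) / β l)
        / theta p (q ^ a * (x i * y l)) := fun v =>
    prod_congr rfl fun j hj => by rw [Function.update_of_ne (ne_of_mem_erase hj)]
  simp only [← mul_prod_erase univ _ (mem_univ i₀), ← mul_prod_erase univ _ (mem_univ l₀), hα, hβ,
    Function.update_self]
  have hqa := pow_ne_zero a hq0
  have h := theta_mul_theta_div_mul_left hp hp0 (c := d₁ * q ^ a * x i / x i₀)
    (e := q ^ a * (x i * y l₀) / d₂) (u := u)
    (div_ne_zero (mul_ne_zero (mul_ne_zero hd₁ hqa) (hx _)) (hx _))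
    (div_ne_zero (mul_ne_zero hqa (mul_ne_zero (hx _) (hy _))) hd₂) hu
  have e1 : p * u * (d₁ * q ^ a * x i / x i₀) = p * u * d₁ * q ^ a * x i / x i₀ := by ring
  have e2 : q ^ a * (x i * y l₀) / d₂ / (p * u) = q ^ a * (x i * y l₀) / (p * u * d₂) := by
    rw [div_div, mul_comm d₂]
  have e3 : u * (d₁ * q ^ a * x i / x i₀) = u * d₁ * q ^ a * x i / x i₀ := by ring
  have e4 : q ^ a * (x i * y l₀) / d₂ / u = q ^ a * (x i * y l₀) / (u * d₂) := by
    rw [div_div, mul_comm d₂]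
  have e5 : q ^ a * (x i * y l₀) / d₂ / (d₁ * q ^ a * x i / x i₀ * p)
      = x i₀ * y l₀ / (d₁ * d₂ * p) := by
    have := hx i
    have := hx i₀
    field_simp
  rw [e1, e2, e3, e4, e5] at h
  have key : ∀ A B C D E F G H K : ℂ, A * B = K * (C * D) →
      A / E * F * (B / G * H) = K * (C / E * F * (D / G * H)) := by
    intro A B C D E F G H K h
    linear_combination (E⁻¹ * F * (G⁻¹ * H)) * h
  exact key _ _ _ _ _ _ _ _ _ h

theorem differentiableAt_theta_comp (hp : ‖p‖ < 1) {g : ℂ → ℂ} {u : ℂ}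
    (hg : DifferentiableAt ℂ g u) (h0 : g u ≠ 0) : DifferentiableAt ℂ (fun v => theta p (g v)) u :=
  (differentiableAt_theta hp h0).comp u hg

theorem differentiableOn_kajiharaSum [DecidableEq ι] [DecidableEq κ] (hp : ‖p‖ < 1) (hq0 : q ≠ 0)
    (hx : ∀ i, x i ≠ 0) (hy : ∀ l, y l ≠ 0) {α : ι → ℂ} {β : κ → ℂ} (hα : ∀ i, α i ≠ 0)
    (hβ : ∀ l, β l ≠ 0) (i₀ : ι) (l₀ : κ)
    {d₁ d₂ : ℂ} (hd₁ : d₁ ≠ 0) (hd₂ : d₂ ≠ 0) (k : ℕ) :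
    DifferentiableOn ℂ (fun u => kajiharaSum p q (Function.update α i₀ (u * d₁)) x
      (Function.update β l₀ (u * d₂)) y k) {0}ᶜ := by
  intro u hu
  rw [Set.mem_compl_singleton_iff] at hu
  refine DifferentiableAt.differentiableWithinAt ?_
  refine DifferentiableAt.fun_sum fun μ _ => DifferentiableAt.fun_finsetProd fun i _ =>
    DifferentiableAt.fun_finsetProd fun a _ => ?_
  have hqa := pow_ne_zero a hq0
  refine DifferentiableAt.mul (DifferentiableAt.fun_finsetProd fun j _ => ?_)
    (DifferentiableAt.fun_finsetProd fun l _ => ?_)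
  · refine (differentiableAt_theta_comp hp ?_ ?_).div_const _
    · by_cases h : j = i₀
      · subst h
        simp only [Function.update_self]
        fun_prop
      · simp only [Function.update_of_ne h]
        fun_prop
    · by_cases h : j = i₀
      · subst h
        simp [hu, hd₁, hqa, hx]
      · simp [Function.update_of_ne h, hα, hqa, hx]
  · refine (differentiableAt_theta_comp hp ?_ ?_).div_const _
    · by_cases h : l = l₀
      · subst h
        simp only [Function.update_self]
        fun_prop (disch := exact mul_ne_zero hu hd₂)
      · simp only [Function.update_of_ne h]
        fun_prop
    · by_cases h : l = l₀
      · subst h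
        simp [hu, hd₂, hqa, hx, hy]
      · simp [Function.update_of_ne h, hβ, hqa, hx, hy]

theorem kajiharaSum_update_mul_left [DecidableEq ι] [DecidableEq κ] (hp : ‖p‖ < 1)
    (hp0 : p ≠ 0) (hq0 : q ≠ 0)
    (hx : ∀ i, x i ≠ 0) (hy : ∀ l, y l ≠ 0) (α : ι → ℂ) (β : κ → ℂ) (i₀ : ι) (l₀ : κ)
    {d₁ d₂ u : ℂ} (hd₁ : d₁ ≠ 0) (hd₂ : d₂ ≠ 0) (hu : u ≠ 0) (k : ℕ) :
    kajiharaSum p q (Function.update α i₀ (p * u * d₁)) x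
        (Function.update β l₀ (p * u * d₂)) y k
      = (x i₀ * y l₀ / (d₁ * d₂ * p) * (u ^ 2)⁻¹) ^ k
        * kajiharaSum p q (Function.update α i₀ (u * d₁)) x
            (Function.update β l₀ (u * d₂)) y k := by
  rw [kajiharaSum, kajiharaSum, mul_sum]
  refine sum_congr rfl fun μ hμ => ?_
  rw [kajiharaTerm_update_mul_left hp hp0 hq0 hx hy α β i₀ l₀ hd₁ hd₂ hu, (mem_piAntidiag.mp hμ).1]

theorem zpow_injective_mod (hp : ‖p‖ < 1) (hp0 : p ≠ 0) (hq0 : q ≠ 0)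
    (hq : ∀ c : ℤ, c ≠ 0 → theta p (q ^ c) ≠ 0) {i j b : ℤ} (h : q ^ i = p ^ b * q ^ j) :
    i = j := by
  by_contra hne
  refine hq (i - j) (sub_ne_zero.mpr hne) ?_
  rw [zpow_sub₀ hq0, h, mul_div_cancel_right₀ _ (zpow_ne_zero _ hq0), theta_zpow hp hp0]

/-- Both sides of the duality transformation are theta functions of the same type in a common
factor `u` of `α_{i₀}` and `β_{l₀}`. Hence they agree if they do so at infinitely many `q^{-M}`. -/
theorem kajiharaSum_comm_of_forall_update [DecidableEq ι] [DecidableEq κ] (hp : ‖p‖ < 1)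
    (hp0 : p ≠ 0) (hq0 : q ≠ 0)
    (hq : ∀ c : ℤ, c ≠ 0 → theta p (q ^ c) ≠ 0)
    (hx : ∀ i, x i ≠ 0) (hy : ∀ l, y l ≠ 0) {α : ι → ℂ} {β : κ → ℂ} (hα : ∀ i, α i ≠ 0)
    (hβ : ∀ l, β l ≠ 0) (i₀ : ι) (l₀ : κ)
    {d₁ d₂ : ℂ} (hd₁ : d₁ ≠ 0) (hd₂ : d₂ ≠ 0) (k M₀ : ℕ)
    (h : ∀ M, M₀ ≤ M →
      kajiharaSum p q (Function.update α i₀ ((q ^ M)⁻¹ * d₁)) x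
        (Function.update β l₀ ((q ^ M)⁻¹ * d₂)) y k
      = kajiharaSum p q (Function.update β l₀ ((q ^ M)⁻¹ * d₂)) y
        (Function.update α i₀ ((q ^ M)⁻¹ * d₁)) x k) {u : ℂ} (hu : u ≠ 0) :
      kajiharaSum p q (Function.update α i₀ (u * d₁)) x
        (Function.update β l₀ (u * d₂)) y k
      = kajiharaSum p q (Function.update β l₀ (u * d₂)) y
        (Function.update α i₀ (u * d₁)) x k := by
  rw [← sub_eq_zero]
  have hd1 := differentiableOn_kajiharaSum (q := q) hp hq0 hx hy hα hβ i₀ l₀ hd₁ hd₂ k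
  have hd2 := differentiableOn_kajiharaSum (q := q) hp hq0 hy hx hβ hα l₀ i₀ hd₂ hd₁ k
  refine eq_zero_of_infinite_zeros hp hp0 (C := (x i₀ * y l₀ / (d₁ * d₂ * p)) ^ k)
    (e := -(2 * k : ℕ)) (pow_ne_zero _ (div_ne_zero (mul_ne_zero (hx _) (hy _)) (by simp [*])))
    (hd1.sub hd2) (u := fun j => (q ^ (j + M₀))⁻¹) ?_
    (fun j => inv_ne_zero (pow_ne_zero _ hq0)) ?_ ?_ hu
  · intro v hv
    simp only [Pi.sub_apply]
    rw [kajiharaSum_update_mul_left hp hp0 hq0 hx hy α β i₀ l₀ hd₁ hd₂ hv,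
      kajiharaSum_update_mul_left hp hp0 hq0 hy hx β α l₀ i₀ hd₂ hd₁ hv, mul_comm (y l₀),
      mul_comm d₂, ← mul_sub, mul_pow, ← inv_pow, ← pow_mul, zpow_neg, zpow_natCast, inv_pow]
  · intro i j b hij
    simp only [← zpow_natCast, ← zpow_neg] at hij
    have := zpow_injective_mod hp hp0 hq0 hq hij
    push_cast at this
    linarith
  · intro j
    simp only [Pi.sub_apply]
    rw [sub_eq_zero]
    exact h _ (Nat.le_add_left _ _)

theorem prod_update_eq [DecidableEq ι] {f : ι → ℂ} {i : ι} (hi : f i ≠ 0) (v : ℂ) :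
    ∏ j, Function.update f i v j = v / f i * ∏ j, f j := by
  rw [prod_update_of_mem (mem_univ i), ← mul_prod_erase univ f (mem_univ i),
    sdiff_singleton_eq_erase]
  field_simp

/-- The duality transformation when all parameters but `α_{i₀}` and `β_{l₀}` are in `q^{-ℕ}`. -/
theorem kajiharaSum_comm_of_pow_of_ne [DecidableEq ι] [DecidableEq κ] (hp : ‖p‖ < 1)
    (hp0 : p ≠ 0) (hq0 : q ≠ 0)
    (hq : ∀ c : ℤ, c ≠ 0 → theta p (q ^ c) ≠ 0) (hx : ∀ i, x i ≠ 0) (hy : ∀ l, y l ≠ 0)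
    (hxx : ∀ i j, i ≠ j → ∀ c : ℤ, theta p (q ^ c * x i / x j) ≠ 0)
    (hyy : ∀ i j, i ≠ j → ∀ c : ℤ, theta p (q ^ c * y i / y j) ≠ 0)
    (hxy : ∀ i l, ∀ c : ℤ, theta p (q ^ c * (x i * y l)) ≠ 0) (k : ℕ) (i₀ : ι) (l₀ : κ)
    {α : ι → ℂ} {β : κ → ℂ} (hα : ∀ i, α i ≠ 0) (hβ : ∀ l, β l ≠ 0)
    (hαβ : ∏ i, α i = ∏ l, β l)
    (hα' : ∀ i, i ≠ i₀ → ∃ M : ℕ, α i = (q ^ M)⁻¹)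
    (hβ' : ∀ l, l ≠ l₀ → ∃ N : ℕ, β l = (q ^ N)⁻¹) :
    kajiharaSum p q α x β y k = kajiharaSum p q β y α x k := by
  choose! M hM using hα'
  choose! N hN using hβ'
  have hinv : ∀ (A B : ℕ), (q ^ (A + B))⁻¹ = (q ^ A)⁻¹ * (q ^ B)⁻¹ := fun A B => by
    rw [pow_add, mul_inv]
  have h := kajiharaSum_comm_of_forall_update hp hp0 hq0 hq hx hy hα hβ i₀ l₀ one_ne_zero
    (div_ne_zero (hβ l₀) (hα i₀)) k (∑ l ∈ univ.erase l₀, N l) ?_ (hα i₀)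
  · rwa [mul_one, Function.update_eq_self, mul_div_cancel₀ _ (hα i₀), Function.update_eq_self] at h
  · intro A hA
    -- the value of `β_{l₀}` is forced by the balancing condition
    have e1 : Function.update α i₀ ((q ^ A)⁻¹ * 1)
        = fun i => (q ^ (Function.update M i₀ A i))⁻¹ := by
      funext i
      by_cases hi : i = i₀
      · subst hi; simp
      · simp [Function.update_of_ne hi, hM i hi]
    have e2 : Function.update β l₀ ((q ^ A)⁻¹ * (β l₀ / α i₀)) = fun l => (q ^ (Function.update N l₀
        (A + ∑ i ∈ univ.erase i₀, M i - ∑ l ∈ univ.erase l₀, N l) l))⁻¹ := by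
      funext l
      by_cases hl : l = l₀
      · subst hl
        rw [Function.update_self, Function.update_self]
        have e3 : ∏ i ∈ univ.erase i₀, α i = (q ^ (∑ i ∈ univ.erase i₀, M i))⁻¹ := by
          rw [← prod_pow_eq_pow_sum, ← prod_inv_distrib]
          exact prod_congr rfl fun i hi => hM i (ne_of_mem_erase hi)
        have e4 : ∏ j ∈ univ.erase l, β j = (q ^ (∑ j ∈ univ.erase l, N j))⁻¹ := by
          rw [← prod_pow_eq_pow_sum, ← prod_inv_distrib]
          exact prod_congr rfl fun i hi => hN i (ne_of_mem_erase hi)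
        rw [← mul_prod_erase univ α (mem_univ i₀), ← mul_prod_erase univ β (mem_univ l), e3, e4]
          at hαβ
        have e5 := congrArg (fun n => (q ^ n)⁻¹) (Nat.sub_add_cancel
          (show ∑ j ∈ univ.erase l, N j ≤ A + ∑ i ∈ univ.erase i₀, M i by omega))
        simp only [hinv] at e5
        have hne : (q ^ (∑ j ∈ univ.erase l, N j))⁻¹ ≠ 0 := inv_ne_zero (pow_ne_zero _ hq0)
        refine mul_right_cancel₀ hne ?_
        rw [e5]
        have := hα i₀
        field_simp at hαβ ⊢
        linear_combination (-1) * hαβ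
      · simp [Function.update_of_ne hl, hN l hl]
    rw [e1, e2]
    refine kajiharaSum_comm_of_pow hp hp0 hq0 hq hx hy hxx hyy hxy ?_ k
    rw [sum_update_of_mem (mem_univ _), sum_update_of_mem (mem_univ _), sdiff_singleton_eq_erase,
      sdiff_singleton_eq_erase]
    omega

theorem update_ne_zero {γ : Type*} [DecidableEq γ] {f : γ → ℂ} (g : γ) {v : ℂ}
    (hf : ∀ i, f i ≠ 0) (hv : v ≠ 0) (i : γ) : Function.update f g v i ≠ 0 := by
  by_cases hi : i = g
  · subst hi; simpa using hv
  · simpa [Function.update_of_ne hi] using hf i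

/-- The duality transformation when the parameters outside `S ∪ {i₀}` and `T ∪ {l₀}` are in
`q^{-ℕ}`: the parameters in `S` and `T` are freed one after the other, each against `β_{l₀}` or
`α_{i₀}`. -/
theorem kajiharaSum_comm_of_mem [DecidableEq ι] [DecidableEq κ] (hp : ‖p‖ < 1)
    (hp0 : p ≠ 0) (hq0 : q ≠ 0)
    (hq : ∀ c : ℤ, c ≠ 0 → theta p (q ^ c) ≠ 0) (hx : ∀ i, x i ≠ 0) (hy : ∀ l, y l ≠ 0)
    (hxx : ∀ i j, i ≠ j → ∀ c : ℤ, theta p (q ^ c * x i / x j) ≠ 0)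
    (hyy : ∀ i j, i ≠ j → ∀ c : ℤ, theta p (q ^ c * y i / y j) ≠ 0)
    (hxy : ∀ i l, ∀ c : ℤ, theta p (q ^ c * (x i * y l)) ≠ 0) (k : ℕ) (i₀ : ι) (l₀ : κ)
    (S : Finset ι) (T : Finset κ) :
    ∀ {α : ι → ℂ} {β : κ → ℂ}, (∀ i, α i ≠ 0) → (∀ l, β l ≠ 0) → (∏ i, α i = ∏ l, β l) →
    (∀ i, i ∉ S → i ≠ i₀ → ∃ M : ℕ, α i = (q ^ M)⁻¹) →
    (∀ l, l ∉ T → l ≠ l₀ → ∃ N : ℕ, β l = (q ^ N)⁻¹) →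
    kajiharaSum p q α x β y k = kajiharaSum p q β y α x k := by
  induction T using Finset.induction_on with
  | empty =>
    induction S using Finset.induction_on with
    | empty =>
      intro α β hα hβ hαβ hα' hβ'
      exact kajiharaSum_comm_of_pow_of_ne hp hp0 hq0 hq hx hy hxx hyy hxy k i₀ l₀ hα hβ hαβ
        (fun i => hα' i (notMem_empty i)) (fun l => hβ' l (notMem_empty l))
    | insert i S hi ih =>
      intro α β hα hβ hαβ hα' hβ'
      have h := kajiharaSum_comm_of_forall_update hp hp0 hq0 hq hx hy hα hβ i l₀ one_ne_zero
        (div_ne_zero (hβ l₀) (hα i)) k 0 ?_ (hα i)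
      · rwa [mul_one, Function.update_eq_self, mul_div_cancel₀ _ (hα i),
          Function.update_eq_self] at h
      · intro M _
        have hqM : (q ^ M)⁻¹ ≠ 0 := inv_ne_zero (pow_ne_zero _ hq0)
        refine ih (update_ne_zero i hα (by simpa using hqM))
          (update_ne_zero l₀ hβ (mul_ne_zero hqM (div_ne_zero (hβ _) (hα _)))) ?_ ?_ ?_
        · rw [prod_update_eq (hα i), prod_update_eq (hβ l₀), hαβ]
          have := hα i
          have := hβ l₀
          field_simp
        · intro j hj hj0
          by_cases hji : j = i
          · subst hji; exact ⟨M, by simp⟩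
          · rw [Function.update_of_ne hji]
            exact hα' j (by simp [hji, hj]) hj0
        · intro l hl hl0
          rw [Function.update_of_ne hl0]
          exact hβ' l hl hl0
  | insert l T hl ih =>
    intro α β hα hβ hαβ hα' hβ'
    have h := kajiharaSum_comm_of_forall_update hp hp0 hq0 hq hx hy hα hβ i₀ l
      (div_ne_zero (hα i₀) (hβ l)) one_ne_zero k 0 ?_ (hβ l)
    · rwa [mul_one, Function.update_eq_self, mul_div_cancel₀ _ (hβ l), Function.update_eq_self] at h
    · intro M _
      have hqM : (q ^ M)⁻¹ ≠ 0 := inv_ne_zero (pow_ne_zero _ hq0)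
      refine ih (update_ne_zero i₀ hα (mul_ne_zero hqM (div_ne_zero (hα _) (hβ _))))
        (update_ne_zero l hβ (by simpa using hqM)) ?_ ?_ ?_
      · rw [prod_update_eq (hα i₀), prod_update_eq (hβ l), hαβ]
        have := hα i₀
        have := hβ l
        field_simp
      · intro i hi hi0
        rw [Function.update_of_ne hi0]
        exact hα' i hi hi0
      · intro j hj hj0
        by_cases hjl : j = l
        · subst hjl; exact ⟨M, by simp⟩
        · rw [Function.update_of_ne hjl]
          exact hβ' j (by simp [hjl, hj]) hj0

theorem kajiharaTerm_option_eq_zero {x : Option ι → ℂ} (α : ι → ℂ) (β y : κ → ℂ)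
    (hx : x none ≠ 0) {μ : Option ι → ℕ} (hμ : μ none ≠ 0) :
    kajiharaTerm p q (fun i => i.elim 1 α) x β y μ = 0 := by
  refine prod_eq_zero (mem_univ none) (prod_eq_zero (mem_range.mpr (Nat.pos_of_ne_zero hμ)) ?_)
  rw [prod_eq_zero (mem_univ none), zero_mul]
  simp [hx, theta_one]

theorem kajiharaTerm_option {x : Option ι → ℂ} {y : Option κ → ℂ} (α : ι → ℂ) (β : κ → ℂ)
    (hxx : ∀ i j, i ≠ j → ∀ c : ℤ, theta p (q ^ c * x i / x j) ≠ 0)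
    (hxy : ∀ i l, ∀ c : ℤ, theta p (q ^ c * (x i * y l)) ≠ 0) (μ : ι → ℕ) :
    kajiharaTerm p q (fun i => i.elim 1 α) x (fun l => l.elim 1 β) y (fun i => i.elim 0 μ)
      = kajiharaTerm p q α (fun i => x (some i)) β (fun l => y (some l)) μ := by
  rw [kajiharaTerm, Fintype.prod_option, kajiharaTerm]
  simp only [Option.elim_none, range_zero, prod_empty, one_mul, Option.elim_some]
  refine prod_congr rfl fun i _ => prod_congr rfl fun a _ => ?_
  simp only [Fintype.prod_option, Option.elim_none, Option.elim_some, Nat.cast_zero, sub_zero,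
    zpow_natCast, one_mul, div_one]
  have h1 := hxx (some i) none (by simp) a
  have h2 := hxy (some i) none a
  rw [zpow_natCast] at h1 h2
  rw [div_self h1, div_self h2, one_mul, one_mul]

/-- Variables with parameter `1` do not contribute. -/
theorem kajiharaSum_option [DecidableEq ι] [DecidableEq κ] {x : Option ι → ℂ} {y : Option κ → ℂ}
    (α : ι → ℂ) (β : κ → ℂ)
    (hx : ∀ i, x i ≠ 0)
    (hxx : ∀ i j, i ≠ j → ∀ c : ℤ, theta p (q ^ c * x i / x j) ≠ 0)
    (hxy : ∀ i l, ∀ c : ℤ, theta p (q ^ c * (x i * y l)) ≠ 0) (k : ℕ) :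
    kajiharaSum p q (fun i => i.elim 1 α) x (fun l => l.elim 1 β) y k
      = kajiharaSum p q α (fun i => x (some i)) β (fun l => y (some l)) k := by
  symm
  refine sum_of_injOn (fun μ i => i.elim 0 μ) ?_ ?_ ?_ ?_
  · intro μ _ ν _ h
    funext i
    exact congrFun h (some i)
  · intro μ hμ
    rw [mem_coe, mem_piAntidiag] at hμ ⊢
    simpa using hμ.1
  · intro μ hμ h
    refine kajiharaTerm_option_eq_zero α _ _ (hx _) fun h0 => h ?_
    refine ⟨fun i => μ (some i), ?_, ?_⟩
    · rw [mem_piAntidiag, Fintype.sum_option, h0, zero_add] at hμ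
      rw [mem_coe, mem_piAntidiag]
      exact ⟨hμ.1, fun _ _ => mem_univ _⟩
    · funext i
      cases i <;> simp [h0]
  · intro μ _
    exact (kajiharaTerm_option α β hxx hxy μ).symm

/-- The Kajihara–Noumi duality transformation. The auxiliary variables `x none` and `y none`
serve the continuation in the parameters; they make it work also when there are no other `x_i`
or `y_l`. -/
theorem kajiharaSum_comm [DecidableEq ι] [DecidableEq κ] {x : Option ι → ℂ} {y : Option κ → ℂ}
    (hp : ‖p‖ < 1) (hp0 : p ≠ 0) (hq0 : q ≠ 0)
    (hq : ∀ c : ℤ, c ≠ 0 → theta p (q ^ c) ≠ 0) (hx : ∀ i, x i ≠ 0) (hy : ∀ l, y l ≠ 0)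
    (hxx : ∀ i j, i ≠ j → ∀ c : ℤ, theta p (q ^ c * x i / x j) ≠ 0)
    (hyy : ∀ i j, i ≠ j → ∀ c : ℤ, theta p (q ^ c * y i / y j) ≠ 0)
    (hxy : ∀ i l, ∀ c : ℤ, theta p (q ^ c * (x i * y l)) ≠ 0) (k : ℕ)
    {α : ι → ℂ} {β : κ → ℂ} (hα : ∀ i, α i ≠ 0) (hβ : ∀ l, β l ≠ 0)
    (hαβ : ∏ i, α i = ∏ l, β l) :
    kajiharaSum p q α (fun i => x (some i)) β (fun l => y (some l)) k
      = kajiharaSum p q β (fun l => y (some l)) α (fun i => x (some i)) k := by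
  have hyx : ∀ l i, ∀ c : ℤ, theta p (q ^ c * (y l * x i)) ≠ 0 := fun l i c => by
    rw [mul_comm (y l)]; exact hxy i l c
  rw [← kajiharaSum_option α β hx hxx hxy, ← kajiharaSum_option β α hy hyy hyx]
  refine kajiharaSum_comm_of_mem hp hp0 hq0 hq hx hy hxx hyy hxy k none none univ univ
    ?_ ?_ ?_ (fun i hi => absurd (mem_univ i) hi) (fun i hi => absurd (mem_univ i) hi)
  · rintro (_ | i) <;> simp [hα]
  · rintro (_ | i) <;> simp [hβ]
  · simpa [Fintype.prod_option] using hαβ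

end

/-! ### The functional equation of the gamma factors -/

/-- The double shifted factorial `∏_{j,k ≥ 0} (1 - p^j s^k x)`. -/
noncomputable def qPochInf₂ (p s x : ℂ) : ℂ := ∏' a : ℕ × ℕ, (1 + -(p ^ a.1 * s ^ a.2 * x))

section
variable {p s x : ℂ}

theorem summable_norm_pow_mul_pow (hp : ‖p‖ < 1) (hs : ‖s‖ < 1) (x : ℂ) :
    Summable fun a : ℕ × ℕ => ‖-(p ^ a.1 * s ^ a.2 * x)‖ := by
  have h := Summable.mul_of_nonneg (summable_geometric_of_lt_one (norm_nonneg _) hp)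
    (summable_geometric_of_lt_one (norm_nonneg _) hs) (fun _ => by positivity)
    (fun _ => by positivity)
  simpa only [norm_neg, norm_mul, norm_pow] using h.mul_right ‖x‖

theorem multipliable_qPochInf₂ (hp : ‖p‖ < 1) (hs : ‖s‖ < 1) (x : ℂ) :
    Multipliable fun a : ℕ × ℕ => (1 + -(p ^ a.1 * s ^ a.2 * x)) :=
  multipliable_one_add_of_summable (summable_norm_pow_mul_pow hp hs x)

theorem qPochInf₂_ne_zero (hp : ‖p‖ < 1) (hs : ‖s‖ < 1)
    (h : ∀ j k : ℕ, p ^ j * s ^ k * x ≠ 1) : qPochInf₂ p s x ≠ 0 := by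
  refine tprod_one_add_ne_zero_of_summable (fun a => ?_) (summable_norm_pow_mul_pow hp hs x)
  rw [← sub_eq_add_neg, sub_ne_zero]
  exact (h a.1 a.2).symm

theorem hasProd_qPochInf (hp : ‖p‖ < 1) (hs : ‖s‖ < 1) (x : ℂ) :
    HasProd (fun k : ℕ => qPochInf p (s ^ k * x)) (qPochInf₂ p s x) := by
  have h := (multipliable_qPochInf₂ hp hs x).hasProd
  have h2 := (Equiv.prodComm ℕ ℕ).hasProd_iff.mpr h
  refine h2.prod_fiberwise fun k => ?_
  have h3 : HasProd (fun j : ℕ => 1 + -(p ^ j * (s ^ k * x))) (qPochInf p (s ^ k * x)) :=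
    (multipliable_qPochInf hp (s ^ k * x)).hasProd
  simpa only [Function.comp, Equiv.prodComm_apply, Prod.swap, mul_assoc] using h3

theorem qPochInf₂_eq_mul (hp : ‖p‖ < 1) (hs : ‖s‖ < 1) (x : ℂ) :
    qPochInf₂ p s x = qPochInf p x * qPochInf₂ p s (s * x) := by
  have h := hasProd_qPochInf hp hs (s * x)
  have h2 : HasProd (fun k : ℕ => qPochInf p (s ^ (k + 1) * x)) (qPochInf₂ p s (s * x)) := by
    simpa only [pow_succ, mul_assoc] using h
  have h3 := HasProd.zero_mul (f := fun k : ℕ => qPochInf p (s ^ k * x)) h2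
  rw [pow_zero, one_mul] at h3
  exact (hasProd_qPochInf hp hs x).unique h3

theorem ellipticGamma_eq_div (hp : ‖p‖ < 1) (hs : ‖s‖ < 1)
    (h : ∀ j k : ℕ, p ^ j * s ^ k * x ≠ 1) :
    ellipticGamma p s x = qPochInf₂ p s (p * s / x) / qPochInf₂ p s x := by
  have h1 := (multipliable_qPochInf₂ hp hs (p * s / x)).hasProd
  have h2 := (multipliable_qPochInf₂ hp hs x).hasProd.inv₀ (qPochInf₂_ne_zero hp hs h)
  rw [div_eq_mul_inv]
  refine Eq.trans (tprod_congr fun a => ?_) (h1.mul h2).tprod_eq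
  ring

theorem EllipticGammaRegular.ne_one (h : EllipticGammaRegular p s x) (j k : ℕ) :
    p ^ j * s ^ k * x ≠ 1 := (h j k).1

theorem EllipticGammaRegular.theta_ne_zero (hp : ‖p‖ < 1) (hx : x ≠ 0)
    (h : EllipticGammaRegular p s x) (h' : EllipticGammaRegular p s (s * x)) : theta p x ≠ 0 := by
  refine DeformedRuijsenaars.theta_ne_zero hp hx (fun j => by simpa using (h j 0).1) fun j hj => ?_
  refine (h' j 0).2 ?_
  rw [zero_add, pow_one, hj, mul_comm]

theorem ellipticGamma_mul_left (hp : ‖p‖ < 1) (hs : ‖s‖ < 1) (hs0 : s ≠ 0)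
    (h : EllipticGammaRegular p s x) :
    ellipticGamma p s (s * x) = theta p x * ellipticGamma p s x := by
  have h1 : ∀ j k : ℕ, p ^ j * s ^ k * (s * x) ≠ 1 := fun j k => by
    have := h.ne_one j (k + 1)
    rwa [pow_succ, ← mul_assoc, mul_assoc _ s x] at this
  have h2 : qPochInf p x ≠ 0 := qPochInf_ne_zero hp fun j => by simpa using h.ne_one j 0
  have h3 : p * s / (s * x) = p / x := by rw [mul_comm p s, mul_div_mul_left _ _ hs0]
  have h4 : s * (p / x) = p * s / x := by ring
  rw [ellipticGamma_eq_div hp hs h1, ellipticGamma_eq_div hp hs h.ne_one, theta_eq_qPochInf hp, h3,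
    qPochInf₂_eq_mul hp hs (p / x), h4, qPochInf₂_eq_mul hp hs x]
  have h5 : qPochInf₂ p s (s * x) ≠ 0 := qPochInf₂_ne_zero hp hs h1
  field_simp

theorem EllipticGammaRegular.of_le {n l : ℕ} (hl : l ≤ n)
    (h0 : EllipticGammaRegular p s x) (hn : EllipticGammaRegular p s (s ^ n * x)) :
    EllipticGammaRegular p s (s ^ l * x) := by
  intro j k
  constructor
  · have := (h0 j (k + l)).1
    rwa [pow_add, ← mul_assoc, mul_assoc _ _ x] at this
  · intro h
    obtain ⟨d, rfl⟩ := Nat.exists_eq_add_of_le hl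
    refine (hn j (k + d)).2 ?_
    rw [add_right_comm, pow_add s (k + 1) d, ← mul_assoc, h, pow_add]
    ring

/-- Regularity at `x` and at `s^n x` implies regularity at all intermediate points: for
`|s| < 1` the set of poles is stable under `x ↦ s⁻¹ x`, and the set of zeros under `x ↦ s x`. -/
theorem GammaSolRegular.of_le {n l : ℕ} (hs0 : s ≠ 0) (hl : l ≤ n)
    (h0 : GammaSolRegular p s x) (hn : GammaSolRegular p s (s ^ n * x)) :
    GammaSolRegular p s (s ^ l * x) := by
  unfold GammaSolRegular at *
  split_ifs at * with hs
  · exact h0.of_le hl hn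
  · obtain ⟨d, rfl⟩ := Nat.exists_eq_add_of_le hl
    have e : s⁻¹ ^ (l + d) * (s⁻¹ * (s ^ (l + d) * x)) = s⁻¹ * x := by
      rw [inv_pow]
      have := pow_ne_zero (l + d) hs0
      field_simp
    have := hn.of_le (n := l + d) (l := d) (by omega) (by rwa [e])
    rwa [show s⁻¹ ^ d * (s⁻¹ * (s ^ (l + d) * x)) = s⁻¹ * (s ^ l * x) by
      rw [inv_pow, pow_add]
      have := pow_ne_zero d hs0
      field_simp] at this

theorem GammaSolRegular.theta_ne_zero (hp : ‖p‖ < 1) (hs0 : s ≠ 0) (hx : x ≠ 0)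
    (h : GammaSolRegular p s x) (h' : GammaSolRegular p s (s * x)) : theta p x ≠ 0 := by
  unfold GammaSolRegular at *
  split_ifs at * with hs
  · exact h.theta_ne_zero hp hx h'
  · rw [inv_mul_cancel_left₀ hs0] at h'
    exact h'.theta_ne_zero hp hx h

theorem gammaSol_mul_left (hp : ‖p‖ < 1) (hs0 : s ≠ 0) (hs1 : ‖s‖ ≠ 1) (hx : x ≠ 0)
    (h : GammaSolRegular p s x) (h' : GammaSolRegular p s (s * x)) :
    gammaSol p s (s * x) = theta p x * gammaSol p s x := by
  have hθ := h.theta_ne_zero hp hs0 hx h'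
  unfold GammaSolRegular gammaSol at *
  split_ifs at * with hs
  · exact ellipticGamma_mul_left hp hs hs0 h
  · have hs' : ‖s⁻¹‖ < 1 := by
      rw [norm_inv]
      exact inv_lt_one_of_one_lt₀ (lt_of_le_of_ne (not_lt.mp hs) hs1.symm)
    rw [inv_mul_cancel_left₀ hs0] at *
    rw [ellipticGamma_mul_left hp hs' (inv_ne_zero hs0) h']
    field_simp

theorem gammaSol_pow_mul (hp : ‖p‖ < 1) (hs0 : s ≠ 0) (hs1 : ‖s‖ ≠ 1) (hx : x ≠ 0) (n : ℕ)
    (h : GammaSolRegular p s x) (h' : GammaSolRegular p s (s ^ n * x)) :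
    gammaSol p s (s ^ n * x) = (∏ l ∈ range n, theta p (s ^ l * x)) * gammaSol p s x ∧
      ∀ l ∈ range n, theta p (s ^ l * x) ≠ 0 := by
  have hreg : ∀ l, l ≤ n → GammaSolRegular p s (s ^ l * x) := fun l hl => h.of_le hs0 hl h'
  have hstep : ∀ l, l < n → GammaSolRegular p s (s * (s ^ l * x)) := fun l hl => by
    rw [← mul_assoc, ← pow_succ']
    exact hreg _ hl
  have hx' : ∀ l, s ^ l * x ≠ 0 := fun l => mul_ne_zero (pow_ne_zero _ hs0) hx
  refine ⟨?_, fun l hl => (hreg l (mem_range.mp hl).le).theta_ne_zero hp hs0 (hx' l)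
    (hstep l (mem_range.mp hl))⟩
  have : ∀ m, m ≤ n →
      gammaSol p s (s ^ m * x) = (∏ l ∈ range m, theta p (s ^ l * x)) * gammaSol p s x := by
    intro m
    induction m with
    | zero => simp
    | succ m ih =>
      intro hm
      rw [pow_succ', mul_assoc, gammaSol_mul_left hp hs0 hs1 (hx' m) (hreg m (by omega))
        (hstep m hm), ih (by omega), prod_range_succ]
      ring
  exact this n le_rfl

/-- The ratio of gamma factors at `s^a x`, in terms of the ratio at `s^b x` with `a ≤ b`. -/
theorem gammaSol_div_eq (hp : ‖p‖ < 1) (hs0 : s ≠ 0) (hs1 : ‖s‖ ≠ 1) {c : ℂ} (hc : c ≠ 0)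
    (hx : x ≠ 0) {a b : ℕ} (hab : a ≤ b)
    (h1 : GammaSolRegular p s (c * (s ^ a * x))) (h2 : GammaSolRegular p s (c * (s ^ b * x)))
    (h3 : GammaSolRegular p s (s ^ a * x)) (h4 : GammaSolRegular p s (s ^ b * x)) :
    gammaSol p s (c * (s ^ a * x)) / gammaSol p s (s ^ a * x)
      = gammaSol p s (c * (s ^ b * x)) / gammaSol p s (s ^ b * x)
        * ∏ l ∈ Ico a b, theta p (s ^ l * x) / theta p (c * (s ^ l * x)) ∧
    ∀ l ∈ Ico a b, theta p (c * (s ^ l * x)) ≠ 0 := by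
  obtain ⟨d, rfl⟩ := Nat.exists_eq_add_of_le hab
  have hxa : s ^ a * x ≠ 0 := mul_ne_zero (pow_ne_zero _ hs0) hx
  have e1 : ∀ l, s ^ l * (c * (s ^ a * x)) = c * (s ^ (a + l) * x) := fun l => by
    rw [pow_add]; ring
  have e2 : ∀ l, s ^ l * (s ^ a * x) = s ^ (a + l) * x := fun l => by
    rw [pow_add]; ring
  obtain ⟨f1, g1⟩ := gammaSol_pow_mul hp hs0 hs1 (mul_ne_zero hc hxa) d h1 (by rwa [e1])
  obtain ⟨f2, g2⟩ := gammaSol_pow_mul hp hs0 hs1 hxa d h3 (by rwa [e2])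
  simp only [e1] at f1 g1
  simp only [e2] at f2 g2
  constructor
  · have n1 := prod_ne_zero_iff.mpr g1
    have n2 := prod_ne_zero_iff.mpr g2
    rw [f1, f2, prod_Ico_eq_prod_range, add_tsub_cancel_left, prod_div_distrib]
    have key : ∀ A B G H : ℂ, A ≠ 0 → B ≠ 0 → G / H = A * G / (B * H) * (B / A) := by
      intro A B G H hA hB
      by_cases hH : H = 0
      · simp [hH]
      · field_simp
    exact key _ _ _ _ n1 n2
  · intro l hl
    obtain ⟨h5, h6⟩ := mem_Ico.mp hl
    obtain ⟨m, rfl⟩ := Nat.exists_eq_add_of_le h5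
    exact g1 m (mem_range.mpr (by omega))

end

/-! ### The coefficients of the operator in terms of the duality transformation -/

section
variable {p q t : ℂ}

theorem two_mul_choose_succ (n : ℕ) : 2 * Nat.choose (n + 1) 2 = n * (n + 1) := by
  rw [Nat.choose_two_right, Nat.add_sub_cancel, mul_comm (n + 1)]
  exact Nat.two_mul_div_two_of_even (Nat.even_mul_succ_self n)

theorem two_mul_choose_two (n : ℕ) : 2 * Nat.choose n 2 + n = n * n := by
  cases n with
  | zero => simp
  | succ n =>
    rw [two_mul_choose_succ]
    ring

theorem theta_swap (hp : ‖p‖ < 1) {a b : ℂ} (ha : a ≠ 0) (hb : b ≠ 0) :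
    theta p (a / b) = -(a / b) * theta p (b / a) := by
  have := theta_inv hp (div_ne_zero hb ha)
  rw [inv_div] at this
  exact this

/-- The factors of a pair `i < j` in the coefficient, with `X = z_i/z_j`, `m = μ_i`, `n = μ_j`,
compared with those in the duality transformation. -/
theorem thetaFactorial_mul_theta (hp : ‖p‖ < 1) (hq0 : q ≠ 0) {X : ℂ} (hX : X ≠ 0) (m n : ℕ) :
    thetaFactorial p q (q * X) m * thetaFactorial p q (q / X) n * theta p X
      = q ^ (n + m * n) * (∏ a ∈ range m, theta p (q ^ ((a : ℤ) - n) * X))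
        * (∏ b ∈ range n, theta p (q ^ ((b : ℤ) - m) / X)) * theta p (q ^ ((m : ℤ) - n) * X) := by
  have hqz : ∀ c : ℤ, q ^ c ≠ 0 := fun c => zpow_ne_zero c hq0
  have inv : ∀ c : ℤ, theta p (q ^ c * X) = -(q ^ c * X) * theta p (q ^ (-c) / X) := by
    intro c
    have := theta_swap hp (mul_ne_zero (hqz c) hX) one_ne_zero
    rwa [div_one, one_div, mul_inv, ← zpow_neg, ← div_eq_mul_inv] at this
  induction m with
  | zero =>
    simp only [thetaFactorial, range_zero, prod_empty, one_mul, zero_mul, add_zero, Nat.cast_zero,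
      zero_sub, sub_zero, zpow_natCast, mul_one]
    rw [inv (-n), neg_neg, zpow_natCast]
    have h1 := inv 0
    rw [zpow_zero, one_mul, neg_zero, zpow_zero] at h1
    rw [h1]
    have h2 : (∏ l ∈ range n, theta p (q / X * q ^ l)) * theta p (1 / X)
        = (∏ l ∈ range n, theta p (q ^ l / X)) * theta p (q ^ n / X) := by
      rw [← prod_range_succ (fun l => theta p (q ^ l / X)), prod_range_succ', pow_zero]
      congr 1
      exact prod_congr rfl fun l _ => by rw [pow_succ]; ring_nf
    have h3 : q ^ n * q ^ (-n : ℤ) = 1 := by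
      rw [zpow_neg, zpow_natCast, mul_inv_cancel₀ (pow_ne_zero _ hq0)]
    linear_combination (-X) * h2
      + X * (∏ l ∈ range n, theta p (q ^ l / X)) * theta p (q ^ n / X) * h3
  | succ m ih =>
    have e1 : thetaFactorial p q (q * X) (m + 1)
        = thetaFactorial p q (q * X) m * theta p (q ^ ((m : ℤ) + 1) * X) := by
      rw [thetaFactorial, prod_range_succ, ← thetaFactorial, zpow_add_one₀ hq0, zpow_natCast]
      ring_nf
    have e2 : (∏ b ∈ range n, theta p (q ^ ((b : ℤ) - (m + 1 : ℕ)) / X))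
        * theta p (q ^ ((n : ℤ) - (m + 1)) / X)
        = theta p (q ^ (-((m : ℤ) + 1)) / X) * ∏ b ∈ range n, theta p (q ^ ((b : ℤ) - m) / X) := by
      have := prod_range_succ (fun b : ℕ => theta p (q ^ ((b : ℤ) - (m + 1)) / X)) n
      rw [prod_range_succ'] at this
      push_cast at this ⊢
      rw [← this, mul_comm, zero_sub]
      congr 1
      refine prod_congr rfl fun b _ => ?_
      congr 3
      ring
    have e3 := inv ((m : ℤ) + 1)
    have e4 := inv ((m + 1 : ℕ) - n)
    rw [prod_range_succ, e1, e4]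
    rw [show -(((m + 1 : ℕ) : ℤ) - n) = (n : ℤ) - (m + 1) by push_cast; ring]
    have e5 : (q ^ ((m + 1 : ℕ) - n : ℤ)) * q ^ n = q ^ ((m : ℤ) + 1) := by
      rw [← zpow_natCast q n, ← zpow_add₀ hq0]
      congr 1
      push_cast
      ring
    have e6 : q ^ (n + (m + 1) * n) = q ^ (n + m * n) * q ^ n := by
      rw [← pow_add]
      ring_nf
    rw [e6]
    generalize thetaFactorial p q (q * X) m = A, thetaFactorial p q (q / X) n = B,
      (∏ a ∈ range m, theta p (q ^ ((a : ℤ) - n) * X)) = C,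
      (∏ b ∈ range n, theta p (q ^ ((b : ℤ) - m) / X)) = D,
      (∏ b ∈ range n, theta p (q ^ ((b : ℤ) - (m + 1 : ℕ)) / X)) = D',
      theta p (q ^ ((n : ℤ) - (m + 1)) / X) = E, theta p (q ^ (-((m : ℤ) + 1)) / X) = F,
      q ^ ((m + 1 : ℕ) - n : ℤ) = Q1, q ^ ((m : ℤ) + 1) = Q2,
      theta p (q ^ ((m : ℤ) - n) * X) = H, q ^ (n + m * n) = Q3, q ^ n = Q4, theta p X = I at *
    generalize theta p (Q2 * X) = G at *
    linear_combination G * ih + Q3 * C * H * X * Q4 * Q1 * e2 + Q3 * C * H * D * e3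
      + Q3 * C * D * H * F * X * e5

theorem thetaFactorial_self (hp : ‖p‖ < 1) (hq0 : q ≠ 0) (m : ℕ) :
    thetaFactorial p q q m
      = (-1) ^ m * q ^ Nat.choose (m + 1) 2 * ∏ a ∈ range m, theta p (q ^ ((a : ℤ) - m)) := by
  induction m with
  | zero => simp [thetaFactorial]
  | succ m ih =>
    have e1 : thetaFactorial p q q (m + 1) = thetaFactorial p q q m * theta p (q ^ (m + 1)) := by
      rw [thetaFactorial, prod_range_succ, ← thetaFactorial, pow_succ']
    have e2 : ∏ a ∈ range (m + 1), theta p (q ^ ((a : ℤ) - (m + 1 : ℕ)))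
        = (∏ a ∈ range m, theta p (q ^ ((a : ℤ) - m))) * theta p (q ^ (m + 1))⁻¹ := by
      rw [prod_range_succ']
      congr 1
      · refine prod_congr rfl fun a _ => ?_
        congr 2
        push_cast
        ring
    have e3 : Nat.choose (m + 1 + 1) 2 = Nat.choose (m + 1) 2 + (m + 1) := by
      have h1 := two_mul_choose_succ (m + 1)
      have h2 := two_mul_choose_succ m
      nlinarith
    have hqm := pow_ne_zero (m + 1) hq0
    rw [e1, e2, e3, theta_inv hp hqm, ih,
      pow_add q (Nat.choose (m + 1) 2) (m + 1), pow_succ (-1 : ℂ)]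
    field_simp

theorem sum_choose_add_sum_mul {m : ℕ} (μ : Fin m → ℕ) :
    ∑ i, Nat.choose (μ i + 1) 2 + ∑ i, ∑ j ∈ Ioi i, μ i * μ j
      = Nat.choose (∑ i, μ i + 1) 2 := by
  have h1 := two_mul_choose_succ (∑ i, μ i)
  have h2 := sum_sum_Ioi_add_eq_sum_sum_off_diag (fun i j : Fin m => μ i * μ j)
  have h3 : ∑ i, ∑ j ∈ Ioi i, (μ j * μ i + μ i * μ j) = 2 * ∑ i, ∑ j ∈ Ioi i, μ i * μ j := by
    simp only [mul_sum]
    refine sum_congr rfl fun i _ => sum_congr rfl fun j _ => by ring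
  have h4 : ∑ i, ∑ j ∈ ({i}ᶜ : Finset (Fin m)), μ j * μ i + ∑ i, μ i * μ i
      = (∑ i, μ i) * ∑ i, μ i := by
    rw [sum_mul_sum, ← sum_add_distrib]
    refine sum_congr rfl fun i _ => ?_
    rw [← sum_compl_add_sum {i} (fun j => μ i * μ j), sum_singleton]
    simp only [mul_comm (μ i)]
  have h5 : 2 * ∑ i, Nat.choose (μ i + 1) 2 = ∑ i, μ i * μ i + ∑ i, μ i := by
    rw [mul_sum, ← sum_add_distrib]
    refine sum_congr rfl fun i _ => ?_
    rw [two_mul_choose_succ]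
    ring
  nlinarith

theorem prod_prod_eq_prod_diag_mul {m : ℕ} (F : Fin m → Fin m → ℂ) :
    ∏ i, ∏ j, F i j = (∏ i, F i i) * ∏ i, ∏ j ∈ Ioi i, F j i * F i j := by
  rw [prod_prod_Ioi_mul_eq_prod_prod_off_diag, Finset.prod_comm, ← prod_mul_distrib]
  refine prod_congr rfl fun i _ => ?_
  rw [← prod_compl_mul_prod {i} (fun j => F j i), prod_singleton, mul_comm]

theorem prod_thetaFactorial_eq (hp : ‖p‖ < 1) (hq0 : q ≠ 0) {m : ℕ} {z : Fin m → ℂ}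
    (hz : ∀ i, z i ≠ 0) (hzz : ∀ i j, i ≠ j → theta p (z i / z j) ≠ 0) (μ : Fin m → ℕ) :
    ∏ i, ∏ j, thetaFactorial p q (q * z i / z j) (μ i)
      = (-1) ^ (∑ i, μ i) * q ^ Nat.choose (∑ i, μ i + 1) 2
        * (∏ i, ∏ j ∈ Ioi i,
            q ^ (μ j) * theta p (q ^ ((μ i : ℤ) - (μ j : ℤ)) * z i / z j) / theta p (z i / z j))
        * ∏ i, ∏ j, ∏ a ∈ range (μ i), theta p (q ^ ((a : ℤ) - μ j) * z i / z j) := by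
  rw [prod_prod_eq_prod_diag_mul, prod_prod_eq_prod_diag_mul (fun i j => ∏ a ∈ range (μ i), _),
    ← sum_choose_add_sum_mul, pow_add]
  have e1 : ∏ i, thetaFactorial p q (q * z i / z i) (μ i) = (-1) ^ (∑ i, μ i)
      * q ^ (∑ i, Nat.choose (μ i + 1) 2)
      * ∏ i, ∏ a ∈ range (μ i), theta p (q ^ ((a : ℤ) - μ i) * z i / z i) := by
    rw [← prod_pow_eq_pow_sum, ← prod_pow_eq_pow_sum, ← prod_mul_distrib, ← prod_mul_distrib]
    refine prod_congr rfl fun i _ => ?_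
    simp only [mul_div_cancel_right₀ _ (hz i)]
    exact thetaFactorial_self hp hq0 _
  have e2 : ∏ i, ∏ j ∈ Ioi i, thetaFactorial p q (q * z j / z i) (μ j)
        * thetaFactorial p q (q * z i / z j) (μ i)
      = q ^ (∑ i, ∑ j ∈ Ioi i, μ i * μ j) * (∏ i, ∏ j ∈ Ioi i,
            q ^ (μ j) * theta p (q ^ ((μ i : ℤ) - (μ j : ℤ)) * z i / z j) / theta p (z i / z j))
        * ∏ i, ∏ j ∈ Ioi i, (∏ a ∈ range (μ j), theta p (q ^ ((a : ℤ) - μ i) * z j / z i))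
          * ∏ a ∈ range (μ i), theta p (q ^ ((a : ℤ) - μ j) * z i / z j) := by
    simp only [← prod_pow_eq_pow_sum, ← prod_mul_distrib]
    refine prod_congr rfl fun i _ => prod_congr rfl fun j hj => ?_
    have hX : z i / z j ≠ 0 := div_ne_zero (hz i) (hz j)
    have hθ := hzz i j (mem_Ioi.mp hj).ne
    have h := thetaFactorial_mul_theta hp hq0 hX (μ i) (μ j)
    simp only [div_div_eq_mul_div] at h
    simp only [← mul_div_assoc] at h
    rw [mul_comm (thetaFactorial _ _ _ _), eq_comm]
    rw [pow_add] at h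
    rw [← mul_left_inj' hθ, h]
    field_simp
  rw [e1, e2]
  ring

/-- The indicator function of `I`, as an exponent vector. -/
def indicatorVec {r : ℕ} (I : Finset (Fin r)) : Fin r → ℕ := fun j => if j ∈ I then 1 else 0

theorem prod_zz_eq (hp : ‖p‖ < 1) (hq0 : q ≠ 0) {m : ℕ} {z : Fin m → ℂ}
    (hq : ∀ c : ℤ, c ≠ 0 → theta p (q ^ c) ≠ 0)
    (hz : ∀ i, z i ≠ 0) (hzz : ∀ i j, i ≠ j → ∀ c : ℤ, theta p (q ^ c * z i / z j) ≠ 0)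
    (μ : Fin m → ℕ) :
    ∏ i, ∏ a ∈ range (μ i), ∏ j, theta p (t * q ^ a * z i / z j)
        / theta p (q ^ ((a : ℤ) - μ j) * z i / z j)
      = (-1) ^ (∑ i, μ i) * q ^ Nat.choose (∑ i, μ i + 1) 2 *
        ((∏ i, ∏ j, thetaFactorial p q (t * z i / z j) (μ i)
          / thetaFactorial p q (q * z i / z j) (μ i))
        * ∏ i, ∏ j ∈ Ioi i,
            q ^ (μ j) * theta p (q ^ ((μ i : ℤ) - (μ j : ℤ)) * z i / z j)
              / theta p (z i / z j)) := by
  have hzz0 : ∀ i j, i ≠ j → theta p (z i / z j) ≠ 0 := fun i j h => by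
    simpa using hzz i j h 0
  have h := prod_thetaFactorial_eq hp hq0 hz hzz0 μ
  have hne : ∏ i, ∏ j, thetaFactorial p q (q * z i / z j) (μ i) ≠ 0 := by
    refine prod_ne_zero_iff.mpr fun i _ => prod_ne_zero_iff.mpr fun j _ =>
      prod_ne_zero_iff.mpr fun a _ => ?_
    by_cases hij : i = j
    · subst hij
      rw [mul_div_cancel_right₀ _ (hz i), ← pow_succ']
      exact_mod_cast hq (a + 1 : ℕ) (by omega)
    · have := hzz i j hij (a + 1 : ℕ)
      rw [zpow_natCast, pow_succ] at this
      convert this using 2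
      ring
  have hD : ∏ i, ∏ j, ∏ a ∈ range (μ i), theta p (q ^ ((a : ℤ) - μ j) * z i / z j) ≠ 0 := by
    intro h0
    rw [h0, mul_zero] at h
    exact hne h
  simp only [prod_div_distrib]
  have e1 : ∏ i, ∏ a ∈ range (μ i), ∏ j, theta p (t * q ^ a * z i / z j)
      = ∏ i, ∏ j, thetaFactorial p q (t * z i / z j) (μ i) := by
    refine prod_congr rfl fun i _ => ?_
    rw [Finset.prod_comm]
    refine prod_congr rfl fun j _ => prod_congr rfl fun a _ => ?_
    ring_nf
  have e2 : ∏ i, ∏ a ∈ range (μ i), ∏ j, theta p (q ^ ((a : ℤ) - μ j) * z i / z j)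
      = ∏ i, ∏ j, ∏ a ∈ range (μ i), theta p (q ^ ((a : ℤ) - μ j) * z i / z j) :=
    prod_congr rfl fun i _ => Finset.prod_comm
  simp only [prod_div_distrib] at h
  rw [e1, e2, h]
  rw [h] at hne
  generalize ∏ i, ∏ j, ∏ a ∈ range (μ i), theta p (q ^ ((a : ℤ) - μ j) * z i / z j) = D at *
  generalize (-1) ^ (∑ i, μ i) * q ^ Nat.choose (∑ i, μ i + 1) 2 = A at *
  generalize ((∏ i, ∏ j ∈ Ioi i, q ^ (μ j) * theta p (q ^ ((μ i : ℤ) - (μ j : ℤ)) * z i / z j))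
    / ∏ i, ∏ j ∈ Ioi i, theta p (z i / z j)) = B at *
  have hA : A * B ≠ 0 := left_ne_zero_of_mul hne
  have hA1 := left_ne_zero_of_mul hA
  have hB1 := right_ne_zero_of_mul hA
  field_simp

theorem prod_zw_eq (hq0 : q ≠ 0) {m r : ℕ} {z : Fin m → ℂ} {w : Fin r → ℂ}
    (hzw : ∀ i j, ∀ c : ℤ, theta p (q ^ c * z i / w j) ≠ 0) (μ : Fin m → ℕ) (I : Finset (Fin r)) :
    ∏ i, ∏ a ∈ range (μ i), ∏ j, theta p (q⁻¹ * q ^ a * z i / w j)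
        / theta p (q ^ ((a : ℤ) - indicatorVec I j) * z i / w j)
      = ∏ i, ∏ j ∈ Iᶜ, theta p (z i / (q * w j)) / theta p (q ^ ((μ i : ℤ) - 1) * z i / w j) := by
  refine prod_congr rfl fun i _ => ?_
  rw [Finset.prod_comm, ← prod_subset (subset_univ Iᶜ)]
  · refine prod_congr rfl fun j hj => ?_
    have hj' : indicatorVec I j = 0 := if_neg (mem_compl.mp hj)
    have h := prod_Ico_telescope (fun a : ℕ => theta p (q ^ ((a : ℤ) - 1) * z i / w j))
      (Nat.zero_le (μ i)) (fun b _ => hzw i j _)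
    rw [← range_eq_Ico] at h
    have h2 := congrArg (fun x => x⁻¹) h
    simp only [← prod_inv_distrib, inv_div] at h2
    convert h2 using 2 with a _
    · rw [hj', zpow_sub_one₀ hq0, zpow_natCast]
      push_cast
      rw [add_sub_cancel_right, sub_zero, zpow_natCast, mul_comm q⁻¹]
    · rw [Nat.cast_zero, zero_sub, zpow_neg_one]
      congr 1
      rw [div_mul_eq_div_div, inv_mul_eq_div]
  · intro j _ hj
    rw [mem_compl, not_not] at hj
    refine prod_eq_one fun a _ => ?_
    have hj' : indicatorVec I j = 1 := if_pos hj
    rw [hj', Nat.cast_one, zpow_sub_one₀ hq0, zpow_natCast, mul_comm q⁻¹]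
    refine div_self ?_
    have := hzw i j (a - 1)
    rwa [zpow_sub_one₀ hq0, zpow_natCast] at this

theorem prod_wz_eq (hp : ‖p‖ < 1) (hq0 : q ≠ 0) (ht0 : t ≠ 0) {m r : ℕ} {z : Fin m → ℂ}
    {w : Fin r → ℂ} (hz : ∀ i, z i ≠ 0) (hw : ∀ i, w i ≠ 0) (μ : Fin m → ℕ) (I : Finset (Fin r)) :
    ∏ i ∈ I, ∏ j, theta p (t * w i / z j) / theta p (q ^ (-(μ j : ℤ)) * w i / z j)
      = t ^ (m * #I) * q ^ ((∑ i, μ i) * #I) *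
        ∏ i, ∏ j ∈ I, theta p (z i / (t * w j)) / theta p (q ^ (μ i) * z i / w j) := by
  have h : ∀ i j, theta p (t * w i / z j) / theta p (q ^ (-(μ j : ℤ)) * w i / z j)
      = t * q ^ μ j * (theta p (z j / (t * w i)) / theta p (q ^ (μ j) * z j / w i)) := by
    intro i j
    have h1 := theta_swap hp (mul_ne_zero ht0 (hw i)) (hz j)
    have hqm := pow_ne_zero (μ j) hq0
    have h2 := theta_swap hp (hw i) (mul_ne_zero hqm (hz j))
    have h3 : q ^ (-(μ j : ℤ)) * w i / z j = w i / (q ^ μ j * z j) := by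
      rw [zpow_neg, zpow_natCast]
      field_simp
    rw [h1, h3, h2, mul_div_mul_comm]
    have := hw i
    have := hz j
    congr 1
    field_simp
  simp only [h, prod_mul_distrib, prod_const, prod_pow_eq_pow_sum, card_univ, Fintype.card_fin]
  rw [Finset.prod_comm, pow_mul, pow_mul]

theorem prod_ww_eq (hp : ‖p‖ < 1) (hq0 : q ≠ 0) {r : ℕ} {w : Fin r → ℂ}
    (hq : ∀ c : ℤ, c ≠ 0 → theta p (q ^ c) ≠ 0) (hw : ∀ i, w i ≠ 0)
    (hww : ∀ i j, i ≠ j → ∀ c : ℤ, theta p (q ^ c * w i / w j) ≠ 0) (I : Finset (Fin r)) :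
    ∏ i ∈ I, ∏ j, theta p (q⁻¹ * w i / w j) / theta p (q ^ (-(indicatorVec I j : ℤ)) * w i / w j)
      = (q ^ (#I * #Iᶜ))⁻¹ *
        ∏ i ∈ I, ∏ j ∈ Iᶜ, theta p (q * w j / w i) / theta p (w j / w i) := by
  have h : ∀ i ∈ I, ∏ j, theta p (q⁻¹ * w i / w j)
        / theta p (q ^ (-(indicatorVec I j : ℤ)) * w i / w j)
      = (q ^ #Iᶜ)⁻¹ * ∏ j ∈ Iᶜ, theta p (q * w j / w i) / theta p (w j / w i) := by
    intro i hi
    rw [← inv_pow, ← prod_const, ← prod_mul_distrib, ← prod_subset (subset_univ Iᶜ)]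
    · refine prod_congr rfl fun j hj => ?_
      have hj' : indicatorVec I j = 0 := if_neg (mem_compl.mp hj)
      have h1 := theta_swap hp (hw i) (mul_ne_zero hq0 (hw j))
      have h2 := theta_swap hp (hw i) (hw j)
      rw [show q⁻¹ * w i / w j = w i / (q * w j) by field_simp, h1, hj', Nat.cast_zero, neg_zero,
        zpow_zero, one_mul, h2, mul_div_mul_comm]
      have := hw i
      have := hw j
      congr 1
      field_simp
    · intro j _ hj
      rw [mem_compl, not_not] at hj
      have hj' : indicatorVec I j = 1 := if_pos hj
      rw [hj', Nat.cast_one, zpow_neg_one]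
      refine div_self ?_
      by_cases hij : i = j
      · subst hij
        rw [mul_div_cancel_right₀ _ (hw i), ← zpow_neg_one]
        exact hq _ (by norm_num)
      · simpa using hww i j hij (-1)
  rw [prod_congr rfl h, prod_mul_distrib, prod_const, inv_pow, ← pow_mul, mul_comm #Iᶜ]

/-- The coefficient of the operator is, up to a scalar that depends only on `k = |μ| + |I|`, the
part of the Kajihara–Noumi term with parameters `t` for the `z_i` and `q⁻¹` for the `w_j` that
does not involve the dual variables. -/
theorem coeff_eq (hp : ‖p‖ < 1) (hq0 : q ≠ 0) (ht0 : t ≠ 0) {m r : ℕ} {z : Fin m → ℂ}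
    {w : Fin r → ℂ} (hq : ∀ c : ℤ, c ≠ 0 → theta p (q ^ c) ≠ 0)
    (hz : ∀ i, z i ≠ 0) (hw : ∀ i, w i ≠ 0)
    (hzz : ∀ i j, i ≠ j → ∀ c : ℤ, theta p (q ^ c * z i / z j) ≠ 0)
    (hzw : ∀ i j, ∀ c : ℤ, theta p (q ^ c * z i / w j) ≠ 0)
    (hww : ∀ i j, i ≠ j → ∀ c : ℤ, theta p (q ^ c * w i / w j) ≠ 0)
    (μ : Fin m → ℕ) (I : Finset (Fin r)) {k : ℕ} (hk : ∑ i, μ i + #I = k) :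
    coeff p q t μ I z w
      = (-1) ^ k * (q ^ Nat.choose (k + 1) 2)⁻¹ * ((t ^ m)⁻¹ * q ^ r) ^ k
        * ((∏ i, ∏ a ∈ range (μ i), ∏ j, theta p (t * q ^ a * z i / z j)
              / theta p (q ^ ((a : ℤ) - μ j) * z i / z j))
          * (∏ i, ∏ a ∈ range (μ i), ∏ j, theta p (q⁻¹ * q ^ a * z i / w j)
              / theta p (q ^ ((a : ℤ) - indicatorVec I j) * z i / w j))
          * (∏ i ∈ I, ∏ j, theta p (t * w i / z j) / theta p (q ^ (-(μ j : ℤ)) * w i / z j))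
          * (∏ i ∈ I, ∏ j, theta p (q⁻¹ * w i / w j)
              / theta p (q ^ (-(indicatorVec I j : ℤ)) * w i / w j))) := by
  rw [prod_zz_eq hp hq0 hq hz hzz, prod_zw_eq hq0 hzw, prod_wz_eq hp hq0 ht0 hz hw,
    prod_ww_eq hp hq0 hq hw hww, coeff]
  have hr : #I + #Iᶜ = r := by simp
  have hscalar : (-1 : ℂ) ^ #I * ((t ^ m)⁻¹ * q ^ r) ^ (∑ i, μ i) * q ^ (Nat.choose #I 2)
      = (-1) ^ k * (q ^ Nat.choose (k + 1) 2)⁻¹ * ((t ^ m)⁻¹ * q ^ r) ^ k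
        * ((-1) ^ (∑ i, μ i) * q ^ Nat.choose (∑ i, μ i + 1) 2) * (t ^ (m * #I)
        * q ^ ((∑ i, μ i) * #I)) * (q ^ (#I * #Iᶜ))⁻¹ := by
    rw [← hk]
    generalize ∑ i, μ i = M
    generalize #I = n at hr ⊢
    generalize #Iᶜ = d at hr ⊢
    subst hr
    have e1 : (-1 : ℂ) ^ (M + n) * (-1) ^ M = (-1) ^ n := by
      rw [pow_add, mul_right_comm, ← mul_pow]
      simp
    have e2 : ((t ^ m)⁻¹ * q ^ (n + d)) ^ (M + n) * t ^ (m * n)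
        = ((t ^ m)⁻¹ * q ^ (n + d)) ^ M * q ^ ((n + d) * n) := by
      rw [pow_add, mul_pow _ _ n, pow_mul, pow_mul, inv_pow]
      have := pow_ne_zero n (pow_ne_zero m ht0)
      field_simp
    have e3 : q ^ (Nat.choose n 2) * (q ^ Nat.choose (M + n + 1) 2 * q ^ (n * d))
        = q ^ ((n + d) * n) * q ^ Nat.choose (M + 1) 2 * q ^ (M * n) := by
      rw [← pow_add, ← pow_add, ← pow_add, ← pow_add]
      congr 1
      have h1 := two_mul_choose_succ (M + n)
      have h2 := two_mul_choose_succ M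
      have h3 := two_mul_choose_two n
      nlinarith
    have n1 : q ^ Nat.choose (M + n + 1) 2 ≠ 0 := pow_ne_zero _ hq0
    have n2 : q ^ (n * d) ≠ 0 := pow_ne_zero _ hq0
    calc (-1 : ℂ) ^ n * ((t ^ m)⁻¹ * q ^ (n + d)) ^ M * q ^ (Nat.choose n 2)
        = (-1 : ℂ) ^ n * ((t ^ m)⁻¹ * q ^ (n + d)) ^ M * (q ^ (Nat.choose n 2)
          * (q ^ Nat.choose (M + n + 1) 2 * q ^ (n * d)))
          * ((q ^ Nat.choose (M + n + 1) 2)⁻¹ * (q ^ (n * d))⁻¹) := by field_simp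
      _ = ((-1 : ℂ) ^ (M + n) * (-1) ^ M)
          * (((t ^ m)⁻¹ * q ^ (n + d)) ^ (M + n) * t ^ (m * n))
          * (q ^ Nat.choose (M + 1) 2 * q ^ (M * n))
          * ((q ^ Nat.choose (M + n + 1) 2)⁻¹ * (q ^ (n * d))⁻¹) := by rw [e3, e1, e2]; ring
      _ = _ := by ring
  rw [hscalar]
  simp only [prod_mul_distrib]
  ring

end

/-! ### Generic points -/

section
variable {ι κ : Type*}

/-- The point `(x;y)` is off the zeros of all theta functions that occur in the duality
transformation and in its translation to the kernel identity. -/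
structure IsGeneric (p q t : ℂ) (x : ι → ℂ) (y : κ → ℂ) : Prop where
  norm_lt : ‖p‖ < 1
  p_ne : p ≠ 0
  pow : ∀ c : ℤ, c ≠ 0 → theta p (q ^ c) ≠ 0
  left_ne : ∀ i, x i ≠ 0
  right_ne : ∀ l, y l ≠ 0
  left : ∀ i j, i ≠ j → ∀ c : ℤ, theta p (q ^ c * x i / x j) ≠ 0
  right : ∀ i j, i ≠ j → ∀ c : ℤ, theta p (q ^ c * y i / y j) ≠ 0
  cross : ∀ i l, ∀ c : ℤ, theta p (q ^ c * (x i * y l)) ≠ 0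
  cross_t : ∀ i l, ∀ c : ℤ, theta p (t⁻¹ * (q ^ c * (x i * y l))) ≠ 0

theorem IsGeneric.symm {p q t : ℂ} {x : ι → ℂ} {y : κ → ℂ} (h : IsGeneric p q t x y) :
    IsGeneric p q t y x where
  norm_lt := h.norm_lt
  p_ne := h.p_ne
  pow := h.pow
  left_ne := h.right_ne
  right_ne := h.left_ne
  left := h.right
  right := h.left
  cross := fun l i c => by rw [mul_comm (y l)]; exact h.cross i l c
  cross_t := fun l i c => by rw [mul_comm (y l)]; exact h.cross_t i l c

theorem countable_setOf_theta_exp_eq_zero {p : ℂ} (hp : ‖p‖ < 1) {D : ℂ} (hD : D ≠ 0) {a : ℝ}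
    (ha : a ≠ 0) : {τ : ℝ | theta p (D * Complex.exp (a * τ)) = 0}.Countable := by
  refine (Set.countable_range fun b : ℤ => Real.log (‖p ^ b‖ / ‖D‖) / a).mono ?_
  intro τ hτ
  obtain ⟨b, hb⟩ := exists_of_theta_eq_zero hp (mul_ne_zero hD (Complex.exp_ne_zero _)) hτ
  refine ⟨b, ?_⟩
  simp only
  have h1 : ‖Complex.exp (a * τ)‖ = Real.exp (a * τ) := by
    rw [← Complex.ofReal_mul, Complex.norm_exp_ofReal]
  rw [← hb, norm_mul, mul_div_cancel_left₀ _ (norm_ne_zero_iff.mpr hD), h1, Real.log_exp]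
  field_simp

/-- Arbitrarily close to `p` there is a nonzero `p'` in the unit disc such that no nonzero power
of `q` is a power of `p'`. -/
theorem exists_modulus_near {p q : ℂ} (hp : ‖p‖ < 1) (hq0 : q ≠ 0) (hq1 : ‖q‖ ≠ 1) {ε : ℝ}
    (hε : 0 < ε) : ∃ p' : ℂ, ‖p'‖ < 1 ∧ p' ≠ 0 ∧ dist p' p < ε ∧
      ∀ c : ℤ, c ≠ 0 → theta p' (q ^ c) ≠ 0 := by
  have hC : (Set.range fun a : ℤ × ℤ => Real.exp (a.1 / a.2 * Real.log ‖q‖)).Countable :=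
    Set.countable_range _
  obtain ⟨ρ, hρC, hρ1, hρ2⟩ := (hC.dense_compl ℝ).exists_between
    (show ‖p‖ < min (‖p‖ + ε) 1 from lt_min (by linarith) hp)
  have hρ0 : 0 < ρ := (norm_nonneg p).trans_lt hρ1
  obtain ⟨hρ3, hρ4⟩ := lt_min_iff.mp hρ2
  obtain ⟨u, hu1, hu2⟩ : ∃ u : ℂ, ‖u‖ = 1 ∧ p = ‖p‖ * u := by
    by_cases h : p = 0
    · exact ⟨1, by simp, by simp [h]⟩
    · refine ⟨p / ‖p‖, by simp [h], ?_⟩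
      have : (‖p‖ : ℂ) ≠ 0 := by simpa using h
      field_simp
  have hn : ‖(ρ : ℂ) * u‖ = ρ := by rw [norm_mul, hu1, mul_one, Complex.norm_real,
    Real.norm_of_nonneg hρ0.le]
  refine ⟨ρ * u, by rwa [hn], norm_pos_iff.mp (by rwa [hn]), ?_, ?_⟩
  · rw [dist_eq_norm]
    conv_lhs => rw [hu2]
    rw [← sub_mul, norm_mul, hu1, mul_one, ← Complex.ofReal_sub, Complex.norm_real,
      Real.norm_eq_abs,
      abs_of_pos (by linarith)]
    linarith
  · intro c hc
    refine theta_ne_zero_of_forall_zpow (by rwa [hn]) (zpow_ne_zero _ hq0) fun b hb => hρC ?_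
    have h1 := congrArg (fun x => Real.log ‖x‖) hb
    simp only [norm_zpow, Real.log_zpow, hn] at h1
    have hlq : Real.log ‖q‖ ≠ 0 := by
      have := norm_pos_iff.mpr hq0
      exact Real.log_ne_zero_of_pos_of_ne_one this hq1
    have hc' : (c : ℝ) ≠ 0 := Int.cast_ne_zero.mpr hc
    have hb0 : (b : ℝ) ≠ 0 := by
      intro hb0
      rw [hb0, zero_mul] at h1
      exact mul_ne_zero hc' hlq h1
    refine ⟨(c, b), ?_⟩
    simp only
    rw [div_mul_eq_mul_div, h1, mul_div_cancel_left₀ _ hb0, Real.exp_log hρ0]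

/-- Every point is a limit of generic ones. The variables are moved along `x_i e^{a_i τ}` with
distinct positive `a_i`, and only countably many `τ` fail. -/
theorem exists_generic_seq [Fintype ι] [Fintype κ] {p q t : ℂ} (hp : ‖p‖ < 1) (hq0 : q ≠ 0)
    (hq1 : ‖q‖ ≠ 1) (ht0 : t ≠ 0) (x : ι → ℂ) (y : κ → ℂ) (hx : ∀ i, x i ≠ 0) (hy : ∀ l, y l ≠ 0) :
    ∃ (P : ℕ → ℂ) (X : ℕ → ι → ℂ) (Y : ℕ → κ → ℂ), Tendsto P atTop (𝓝 p) ∧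
      (∀ i, Tendsto (fun n => X n i) atTop (𝓝 (x i))) ∧
      (∀ l, Tendsto (fun n => Y n l) atTop (𝓝 (y l))) ∧
      ∀ n, IsGeneric (P n) q t (X n) (Y n) := by
  classical
  have hN : ∀ n : ℕ, (0 : ℝ) < 1 / ((n : ℝ) + 1) := fun n => Nat.one_div_pos_of_nat
  choose P hP1 hP0 hPd hPq using fun n => exists_modulus_near hp hq0 hq1 (hN n)
  set a : ι → ℝ := fun i => (Fintype.equivFin ι i : ℕ) + 1 with ha
  set b : κ → ℝ := fun l => (Fintype.equivFin κ l : ℕ) + 1 with hb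
  have hane : ∀ i j, i ≠ j → a i - a j ≠ 0 := by
    intro i j hij h
    refine hij ((Fintype.equivFin ι).injective (Fin.ext ?_))
    have : ((Fintype.equivFin ι i : ℕ) : ℝ) = (Fintype.equivFin ι j : ℕ) := by
      simp only [ha] at h; linarith
    exact_mod_cast this
  have hbne : ∀ i j, i ≠ j → b i - b j ≠ 0 := by
    intro i j hij h
    refine hij ((Fintype.equivFin κ).injective (Fin.ext ?_))
    have : ((Fintype.equivFin κ i : ℕ) : ℝ) = (Fintype.equivFin κ j : ℕ) := by
      simp only [hb] at h; linarith
    exact_mod_cast this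
  have habne : ∀ i l, a i + b l ≠ 0 := fun i l => by
    simp only [ha, hb]; positivity
  have hqc : ∀ c : ℤ, q ^ c ≠ 0 := fun c => zpow_ne_zero c hq0
  have hτ : ∀ n : ℕ, ∃ τ : ℝ, 0 < τ ∧ τ < 1 / ((n : ℝ) + 1) ∧
      IsGeneric (P n) q t (fun i => x i * Complex.exp (a i * τ))
        (fun l => y l * Complex.exp (b l * τ)) := by
    intro n
    set B1 : Set ℝ := ⋃ i, ⋃ j, ⋃ (_ : i ≠ j), ⋃ c : ℤ,
      {τ : ℝ | theta (P n) (q ^ c * x i / x j * Complex.exp ((a i - a j : ℝ) * τ)) = 0}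
    set B2 : Set ℝ := ⋃ i, ⋃ j, ⋃ (_ : i ≠ j), ⋃ c : ℤ,
      {τ : ℝ | theta (P n) (q ^ c * y i / y j * Complex.exp ((b i - b j : ℝ) * τ)) = 0}
    set B3 : Set ℝ := ⋃ i, ⋃ l, ⋃ c : ℤ,
      {τ : ℝ | theta (P n) (q ^ c * (x i * y l) * Complex.exp ((a i + b l : ℝ) * τ)) = 0}
    set B4 : Set ℝ := ⋃ i, ⋃ l, ⋃ c : ℤ,
      {τ : ℝ | theta (P n) (t⁻¹ * (q ^ c * (x i * y l)) * Complex.exp ((a i + b l : ℝ) * τ)) = 0}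
    have hB : (B1 ∪ B2 ∪ B3 ∪ B4).Countable := by
      refine ((Set.Countable.union ?_ ?_).union ?_).union ?_
      · refine Set.countable_iUnion fun i => Set.countable_iUnion fun j =>
          Set.countable_iUnion fun hij => Set.countable_iUnion fun c => ?_
        exact countable_setOf_theta_exp_eq_zero (hP1 n)
          (div_ne_zero (mul_ne_zero (hqc c) (hx i)) (hx j)) (hane i j hij)
      · refine Set.countable_iUnion fun i => Set.countable_iUnion fun j =>
          Set.countable_iUnion fun hij => Set.countable_iUnion fun c => ?_
        exact countable_setOf_theta_exp_eq_zero (hP1 n)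
          (div_ne_zero (mul_ne_zero (hqc c) (hy i)) (hy j)) (hbne i j hij)
      · refine Set.countable_iUnion fun i => Set.countable_iUnion fun l =>
          Set.countable_iUnion fun c => ?_
        exact countable_setOf_theta_exp_eq_zero (hP1 n)
          (mul_ne_zero (hqc c) (mul_ne_zero (hx i) (hy l))) (habne i l)
      · refine Set.countable_iUnion fun i => Set.countable_iUnion fun l =>
          Set.countable_iUnion fun c => ?_
        exact countable_setOf_theta_exp_eq_zero (hP1 n)
          (mul_ne_zero (inv_ne_zero ht0) (mul_ne_zero (hqc c) (mul_ne_zero (hx i) (hy l))))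
          (habne i l)
    obtain ⟨τ, hτB, h0, h1⟩ := (hB.dense_compl ℝ).exists_between (hN n)
    simp only [Set.mem_compl_iff, Set.mem_union, not_or, B1, B2, B3, B4, Set.mem_iUnion, not_exists,
      Set.mem_ofPred_eq] at hτB
    obtain ⟨⟨⟨h2, h3⟩, h4⟩, h5⟩ := hτB
    have hsub : ∀ u v : ℝ, Complex.exp ((u - v : ℝ) * τ)
        = Complex.exp (u * τ) / Complex.exp (v * τ) := fun u v => by
      rw [← Complex.exp_sub]; push_cast; ring_nf
    have hadd : ∀ u v : ℝ, Complex.exp ((u + v : ℝ) * τ)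
        = Complex.exp (u * τ) * Complex.exp (v * τ) := fun u v => by
      rw [← Complex.exp_add]; push_cast; ring_nf
    refine ⟨τ, h0, h1, hP1 n, hP0 n, hPq n, fun i => mul_ne_zero (hx i) (Complex.exp_ne_zero _),
      fun i => mul_ne_zero (hy i) (Complex.exp_ne_zero _), ?_, ?_, ?_, ?_⟩
    · intro i j hij c
      have := h2 i j hij c
      rw [hsub] at this
      convert this using 2
      rw [div_mul_div_comm, mul_assoc]
    · intro i j hij c
      have := h3 i j hij c
      rw [hsub] at this
      convert this using 2
      rw [div_mul_div_comm, mul_assoc]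
    · intro i l c
      have := h4 i l c
      rw [hadd] at this
      convert this using 2
      ring
    · intro i l c
      have := h5 i l c
      rw [hadd] at this
      convert this using 2
      ring
  choose τ hτ0 hτ1 hgen using hτ
  have hτlim : Tendsto τ atTop (𝓝 0) :=
    squeeze_zero (fun n => (hτ0 n).le) (fun n => (hτ1 n).le) tendsto_one_div_add_atTop_nhds_zero_nat
  have hexp : ∀ (v : ℂ) (u : ℝ),
      Tendsto (fun n => v * Complex.exp (u * τ n)) atTop (𝓝 v) := by
    intro v u
    have : ContinuousAt (fun s : ℝ => v * Complex.exp (u * s)) 0 := by fun_prop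
    have h2 := this.tendsto.comp hτlim
    simpa [Function.comp_def] using h2
  refine ⟨P, _, _, ?_, fun i => hexp (x i) (a i), fun l => hexp (y l) (b l), hgen⟩
  rw [tendsto_iff_dist_tendsto_zero]
  exact squeeze_zero (fun n => dist_nonneg) (fun n => (hPd n).le)
    tendsto_one_div_add_atTop_nhds_zero_nat

end

/-! ### The kernel function along the shifts -/

section
variable {p q t : ℂ} {m r n s : ℕ}

/-- The common part of all values of the kernel function in the operator of order `k`: the ratios
of gamma functions at the farthest shifts `q^k` and `t^{-min(1,k)}`. -/
noncomputable def kernelBase (p q t : ℂ) (k : ℕ) (z : Fin m → ℂ) (w : Fin r → ℂ)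
    (Z : Fin n → ℂ) (W : Fin s → ℂ) : ℂ :=
  (∏ i, ∏ j, gammaSol p q (t⁻¹ * (q ^ k * (z i * Z j))) / gammaSol p q (q ^ k * (z i * Z j)))
    * (∏ i, ∏ j, gammaSol p t⁻¹ (q * (t⁻¹ ^ min 1 k * (w i * W j)))
        / gammaSol p t⁻¹ (t⁻¹ ^ min 1 k * (w i * W j)))

/-- The quotient of a value of the kernel function by `kernelBase`, which involves theta functions
only. -/
noncomputable def reducedKernel (p q t : ℂ) (k : ℕ) (z : Fin m → ℂ) (w : Fin r → ℂ)
    (Z : Fin n → ℂ) (W : Fin s → ℂ) (μ : Fin m → ℕ) (I : Finset (Fin r)) : ℂ :=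
  (∏ i, ∏ j, ∏ l ∈ Ico (μ i) k,
      theta p (q ^ l * (z i * Z j)) / theta p (t⁻¹ * (q ^ l * (z i * Z j))))
    * (∏ i, ∏ j, ∏ l ∈ Ico (indicatorVec I i) (min 1 k),
        theta p (t⁻¹ ^ l * (w i * W j)) / theta p (q * (t⁻¹ ^ l * (w i * W j))))
    * (∏ i, ∏ j, theta p (q ^ μ i * (z i * W j)))
    * (∏ i, ∏ j, theta p (t⁻¹ ^ indicatorVec I i * (w i * Z j)))

/-- The value of the operator at the kernel function, divided by `kernelBase`. -/
noncomputable def reducedSum (p q t : ℂ) (k : ℕ) (z : Fin m → ℂ) (w : Fin r → ℂ)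
    (Z : Fin n → ℂ) (W : Fin s → ℂ) : ℂ :=
  ∑ l ∈ antidiagonal k, ∑ μ ∈ piAntidiag (univ : Finset (Fin m)) l.1,
    ∑ I ∈ powersetCard l.2 (univ : Finset (Fin r)),
      coeff p q t μ I z w * reducedKernel p q t k z w Z W μ I

theorem kernelBase_symm (k : ℕ) (z : Fin m → ℂ) (w : Fin r → ℂ) (Z : Fin n → ℂ) (W : Fin s → ℂ) :
    kernelBase p q t k Z W z w = kernelBase p q t k z w Z W := by
  unfold kernelBase
  rw [Finset.prod_comm]
  congr 1
  · simp only [mul_comm (Z _) (z _)]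
  · rw [Finset.prod_comm]
    simp only [mul_comm (W _) (w _)]

theorem kernelPhi_symm (z : Fin m → ℂ) (w : Fin r → ℂ) (Z : Fin n → ℂ) (W : Fin s → ℂ) :
    kernelPhi p q t Z W z w = kernelPhi p q t z w Z W := by
  have e1 : ∀ a b c : ℂ, a * b * c = a * c * b := fun a b c => by ring
  have e2 : (∏ i, ∏ j, gammaSol p q (t⁻¹ * Z i * z j) / gammaSol p q (Z i * z j))
      = ∏ i, ∏ j, gammaSol p q (t⁻¹ * z i * Z j) / gammaSol p q (z i * Z j) := by
    rw [Finset.prod_comm]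
    simp only [e1 t⁻¹ (Z _) (z _), mul_comm (Z _) (z _)]
  have e3 : (∏ i, ∏ j, gammaSol p t⁻¹ (q * W i * w j) / gammaSol p t⁻¹ (W i * w j))
      = ∏ i, ∏ j, gammaSol p t⁻¹ (q * w i * W j) / gammaSol p t⁻¹ (w i * W j) := by
    rw [Finset.prod_comm]
    simp only [e1 q (W _) (w _), mul_comm (W _) (w _)]
  have e4 : (∏ i, ∏ j, theta p (Z i * w j)) = ∏ i, ∏ j, theta p (w i * Z j) := by
    rw [Finset.prod_comm]
    simp only [mul_comm (Z _) (w _)]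
  have e5 : (∏ i, ∏ j, theta p (W i * z j)) = ∏ i, ∏ j, theta p (z i * W j) := by
    rw [Finset.prod_comm]
    simp only [mul_comm (W _) (z _)]
  unfold kernelPhi
  rw [e2, e3, e4, e5, mul_right_comm]

theorem KernelRegular.symm {z : Fin m → ℂ} {w : Fin r → ℂ} {Z : Fin n → ℂ} {W : Fin s → ℂ}
    (h : KernelRegular p q t z w Z W) : KernelRegular p q t Z W z w := by
  refine ⟨fun i j => ?_, fun i j => ?_⟩
  · rw [mul_right_comm, mul_comm (Z i)]
    exact h.1 j i
  · rw [mul_right_comm, mul_comm (W i)]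
    exact h.2 j i

theorem shiftW_eq (I : Finset (Fin r)) (w : Fin r → ℂ) (i : Fin r) :
    shiftW t I w i = t⁻¹ ^ indicatorVec I i * w i := by
  unfold shiftW indicatorVec
  split_ifs <;> simp

theorem indicatorVec_le (I : Finset (Fin r)) {k : ℕ} (hI : #I ≤ k) (i : Fin r) :
    indicatorVec I i ≤ min 1 k := by
  unfold indicatorVec
  split_ifs with h
  · exact le_min le_rfl ((card_pos.mpr ⟨i, h⟩).trans_le hI)
  · exact Nat.zero_le _

/-- If the operator of order `k` has a term at all, it has one shifting `w_i` as far as possible. -/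
theorem exists_indicatorVec_eq_min {k : ℕ} (μ : Fin m → ℕ) (I : Finset (Fin r))
    (hk : ∑ i, μ i + #I = k) (i : Fin r) :
    ∃ (μ' : Fin m → ℕ) (I' : Finset (Fin r)),
      ∑ i, μ' i + #I' = k ∧ indicatorVec I' i = min 1 k := by
  rcases Nat.eq_zero_or_pos k with rfl | hpos
  · exact ⟨μ, I, hk, le_antisymm (indicatorVec_le I (by omega) i) (by simp)⟩
  have hmin : min 1 k = 1 := min_eq_left hpos
  rw [hmin]
  by_cases hi : i ∈ I
  · exact ⟨μ, I, hk, by simp [indicatorVec, hi]⟩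
  rcases I.eq_empty_or_nonempty with rfl | ⟨j, hj⟩
  · obtain ⟨a, -, ha⟩ : ∃ a ∈ univ, μ a ≠ 0 := by
      refine exists_ne_zero_of_sum_ne_zero ?_
      simp only [card_empty, add_zero] at hk
      omega
    refine ⟨Function.update μ a (μ a - 1), {i}, ?_, by simp [indicatorVec]⟩
    rw [sum_update_of_mem (mem_univ _), sdiff_singleton_eq_erase, card_singleton, ← hk,
      ← add_sum_erase univ μ (mem_univ a), card_empty]
    omega
  · refine ⟨μ, insert i (I.erase j), ?_, by simp [indicatorVec]⟩
    have h1 : i ∉ I.erase j := fun h => hi (mem_of_mem_erase h)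
    rw [card_insert_of_notMem h1, card_erase_add_one hj, hk]

/-- The shifts of the kernel function in one operator differ by theta functions only. -/
theorem kernelPhi_shift (hp : ‖p‖ < 1) (hq0 : q ≠ 0) (ht0 : t ≠ 0) (hq1 : ‖q‖ ≠ 1)
    (ht1 : ‖t‖ ≠ 1) {k : ℕ} {z : Fin m → ℂ} {w : Fin r → ℂ} {Z : Fin n → ℂ} {W : Fin s → ℂ}
    (hz : ∀ i, z i ≠ 0) (hw : ∀ i, w i ≠ 0) (hZ : ∀ i, Z i ≠ 0) (hW : ∀ i, W i ≠ 0)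
    (hreg : ∀ (μ : Fin m → ℕ) (I : Finset (Fin r)), (∑ i, μ i) + #I = k →
      KernelRegular p q t (shiftZ q μ z) (shiftW t I w) Z W)
    (μ : Fin m → ℕ) (I : Finset (Fin r)) (hk : ∑ i, μ i + #I = k) :
    kernelPhi p q t (shiftZ q μ z) (shiftW t I w) Z W
        = kernelBase p q t k z w Z W * reducedKernel p q t k z w Z W μ I ∧
      (∀ i j, ∀ l ∈ Ico (μ i) k, theta p (t⁻¹ * (q ^ l * (z i * Z j))) ≠ 0) ∧
      ∀ i j, ∀ l ∈ Ico (indicatorVec I i) (min 1 k),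
        theta p (q * (t⁻¹ ^ l * (w i * W j))) ≠ 0 := by
  have a1 : ∀ a b x y : ℂ, a * (b * x) * y = a * (b * (x * y)) := fun a b x y => by ring
  have a2 : ∀ b x y : ℂ, b * x * y = b * (x * y) := fun b x y => by ring
  have hregz : ∀ (μ : Fin m → ℕ) (I : Finset (Fin r)), (∑ i, μ i) + #I = k → ∀ i j,
      GammaSolRegular p q (t⁻¹ * (q ^ μ i * (z i * Z j))) ∧
      GammaSolRegular p q (q ^ μ i * (z i * Z j)) := by
    intro μ I h i j
    have := (hreg μ I h).1 i j
    simpa only [shiftZ, a1, a2] using this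
  have hregw : ∀ (μ : Fin m → ℕ) (I : Finset (Fin r)), (∑ i, μ i) + #I = k → ∀ i j,
      GammaSolRegular p t⁻¹ (q * (t⁻¹ ^ indicatorVec I i * (w i * W j))) ∧
      GammaSolRegular p t⁻¹ (t⁻¹ ^ indicatorVec I i * (w i * W j)) := by
    intro μ I h i j
    have := (hreg μ I h).2 i j
    simpa only [shiftW_eq, a1, a2] using this
  have hA : ∀ i j, _ := fun i j => gammaSol_div_eq (p := p) (s := q) (c := t⁻¹) (a := μ i) (b := k)
    hp hq0 hq1 (inv_ne_zero ht0) (mul_ne_zero (hz i) (hZ j))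
    ((single_le_sum (fun _ _ => Nat.zero_le _) (mem_univ i)).trans (by omega))
    (hregz μ I hk i j).1
    (by simpa using (hregz (Pi.single i k) ∅ (by simp) i j).1)
    (hregz μ I hk i j).2
    (by simpa using (hregz (Pi.single i k) ∅ (by simp) i j).2)
  have hB : ∀ (i : Fin r) (j : Fin s),
      gammaSol p t⁻¹ (q * (t⁻¹ ^ indicatorVec I i * (w i * W j)))
          / gammaSol p t⁻¹ (t⁻¹ ^ indicatorVec I i * (w i * W j))
        = gammaSol p t⁻¹ (q * (t⁻¹ ^ min 1 k * (w i * W j)))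
            / gammaSol p t⁻¹ (t⁻¹ ^ min 1 k * (w i * W j))
          * ∏ l ∈ Ico (indicatorVec I i) (min 1 k),
              theta p (t⁻¹ ^ l * (w i * W j)) / theta p (q * (t⁻¹ ^ l * (w i * W j))) ∧
      ∀ l ∈ Ico (indicatorVec I i) (min 1 k), theta p (q * (t⁻¹ ^ l * (w i * W j))) ≠ 0 := by
    intro i j
    obtain ⟨μ', I', hk', hi'⟩ := exists_indicatorVec_eq_min μ I hk i
    have h' := hregw μ' I' hk' i j
    rw [hi'] at h'
    exact gammaSol_div_eq (p := p) (s := t⁻¹) (c := q) (a := indicatorVec I i) (b := min 1 k)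
      hp (inv_ne_zero ht0) (by simpa using ht1) hq0 (mul_ne_zero (hw i) (hW j))
      (indicatorVec_le I (by omega) i) (hregw μ I hk i j).1 h'.1 (hregw μ I hk i j).2 h'.2
  refine ⟨?_, fun i j => (hA i j).2, fun i j => (hB i j).2⟩
  unfold kernelPhi kernelBase reducedKernel
  simp only [shiftZ, shiftW_eq, a1, a2]
  rw [prod_congr rfl fun i _ => prod_congr rfl fun j _ => (hA i j).1,
    prod_congr rfl fun i _ => prod_congr rfl fun j _ => (hB i j).1]
  simp only [prod_mul_distrib]
  ring

theorem opH_kernelPhi_eq (hp : ‖p‖ < 1) (hq0 : q ≠ 0) (ht0 : t ≠ 0) (hq1 : ‖q‖ ≠ 1)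
    (ht1 : ‖t‖ ≠ 1) {k : ℕ} {z : Fin m → ℂ} {w : Fin r → ℂ} {Z : Fin n → ℂ} {W : Fin s → ℂ}
    (hz : ∀ i, z i ≠ 0) (hw : ∀ i, w i ≠ 0) (hZ : ∀ i, Z i ≠ 0) (hW : ∀ i, W i ≠ 0)
    (hreg : ∀ (μ : Fin m → ℕ) (I : Finset (Fin r)), (∑ i, μ i) + #I = k →
      KernelRegular p q t (shiftZ q μ z) (shiftW t I w) Z W) :
    opH p q t k (fun z' w' => kernelPhi p q t z' w' Z W) z w
      = kernelBase p q t k z w Z W * reducedSum p q t k z w Z W := by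
  unfold opH reducedSum
  simp only [mul_sum]
  refine sum_congr rfl fun l hl => sum_congr rfl fun μ hμ => sum_congr rfl fun I hI => ?_
  have hk : ∑ i, μ i + #I = k := by
    rw [(mem_piAntidiag.mp hμ).1, (mem_powersetCard.mp hI).2, mem_antidiagonal.mp hl]
  rw [(kernelPhi_shift hp hq0 ht0 hq1 ht1 hz hw hZ hW hreg μ I hk).1]
  ring

theorem tendsto_theta (hp : ‖p‖ < 1) {P u : ℕ → ℂ} {v : ℂ} (hv : v ≠ 0)
    (hP : Tendsto P atTop (𝓝 p)) (hu : Tendsto u atTop (𝓝 v)) :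
    Tendsto (fun a => theta (P a) (u a)) atTop (𝓝 (theta p v)) := by
  have h1 : Tendsto (fun a : ℂ × ℂ => theta a.1 a.2) (𝓝 (p, v)) (𝓝 (theta p v)) :=
    continuousAt_theta hp hv
  exact Tendsto.comp (f := fun a => (P a, u a)) h1 (hP.prodMk_nhds hu)

theorem tendsto_coeff (hp : ‖p‖ < 1) (hq0 : q ≠ 0) (ht0 : t ≠ 0)
    (hq : ∀ a : ℕ, 0 < a → ∀ b : ℤ, q ^ a ≠ p ^ b) {k : ℕ} {z : Fin m → ℂ} {w : Fin r → ℂ}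
    (h : CoeffRegular p q k z w) {P : ℕ → ℂ} {z' : ℕ → Fin m → ℂ} {w' : ℕ → Fin r → ℂ}
    (hP : Tendsto P atTop (𝓝 p)) (hz' : ∀ i, Tendsto (fun a => z' a i) atTop (𝓝 (z i)))
    (hw' : ∀ i, Tendsto (fun a => w' a i) atTop (𝓝 (w i)))
    (μ : Fin m → ℕ) (I : Finset (Fin r)) (hk : ∑ i, μ i + #I = k) :
    Tendsto (fun a => coeff (P a) q t μ I (z' a) (w' a)) atTop (𝓝 (coeff p q t μ I z w)) := by
  obtain ⟨hz, hw, hzz, hww, hzw⟩ := h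
  have hμk : ∀ i, μ i + #I ≤ k := fun i => by
    have := single_le_sum (f := μ) (fun _ _ => Nat.zero_le _) (mem_univ i)
    omega
  unfold coeff
  refine ((((Tendsto.mul tendsto_const_nhds ?_).mul ?_).mul ?_).mul ?_)
  · refine tendsto_finsetProd _ fun i hi => tendsto_finsetProd _ fun j hj => ?_
    have hij : i ≠ j := fun e => (mem_compl.mp hj) (e ▸ hi)
    exact (tendsto_theta hp (by simp [hq0, hw]) hP ((tendsto_const_nhds.mul (hw' j)).div (hw' i)
      (hw i))).div (tendsto_theta hp (by simp [hw]) hP ((hw' j).div (hw' i) (hw i)))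
      (hww i j hij)
  · refine tendsto_finsetProd _ fun i _ => tendsto_finsetProd _ fun j _ => ?_
    refine Tendsto.div ?_ ?_ ?_
    · refine tendsto_finsetProd _ fun l _ => tendsto_theta hp (by simp [hq0, ht0, hz]) hP ?_
      exact ((tendsto_const_nhds.mul (hz' i)).div (hz' j) (hz j)).mul_const _
    · refine tendsto_finsetProd _ fun l _ => tendsto_theta hp (by simp [hq0, hz]) hP ?_
      exact ((tendsto_const_nhds.mul (hz' i)).div (hz' j) (hz j)).mul_const _
    · refine prod_ne_zero_iff.mpr fun l hl => ?_
      have e : q * z i / z j * q ^ l = q ^ (l + 1) * z i / z j := by ring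
      rw [e]
      by_cases hij : i = j
      · subst hij
        rw [mul_div_cancel_right₀ _ (hz i)]
        exact theta_ne_zero_of_forall_zpow hp (pow_ne_zero _ hq0) (hq _ (Nat.succ_pos l))
      · refine hzz i j hij (l + 1) ?_
        have := mem_range.mp hl
        have := hμk i
        omega
  · refine tendsto_finsetProd _ fun i _ => tendsto_finsetProd _ fun j hj => ?_
    refine Tendsto.div (Tendsto.mul tendsto_const_nhds (tendsto_theta hp
      (by simp [hq0, hz, zpow_ne_zero]) hP
      ((tendsto_const_nhds.mul (hz' i)).div (hz' j) (hz j))))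
      (tendsto_theta hp (by simp [hz]) hP ((hz' i).div (hz' j) (hz j))) ?_
    simpa using hzz i j (mem_Ioi.mp hj).ne 0 (Nat.zero_le _)
  · refine tendsto_finsetProd _ fun i _ => Tendsto.mul ?_ ?_
    · refine tendsto_finsetProd _ fun j hj => ?_
      refine Tendsto.div (tendsto_theta hp (by simp [ht0, hz, hw]) hP
        ((hz' i).div (tendsto_const_nhds.mul (hw' j)) (mul_ne_zero ht0 (hw j))))
        (tendsto_theta hp (by simp [hq0, hz, hw]) hP
          ((tendsto_const_nhds.mul (hz' i)).div (hw' j) (hw j))) ?_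
      have := hμk i
      have := card_pos.mpr ⟨j, hj⟩
      simpa using hzw i j (μ i) (by omega) (by omega)
    · refine tendsto_finsetProd _ fun j hj => ?_
      refine Tendsto.div (tendsto_theta hp (by simp [hq0, hz, hw]) hP
        ((hz' i).div (tendsto_const_nhds.mul (hw' j)) (mul_ne_zero hq0 (hw j))))
        (tendsto_theta hp (by simp [hq0, hz, hw, zpow_ne_zero]) hP
          ((tendsto_const_nhds.mul (hz' i)).div (hw' j) (hw j))) ?_
      have := hμk i
      exact hzw i j (μ i - 1) (by omega) (by omega)

theorem tendsto_reducedSum (hp : ‖p‖ < 1) (hq0 : q ≠ 0) (ht0 : t ≠ 0) (hq1 : ‖q‖ ≠ 1)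
    (ht1 : ‖t‖ ≠ 1) (hq : ∀ a : ℕ, 0 < a → ∀ b : ℤ, q ^ a ≠ p ^ b) {k : ℕ}
    {z : Fin m → ℂ} {w : Fin r → ℂ} {Z : Fin n → ℂ} {W : Fin s → ℂ}
    (h : CoeffRegular p q k z w) (hZ : ∀ i, Z i ≠ 0) (hW : ∀ i, W i ≠ 0)
    (hreg : ∀ (μ : Fin m → ℕ) (I : Finset (Fin r)), (∑ i, μ i) + #I = k →
      KernelRegular p q t (shiftZ q μ z) (shiftW t I w) Z W)
    {P : ℕ → ℂ} {z' : ℕ → Fin m → ℂ} {w' : ℕ → Fin r → ℂ} {Z' : ℕ → Fin n → ℂ}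
    {W' : ℕ → Fin s → ℂ} (hP : Tendsto P atTop (𝓝 p))
    (hz' : ∀ i, Tendsto (fun a => z' a i) atTop (𝓝 (z i)))
    (hw' : ∀ i, Tendsto (fun a => w' a i) atTop (𝓝 (w i)))
    (hZ' : ∀ i, Tendsto (fun a => Z' a i) atTop (𝓝 (Z i)))
    (hW' : ∀ i, Tendsto (fun a => W' a i) atTop (𝓝 (W i))) :
    Tendsto (fun a => reducedSum (P a) q t k (z' a) (w' a) (Z' a) (W' a)) atTop
      (𝓝 (reducedSum p q t k z w Z W)) := by
  have hz := h.1
  have hw := h.2.1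
  refine tendsto_finsetSum _ fun l hl => tendsto_finsetSum _ fun μ hμ =>
    tendsto_finsetSum _ fun I hI => ?_
  have hk : ∑ i, μ i + #I = k := by
    rw [(mem_piAntidiag.mp hμ).1, (mem_powersetCard.mp hI).2, mem_antidiagonal.mp hl]
  obtain ⟨-, h1, h2⟩ := kernelPhi_shift hp hq0 ht0 hq1 ht1 hz hw hZ hW hreg μ I hk
  refine (tendsto_coeff hp hq0 ht0 hq h hP hz' hw' μ I hk).mul ?_
  unfold reducedKernel
  refine ((Tendsto.mul ?_ ?_).mul ?_).mul ?_
  · refine tendsto_finsetProd _ fun i _ => tendsto_finsetProd _ fun j _ =>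
      tendsto_finsetProd _ fun l hl => ?_
    exact (tendsto_theta hp (by simp [hq0, hz, hZ]) hP (((hz' i).mul (hZ' j)).const_mul _)).div
      (tendsto_theta hp (by simp [hq0, ht0, hz, hZ]) hP
        ((((hz' i).mul (hZ' j)).const_mul _).const_mul _)) (h1 i j l hl)
  · refine tendsto_finsetProd _ fun i _ => tendsto_finsetProd _ fun j _ =>
      tendsto_finsetProd _ fun l hl => ?_
    exact (tendsto_theta hp (by simp [ht0, hw, hW]) hP (((hw' i).mul (hW' j)).const_mul _)).div
      (tendsto_theta hp (by simp [hq0, ht0, hw, hW]) hP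
        ((((hw' i).mul (hW' j)).const_mul _).const_mul _)) (h2 i j l hl)
  · exact tendsto_finsetProd _ fun i _ => tendsto_finsetProd _ fun j _ =>
      tendsto_theta hp (by simp [hq0, hz, hW]) hP (((hz' i).mul (hW' j)).const_mul _)
  · exact tendsto_finsetProd _ fun i _ => tendsto_finsetProd _ fun j _ =>
      tendsto_theta hp (by simp [ht0, hw, hZ]) hP (((hw' i).mul (hZ' j)).const_mul _)

end

/-! ### The kernel identity as a duality transformation -/

section
variable {p q t : ℂ} {m r n s : ℕ}

theorem prod_Ico_eq_mul_prod_range {b a : ℕ} (hab : a ≤ b) {f g : ℕ → ℂ}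
    (hf : ∀ l, f l ≠ 0) (hg : ∀ l, g l ≠ 0) :
    ∏ l ∈ Ico a b, f l / g l = (∏ l ∈ Ico 0 b, f l / g l) * ∏ l ∈ range a, g l / f l := by
  rw [← prod_Ico_consecutive _ (Nat.zero_le a) hab, ← range_eq_Ico, mul_right_comm,
    ← prod_mul_distrib, prod_eq_one (s := range a), one_mul]
  intro l _
  have := hf l
  have := hg l
  field_simp

theorem prod_range_indicatorVec (I : Finset (Fin r)) (f : Fin r → ℕ → ℂ) :
    ∏ i, ∏ a ∈ range (indicatorVec I i), f i a = ∏ i ∈ I, f i 0 := by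
  rw [← prod_filter_mul_prod_filter_not univ (· ∈ I), filter_mem_eq_inter, univ_inter,
    prod_congr rfl (g := fun i => f i 0), prod_eq_one (s := filter _ _), mul_one]
  · intro i hi
    simp [indicatorVec, (mem_filter.mp hi).2]
  · intro i hi
    simp [indicatorVec, hi]

/-- The dependence of `reducedKernel` on the shift is the factor of `kajiharaTerm` that couples the
two sets of variables. -/
theorem reducedKernel_eq {x : Fin m ⊕ Fin r → ℂ} {y : Fin n ⊕ Fin s → ℂ}
    (h : IsGeneric p q t x y) {k : ℕ} (μ : Fin m → ℕ)
    (I : Finset (Fin r)) (hk : ∑ i, μ i + #I = k) :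
    reducedKernel p q t k (fun i => x (.inl i)) (fun i => x (.inr i)) (fun l => y (.inl l))
        (fun l => y (.inr l)) μ I
      = reducedKernel p q t k (fun i => x (.inl i)) (fun i => x (.inr i)) (fun l => y (.inl l))
          (fun l => y (.inr l)) 0 ∅
        * ((∏ i, ∏ a ∈ range (μ i),
            (∏ l, theta p (q ^ a * (x (.inl i) * y (.inl l)) / t)
                / theta p (q ^ a * (x (.inl i) * y (.inl l))))
            * ∏ l, theta p (q ^ a * (x (.inl i) * y (.inr l)) / q⁻¹)
                / theta p (q ^ a * (x (.inl i) * y (.inr l))))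
          * ∏ i, ∏ a ∈ range (indicatorVec I i),
            (∏ l, theta p (q ^ a * (x (.inr i) * y (.inl l)) / t)
                / theta p (q ^ a * (x (.inr i) * y (.inl l))))
            * ∏ l, theta p (q ^ a * (x (.inr i) * y (.inr l)) / q⁻¹)
                / theta p (q ^ a * (x (.inr i) * y (.inr l)))) := by
  have hμ : ∀ i, μ i ≤ k := fun i =>
    (single_le_sum (fun _ _ => Nat.zero_le _) (mem_univ i)).trans (by omega)
  have hI : ∀ i, indicatorVec I i ≤ min 1 k := indicatorVec_le I (by omega)
  have h0 : ∀ i, indicatorVec (∅ : Finset (Fin r)) i = 0 := fun i => by simp [indicatorVec]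
  have hc : ∀ i l (a : ℕ), theta p (q ^ a * (x i * y l)) ≠ 0 := fun i l a => by
    simpa using h.cross i l a
  have hct : ∀ i l (a : ℕ), theta p (t⁻¹ * (q ^ a * (x i * y l))) ≠ 0 := fun i l a => by
    simpa using h.cross_t i l a
  have e1 : ∀ i j, ∏ l ∈ Ico (μ i) k, theta p (q ^ l * (x (.inl i) * y (.inl j)))
        / theta p (t⁻¹ * (q ^ l * (x (.inl i) * y (.inl j))))
      = (∏ l ∈ Ico 0 k, theta p (q ^ l * (x (.inl i) * y (.inl j)))
        / theta p (t⁻¹ * (q ^ l * (x (.inl i) * y (.inl j)))))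
        * ∏ a ∈ range (μ i), theta p (q ^ a * (x (.inl i) * y (.inl j)) / t)
                / theta p (q ^ a * (x (.inl i) * y (.inl j))) := by
    intro i j
    rw [prod_Ico_eq_mul_prod_range (hμ i) (hc _ _) (hct _ _)]
    simp only [div_eq_inv_mul _ t]
  have e2 : ∀ i j, ∏ l ∈ Ico (indicatorVec I i) (min 1 k),
        theta p (t⁻¹ ^ l * (x (.inr i) * y (.inr j)))
          / theta p (q * (t⁻¹ ^ l * (x (.inr i) * y (.inr j))))
      = (∏ l ∈ Ico 0 (min 1 k), theta p (t⁻¹ ^ l * (x (.inr i) * y (.inr j)))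
          / theta p (q * (t⁻¹ ^ l * (x (.inr i) * y (.inr j)))))
        * ∏ a ∈ range (indicatorVec I i), theta p (q ^ a * (x (.inr i) * y (.inr j)) / q⁻¹)
                / theta p (q ^ a * (x (.inr i) * y (.inr j))) := by
    intro i j
    have hlt : ∀ l ∈ Ico (indicatorVec I i) (min 1 k), l = 0 := fun l hl => by
      have := mem_Ico.mp hl
      omega
    have hlt0 : ∀ l ∈ Ico 0 (min 1 k), l = 0 := fun l hl => by
      have := mem_Ico.mp hl
      omega
    have hltI : ∀ l ∈ range (indicatorVec I i), l = 0 := fun l hl => by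
      have := mem_range.mp hl
      have := hI i
      omega
    have h1 : theta p (x (.inr i) * y (.inr j)) ≠ 0 := by simpa using hc (.inr i) (.inr j) 0
    have h2 : theta p (q * (x (.inr i) * y (.inr j))) ≠ 0 := by
      simpa using hc (.inr i) (.inr j) 1
    rw [prod_congr rfl (g := fun _ => theta p (x (.inr i) * y (.inr j))
        / theta p (q * (x (.inr i) * y (.inr j))))
        fun l hl => by rw [hlt l hl, pow_zero, one_mul],
      prod_Ico_eq_mul_prod_range (hI i) (fun _ => h1) (fun _ => h2)]
    congr 1
    · exact prod_congr rfl fun l hl => by rw [hlt0 l hl, pow_zero, one_mul]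
    · exact prod_congr rfl fun l hl => by
        rw [hltI l hl, pow_zero, one_mul, div_inv_eq_mul, mul_comm q]
  have e3 : ∀ i j, theta p (q ^ μ i * (x (.inl i) * y (.inr j)))
      = theta p (q ^ 0 * (x (.inl i) * y (.inr j)))
        * ∏ a ∈ range (μ i), theta p (q ^ a * (x (.inl i) * y (.inr j)) / q⁻¹)
                / theta p (q ^ a * (x (.inl i) * y (.inr j))) := by
    intro i j
    have := prod_Ico_telescope (fun a => theta p (q ^ a * (x (.inl i) * y (.inr j))))
      (Nat.zero_le (μ i)) (fun b _ => hc _ _ b)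
    rw [← range_eq_Ico] at this
    have e : ∀ a : ℕ, q ^ a * (x (.inl i) * y (.inr j)) / q⁻¹
        = q ^ (a + 1) * (x (.inl i) * y (.inr j)) := fun a => by
      rw [div_inv_eq_mul]
      ring
    simp only [e]
    rw [this, mul_div_cancel₀ _ (hc _ _ 0)]
  have e4 : ∀ i j, theta p (t⁻¹ ^ indicatorVec I i * (x (.inr i) * y (.inl j)))
      = theta p (t⁻¹ ^ 0 * (x (.inr i) * y (.inl j)))
        * ∏ a ∈ range (indicatorVec I i), theta p (q ^ a * (x (.inr i) * y (.inl j)) / t)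
                / theta p (q ^ a * (x (.inr i) * y (.inl j))) := by
    intro i j
    have h1 : theta p (x (.inr i) * y (.inl j)) ≠ 0 := by simpa using hc (.inr i) (.inl j) 0
    unfold indicatorVec
    split_ifs
    · rw [range_one, prod_singleton, pow_zero, pow_zero, pow_one, one_mul,
        mul_div_cancel₀ _ h1, div_eq_inv_mul]
    · simp
  unfold reducedKernel
  simp only [e1, e2, e3, e4, h0, Pi.zero_apply, prod_mul_distrib]
  simp only [Finset.prod_comm (s := range _) (t := univ)]
  ring

/-- At generic points the reduced sum is the left side of the duality transformation with
parameters `t` for the variables `z`, `Z` and `q⁻¹` for the variables `w`, `W`. A shift of some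
`w_i` by more than one step does not contribute, as `θ(q⁻¹ · q) = 0`. -/
theorem reducedSum_eq_kajiharaSum (hp : ‖p‖ < 1) (hq0 : q ≠ 0) (ht0 : t ≠ 0)
    {x : Fin m ⊕ Fin r → ℂ} {y : Fin n ⊕ Fin s → ℂ} (h : IsGeneric p q t x y) (k : ℕ) :
    reducedSum p q t k (fun i => x (.inl i)) (fun i => x (.inr i)) (fun l => y (.inl l))
        (fun l => y (.inr l))
      = (-1) ^ k * (q ^ Nat.choose (k + 1) 2)⁻¹ * ((t ^ m)⁻¹ * q ^ r) ^ k
        * reducedKernel p q t k (fun i => x (.inl i)) (fun i => x (.inr i)) (fun l => y (.inl l))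
          (fun l => y (.inr l)) 0 ∅
        * kajiharaSum p q (Sum.elim (fun _ => t) fun _ => q⁻¹) x
            (Sum.elim (fun _ => t) fun _ => q⁻¹) y k := by
  have hxx : ∀ i j, i ≠ j → ∀ c : ℤ, theta p (q ^ c * x i / x j) ≠ 0 := h.left
  unfold reducedSum kajiharaSum
  rw [sum_sigma', sum_sigma', mul_sum]
  refine sum_of_injOn (fun v => Sum.elim v.1.2 (indicatorVec v.2)) ?_ ?_ ?_ ?_
  · rintro ⟨⟨l, μ⟩, I⟩ hv ⟨⟨l', μ'⟩, I'⟩ hv' hvv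
    simp only [coe_sigma, Set.mem_sigma_iff, mem_coe, HasAntidiagonal.mem_antidiagonal,
      mem_piAntidiag, mem_powersetCard] at hv hv'
    have h1 : μ = μ' := funext fun i => congrFun hvv (.inl i)
    have h2 : I = I' := by
      ext j
      have := congrFun hvv (.inr j)
      simp only [Sum.elim_inr, indicatorVec] at this
      split_ifs at this <;> simp_all
    subst h1 h2
    have h3 : l = l' := Prod.ext (hv.1.2.1.symm.trans hv'.1.2.1) (hv.2.2.symm.trans hv'.2.2)
    subst h3
    rfl
  · rintro ⟨⟨l, μ⟩, I⟩ hv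
    simp only [coe_sigma, Set.mem_sigma_iff, mem_coe, HasAntidiagonal.mem_antidiagonal,
      mem_piAntidiag, mem_powersetCard] at hv ⊢
    refine ⟨?_, by simp⟩
    rw [Fintype.sum_sum_type]
    simp only [Sum.elim_inl, Sum.elim_inr, indicatorVec, sum_boole, filter_mem_eq_inter,
      univ_inter, Nat.cast_id]
    rw [hv.1.2.1, hv.2.2, hv.1.1]
  · intro M hM hM'
    obtain ⟨i, hi⟩ : ∃ i, 1 < M (.inr i) := by
      by_contra! hcon
      refine hM' ⟨⟨⟨(∑ i, M (.inl i), ∑ i, M (.inr i)), fun i => M (.inl i)⟩,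
        univ.filter fun i => M (.inr i) = 1⟩, ?_, ?_⟩
      · have h1 := (mem_piAntidiag.mp hM).1
        rw [Fintype.sum_sum_type] at h1
        simp only [coe_sigma, Set.mem_sigma_iff, mem_coe, HasAntidiagonal.mem_antidiagonal,
          mem_piAntidiag, mem_powersetCard]
        refine ⟨⟨h1, by simp, by simp⟩, subset_univ _, ?_⟩
        rw [card_filter]
        refine sum_congr rfl fun i _ => ?_
        have := hcon i
        split_ifs <;> omega
      · funext i
        rcases i with i | i
        · rfl
        · have := hcon i
          simp only [Sum.elim_inr, indicatorVec, mem_filter, mem_univ, true_and]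
          split_ifs <;> omega
    refine mul_eq_zero_of_right _ ?_
    refine prod_eq_zero (mem_univ (.inr i)) (prod_eq_zero (mem_range.mpr hi) ?_)
    refine mul_eq_zero_of_left (prod_eq_zero (mem_univ (.inr i)) ?_) _
    rw [Sum.elim_inr, pow_one, inv_mul_cancel₀ hq0, one_mul, div_self (h.left_ne _), theta_one,
      zero_div]
  · rintro ⟨⟨l, μ⟩, I⟩ hv
    simp only [mem_sigma, HasAntidiagonal.mem_antidiagonal, mem_piAntidiag, mem_powersetCard] at hv
    have hk : ∑ i, μ i + #I = k := by rw [hv.1.2.1, hv.2.2, hv.1.1]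
    simp only
    rw [coeff_eq hp hq0 ht0 h.pow (fun i => h.left_ne _) (fun i => h.left_ne _)
      (fun i j hij c => hxx _ _ (by simpa using hij) c) (fun i j c => hxx _ _ (by simp) c)
      (fun i j hij c => hxx _ _ (by simpa using hij) c) μ I hk,
      reducedKernel_eq h μ I hk]
    unfold kajiharaTerm
    simp only [Fintype.prod_sum_type, Sum.elim_inl, Sum.elim_inr, prod_mul_distrib,
      prod_range_indicatorVec, pow_zero, mul_one, one_mul, Nat.cast_zero, zero_sub]
    ring

/-- The kernel identity for the reduced sums at generic points. The condition `t^{m-n} = q^{r-s}` is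
the balancing condition of the duality transformation. -/
theorem reducedSum_comm_of_isGeneric (hq0 : q ≠ 0) (ht0 : t ≠ 0)
    (hbal : t ^ m * (q ^ r)⁻¹ = t ^ n * (q ^ s)⁻¹)
    {x : Option (Fin m ⊕ Fin r) → ℂ} {y : Option (Fin n ⊕ Fin s) → ℂ}
    (h : IsGeneric p q t x y) (k : ℕ) :
    reducedSum p q t k (fun i => x (some (.inl i))) (fun i => x (some (.inr i)))
        (fun l => y (some (.inl l))) (fun l => y (some (.inr l)))
      = reducedSum p q t k (fun l => y (some (.inl l))) (fun l => y (some (.inr l)))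
        (fun i => x (some (.inl i))) (fun i => x (some (.inr i))) := by
  have h' : IsGeneric p q t (fun i => x (some i)) fun l => y (some l) :=
    { norm_lt := h.norm_lt
      p_ne := h.p_ne
      pow := h.pow
      left_ne := fun i => h.left_ne _
      right_ne := fun l => h.right_ne _
      left := fun i j hij => h.left _ _ (by simpa using hij)
      right := fun i j hij => h.right _ _ (by simpa using hij)
      cross := fun i l => h.cross _ _
      cross_t := fun i l => h.cross_t _ _ }
  have hsymm : reducedKernel p q t k (fun l => y (some (.inl l))) (fun l => y (some (.inr l)))
        (fun i => x (some (.inl i))) (fun i => x (some (.inr i))) 0 ∅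
      = reducedKernel p q t k (fun i => x (some (.inl i))) (fun i => x (some (.inr i)))
        (fun l => y (some (.inl l))) (fun l => y (some (.inr l))) 0 ∅ := by
    unfold reducedKernel
    simp only [indicatorVec, notMem_empty, if_false, Pi.zero_apply, pow_zero, one_mul]
    rw [mul_right_comm]
    congr 1
    · congr 1
      · congr 1
        · rw [Finset.prod_comm]
          simp only [mul_comm (y _) (x _)]
        · rw [Finset.prod_comm]
          simp only [mul_comm (y _) (x _)]
      · rw [Finset.prod_comm]
        simp only [mul_comm (y _) (x _)]
    · rw [Finset.prod_comm]
      simp only [mul_comm (y _) (x _)]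
  have hpar : (t ^ m)⁻¹ * q ^ r = (t ^ n)⁻¹ * q ^ s := by
    have := congrArg (·⁻¹) hbal
    simpa only [mul_inv, inv_inv] using this
  have hα : ∀ {a b : ℕ} (i : Fin a ⊕ Fin b),
      (Sum.elim (fun _ => t) fun _ => q⁻¹ : Fin a ⊕ Fin b → ℂ) i ≠ 0 := by
    rintro a b (i | i) <;> simp [ht0, hq0]
  rw [reducedSum_eq_kajiharaSum h.norm_lt hq0 ht0 h',
    reducedSum_eq_kajiharaSum h.norm_lt hq0 ht0 h'.symm, hsymm, hpar,
    kajiharaSum_comm h.norm_lt h.p_ne hq0 h.pow h.left_ne h.right_ne h.left h.right h.cross k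
      hα hα]
  simpa [Fintype.prod_sum_type] using hbal

end

end DeformedRuijsenaars

/-- The kernel function identity, as an identity of meromorphic functions: it is stated at every
point `(z;w;Z;W)` where the coefficients and the values of the kernel function that occur are
all defined. -/
theorem theoremB2 (m r n s k : ℕ) (p q t : ℂ)
    (hp : ‖p‖ < 1) (hq0 : q ≠ 0) (ht0 : t ≠ 0) (hq1 : ‖q‖ ≠ 1) (ht1 : ‖t‖ ≠ 1)
    (hq : ∀ a : ℕ, 0 < a → ∀ b : ℤ, q ^ a ≠ p ^ b)
    (ht : ∀ a : ℕ, 0 < a → ∀ b : ℤ, t ^ a ≠ p ^ b)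
    (hbal : t ^ ((m : ℤ) - (n : ℤ)) = q ^ ((r : ℤ) - (s : ℤ)))
    (z : Fin m → ℂ) (w : Fin r → ℂ) (Z : Fin n → ℂ) (W : Fin s → ℂ)
    (hzw : DeformedRuijsenaars.CoeffRegular p q k z w)
    (hZW : DeformedRuijsenaars.CoeffRegular p q k Z W)
    (hleft : ∀ (μ : Fin m → ℕ) (I : Finset (Fin r)), (∑ i, μ i) + I.card = k →
      DeformedRuijsenaars.KernelRegular p q t
        (DeformedRuijsenaars.shiftZ q μ z) (DeformedRuijsenaars.shiftW t I w) Z W)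
    (hright : ∀ (ν : Fin n → ℕ) (J : Finset (Fin s)), (∑ i, ν i) + J.card = k →
      DeformedRuijsenaars.KernelRegular p q t z w
        (DeformedRuijsenaars.shiftZ q ν Z) (DeformedRuijsenaars.shiftW t J W)) :
    DeformedRuijsenaars.opH p q t k
        (fun z' w' => DeformedRuijsenaars.kernelPhi p q t z' w' Z W) z w
      = DeformedRuijsenaars.opH p q t k
        (fun Z' W' => DeformedRuijsenaars.kernelPhi p q t z w Z' W') Z W := by
  have hright' := fun ν J h => (hright ν J h).symm
  have hz := hzw.1
  have hw := hzw.2.1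
  have hZ := hZW.1
  have hW := hZW.2.1
  simp only [← DeformedRuijsenaars.kernelPhi_symm z w _ _]
  rw [DeformedRuijsenaars.opH_kernelPhi_eq hp hq0 ht0 hq1 ht1 hZ hW hz hw hright',
    DeformedRuijsenaars.kernelBase_symm]
  rw [DeformedRuijsenaars.opH_kernelPhi_eq hp hq0 ht0 hq1 ht1 hz hw hZ hW hleft]
  congr 1
  have hbal' : t ^ m * (q ^ r)⁻¹ = t ^ n * (q ^ s)⁻¹ := by
    rw [zpow_sub₀ ht0, zpow_sub₀ hq0] at hbal
    simp only [zpow_natCast] at hbal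
    field_simp at hbal ⊢
    rw [hbal]
  -- an auxiliary variable is added on each side to apply the duality transformation also when
  -- there are no others
  obtain ⟨P, X, Y, hP, hX, hY, hgen⟩ := DeformedRuijsenaars.exists_generic_seq hp hq0 hq1 ht0
    (fun i : Option (Fin m ⊕ Fin r) => i.elim 1 (Sum.elim z w))
    (fun l : Option (Fin n ⊕ Fin s) => l.elim 1 (Sum.elim Z W))
    (by rintro (_ | i | i) <;> simp [hz, hw]) (by rintro (_ | i | i) <;> simp [hZ, hW])
  refine tendsto_nhds_unique (DeformedRuijsenaars.tendsto_reducedSum hp hq0 ht0 hq1 ht1 hq hzw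
    hZ hW hleft hP (fun i => hX (some (.inl i))) (fun i => hX (some (.inr i)))
    (fun l => hY (some (.inl l))) (fun l => hY (some (.inr l)))) ?_
  refine (DeformedRuijsenaars.tendsto_reducedSum hp hq0 ht0 hq1 ht1 hq hZW hz hw hright' hP
    (fun l => hY (some (.inl l))) (fun l => hY (some (.inr l)))
    (fun i => hX (some (.inl i))) (fun i => hX (some (.inr i)))).congr fun a => ?_
  exact (DeformedRuijsenaars.reducedSum_comm_of_isGeneric hq0 ht0 hbal' (hgen a) k).symm
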